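/- **Setting.** Let $A$ be a finite-dimensional unital complex algebra (e.g. $A=M_n(\mathbb C)$) and let $G\subset G^{\mathbb C}\subset A^\times$ be closed subgroups ("matrix groups") with Lie algebras $\mathfrak g,\mathfrak g^{\mathbb C}$, where $G^{\mathbb C}$ is a complexification of $G$: $\mathfrak g^{\mathbb C}=\mathfrak g\oplus i\mathfrak g$. (For instance $G$ semisimple.) Let $\sigma$ be an automorphism of $G$ of order $k\ge 2$, extended to a holomorphic automorphism of $G^{\mathbb C}$ with $\sigma^k=1$, and let $K\subset G$ be a closed subgroup with $\mathrm{Fix}_\sigma(G)^0\subset K\subset \mathrm{Fix}_\sigma(G)$. Put $\omega=e^{2\pi i/k}$, let $\mathfrak g_j$ be the $\omega^j$-eigenspace of $\sigma=d\sigma$ on $\mathfrak g^{\mathbb C}$, $\mathfrak k=\mathfrak g\cap\mathfrak g_0$, $\mathfrak m^{\mathbb C}=\sum_{j\not\equiv0}\mathfrak g_j$, $\mathfrak m=\mathfrak g\cap\mathfrak m^{\mathbb C}$; a bar denotes conjugation of $\mathfrak g^{\mathbb C}$ with respect to $\mathfrak g$. The space $G/K$ carries a (possibly indefinite) metric induced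 from a bi-invariant metric on $G$ for which $\mathfrak k\perp\mathfrak m$. *Loops.* $\Lambda G^{\mathbb C}_\sigma$ is the group of continuous $\gamma:S^1\to G^{\mathbb C}$ with $\sigma(\gamma(\lambda))=\gamma(\omega\lambda)$; $\Lambda G_\sigma$ is its subgroup of $G$-valued loops; $\Lambda^+G^{\mathbb C}_\sigma$ is the subgroup of those $\gamma$ that extend to a $G^{\mathbb C}$-valued map, continuous on the closed unit disk and holomorphic inside. $\Lambda\mathfrak g_\sigma$ is the space of continuous $D:S^1\to\mathfrak g$ with $\sigma(D(\lambda))=D(\omega\lambda)$. Maps into loop groups are called smooth if they are smooth as maps into the Banach algebra $C(S^1,A)$ with the supremum norm. An Iwasawa decomposition of a loop $C$ is a factorization $C=F\,W$ with $F\in\Lambda G_\sigma$, $W\in\Lambda^+G^{\mathbb C}_\sigma$; we also say that $F=CV$ is an Iwasawa decomposition of $C$, where $V=W^{-1}$. *Maps.* For an open interval $J\ni 0$ let $\mathbb S=\{z=u+iv: v\in J\}$. A frame of $f:\mathbb S\to G/K$ is a smooth $F:\mathbb S\to G$ with $f=F \bmod K$. Write $F^{-1}dF=\alpha'dz+\alpha''d\bar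 z$, decompose $\alpha'=\alpha'_{\mathfrak m}+\alpha'_{\mathfrak k}$, $\alpha''=\alpha''_{\mathfrak m}+\alpha''_{\mathfrak k}$ according to $\mathfrak g^{\mathbb C}=\mathfrak m^{\mathbb C}\oplus\mathfrak k^{\mathbb C}$, and put for $\lambda\in S^1$ $$\alpha_\lambda=\alpha'_\lambda dz+\alpha''_\lambda d\bar z,\qquad \alpha'_\lambda=\lambda^{-1}\alpha'_{\mathfrak m}+\alpha'_{\mathfrak k},\quad \alpha''_\lambda=\lambda\alpha''_{\mathfrak m}+\alpha''_{\mathfrak k}.$$ A smooth map $f$ is harmonic if it is a critical point of the energy under smooth compactly supported variations. It is primitive harmonic if it is harmonic and has a frame such that $\alpha'_{\mathfrak m}\in\mathfrak g_{-1}$, $\alpha''_{\mathfrak m}\in\mathfrak g_{1}$ and $\alpha_\lambda$ is integrable ($d\alpha_\lambda+\alpha_\lambda\wedge\alpha_\lambda=0$) for all $\lambda\in S^1$. It is translationally equivariant (TE) if $f(z+t)=R(t)f(z)$ for all $t\in\mathbb R$, $z\in\mathbb S$, with a continuous one-parameter group $R$ in $G$. An extended frame of $f$ is a smooth family of loops $F(z,\bar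 z,\lambda)$, $z\in\mathbb S$, $\lambda\in S^1$, in $A^\times$, such that $F(\cdot,\lambda=1)$ is a frame of $f$, $F(0,0,\lambda)=I$, and $F(\cdot,\lambda)^{-1}dF(\cdot,\lambda)=\alpha_\lambda$ for all $\lambda\in S^1$, where $\alpha_\lambda$ is made from the frame $F(\cdot,1)$. **Theorem.** (1) Let $f:\mathbb S\to G/K$ be a TE primitive harmonic map and $F$ an extended frame of $f$ such that $F(z+t,\bar z+t,\lambda)=e^{tD(\lambda)}F(z,\bar z,\lambda)$ for all $t\in\mathbb R$, $z\in\mathbb S$, with a continuous $D:S^1\to A$. Then $$D(\lambda)=\alpha'_\lambda(0)+\alpha''_\lambda(0)=\lambda^{-1}\alpha'_{\mathfrak m}(0)+\alpha'_{\mathfrak k}(0)+\alpha''_{\mathfrak k}(0)+\lambda\alpha''_{\mathfrak m}(0)\in\Lambda\mathfrak g_\sigma .$$ Put $V(v,\lambda)=e^{-ivD(\lambda)}F(iv,-iv,\lambda)$, $v\in J$. Then $V$ is smooth in $v$, takes values in $\Lambda^+G^{\mathbb C}_\sigma$, and with $v=\operatorname{Im}z=-\tfrac i2(z-\bar z)$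 $$V_v=-2iV\alpha''_\lambda,\qquad V(0,\lambda)=I,\qquad \alpha'_\lambda+\alpha''_\lambda=V^{-1}D(\lambda)V .$$ Moreover, for every $z\in\mathbb S$, $F(z,\bar z,\lambda)=e^{zD(\lambda)}V(v,\lambda)$, and this is an Iwasawa decomposition of $e^{zD(\lambda)}$; in particular $F(z,\bar z,\cdot)\in\Lambda G_\sigma$. (2) Conversely, let $D\in\Lambda\mathfrak g_\sigma$ be of the form $D(\lambda)=\lambda^{-1}D_{-1}+D_0+\lambda D_1$ with $D_0\in\mathfrak k$ and $D_{-1},D_1\in\mathfrak m^{\mathbb C}$, let $\varepsilon>0$, and let $V:(-\varepsilon,\varepsilon)\to\Lambda^+G^{\mathbb C}_\sigma$ be a smooth map such that, for some $\widetilde\alpha''_\lambda(v)$, $$V_v=-2iV\widetilde\alpha''_\lambda,\qquad V(0,\lambda)=I,\qquad V^{-1}D(\lambda)V=\overline{\widetilde\alpha''_\lambda}+\widetilde\alpha''_\lambda\qquad(\lambda\in S^1).$$ Then on the strip $|\operatorname{Im}z|<\varepsilon$, with $v=\operatorname{Im} z$, $\widetilde F(z,\bar z,\lambda)=e^{zD(\lambda)}V(v,\lambda)$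 is an Iwasawa decomposition of $e^{zD(\lambda)}$ (in particular $\widetilde F(z,\bar z,\cdot)\in\Lambda G_\sigma$); for every $\lambda\in S^1$ the map $\widetilde f(z,\bar z,\lambda)=\widetilde F(z,\bar z,\lambda)\bmod K$ is a TE primitive harmonic map into $G/K$; and $$\widetilde F^{-1}d\widetilde F=\widetilde\alpha'_\lambda dz+\widetilde\alpha''_\lambda d\bar z,\qquad \widetilde\alpha'_\lambda=\overline{\widetilde\alpha''_\lambda}=V^{-1}D(\lambda)V-\tfrac i2V^{-1}V_v .$$ -/

import Mathlib

open scoped ContDiff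

/-- The continuous loops `S¹ → A`, a Banach algebra under the supremum norm.  Its unit group
`(Loop A)ˣ` consists of the loops with values in the unit group `Aˣ`. -/
abbrev Loop (A : Type*) [NormedRing A] : Type _ := C(Circle, A)

section Calculus

variable {A : Type*} [NormedRing A] [NormedAlgebra ℂ A]

/-- The Lie algebra of a closed subgroup of `Aˣ`. -/
def lieAlg (H : Subgroup Aˣ) : Set A :=
  {X | ∀ t : ℝ, ∃ h ∈ H, (h : A) = NormedSpace.exp (t • X)}

/-- The `∂/∂u`-coefficient of `F⁻¹ dF`, where `z = u + iv`. -/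
noncomputable def mcU (F : ℂ → A) (z : ℂ) : A :=
  Ring.inverse (F z) * fderiv ℝ F z 1

/-- The `∂/∂v`-coefficient of `F⁻¹ dF`, where `z = u + iv`. -/
noncomputable def mcV (F : ℂ → A) (z : ℂ) : A :=
  Ring.inverse (F z) * fderiv ℝ F z Complex.I

/-- The Wirtinger derivative `∂F/∂z = (F_u - i F_v)/2`. -/
noncomputable def dZ (F : ℂ → A) (z : ℂ) : A :=
  (1 / 2 : ℂ) • (fderiv ℝ F z 1 - Complex.I • fderiv ℝ F z Complex.I)

/-- The Wirtinger derivative `∂F/∂z̄ = (F_u + i F_v)/2`. -/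
noncomputable def dZbar (F : ℂ → A) (z : ℂ) : A :=
  (1 / 2 : ℂ) • (fderiv ℝ F z 1 + Complex.I • fderiv ℝ F z Complex.I)

/-- The coefficient `α'` of the Maurer-Cartan form `F⁻¹ dF = α' dz + α'' dz̄`. -/
noncomputable def mcZ (F : ℂ → A) (z : ℂ) : A := Ring.inverse (F z) * dZ F z

/-- The coefficient `α''` of the Maurer-Cartan form `F⁻¹ dF = α' dz + α'' dz̄`. -/
noncomputable def mcZbar (F : ℂ → A) (z : ℂ) : A := Ring.inverse (F z) * dZbar F z

/-- Integrability `dα + α ∧ α = 0` of the one-form `α = a dz + b dz̄` on `S`. -/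
def IsIntegrableForm (S : Set ℂ) (a b : ℂ → A) : Prop :=
  ∀ z ∈ S, dZ b z - dZbar a z + (a z * b z - b z * a z) = 0

end Calculus

/-- The strip `{u + iv : v ∈ J}` parallel to the real axis. -/
def strip (J : Set ℝ) : Set ℂ := {z | z.im ∈ J}

/-- A `k`-symmetric space `G/K`.  The groups are closed groups of units of the finite-dimensional
complex algebra `A` (matrix groups, if `A` is a matrix algebra); `GC` is a complexification of `G`,
and `σ` is the automorphism of `G` of order `k`, extended holomorphically to `GC`. -/
structure KSymmetricSpace (A : Type*) [NormedRing A] [NormedAlgebra ℂ A] where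
  /-- the complexified group -/
  GC : Subgroup Aˣ
  /-- the real group -/
  G : Subgroup Aˣ
  /-- the isotropy group -/
  K : Subgroup Aˣ
  /-- the order of the automorphism -/
  k : ℕ
  /-- the automorphism -/
  σ : MulAut GC
  /-- the complex linear differential of `σ` (only its restriction to the Lie algebra of `GC`
  matters) -/
  dσ : A →ₗ[ℂ] A
  isClosed_GC : IsClosed (GC : Set Aˣ)
  isClosed_G : IsClosed (G : Set Aˣ)
  isClosed_K : IsClosed (K : Set Aˣ)
  two_le_k : 2 ≤ k
  G_le_GC : G ≤ GC
  /-- `𝔤^ℂ = 𝔤 + i𝔤` -/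
  complexification : ∀ X : A, X ∈ lieAlg GC ↔
    ∃ a ∈ lieAlg G, ∃ b ∈ lieAlg G, X = a + Complex.I • b
  /-- `𝔤 ∩ i𝔤 = 0` -/
  totally_real : ∀ X ∈ lieAlg G, Complex.I • X ∈ lieAlg G → X = 0
  /-- `σ` is holomorphic with differential `dσ`: `σ (exp X) = exp (dσ X)` on `𝔤^ℂ` -/
  σ_exp : ∀ X ∈ lieAlg GC, ∀ g : GC, ((g : Aˣ) : A) = NormedSpace.exp X →
    ((σ g : Aˣ) : A) = NormedSpace.exp (dσ X)
  σ_continuous : Continuous fun g : GC => σ g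
  σ_mem_G : ∀ g : GC, (g : Aˣ) ∈ G → (σ g : Aˣ) ∈ G
  σ_pow : σ ^ k = 1
  σ_order : ∀ j : ℕ, 0 < j → j < k → ∃ g : GC, (g : Aˣ) ∈ G ∧ (σ ^ j) g ≠ g
  /-- `K ⊆ Fix_σ(G)` -/
  K_le_fix : ∀ g ∈ K, g ∈ G ∧ ∃ h : g ∈ GC, (σ ⟨g, h⟩ : Aˣ) = g
  /-- `Fix_σ(G)⁰ ⊆ K` -/
  fix_component_le_K :
    connectedComponentIn {g : Aˣ | g ∈ G ∧ ∃ h : g ∈ GC, (σ ⟨g, h⟩ : Aˣ) = g} 1 ⊆ (K : Set Aˣ)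

namespace KSymmetricSpace

variable {A : Type*} [NormedRing A] [NormedAlgebra ℂ A] (M : KSymmetricSpace A)

/-- The homogeneous space `G/K`. -/
abbrev Quot : Type _ := M.G ⧸ M.K.subgroupOf M.G

/-- The root of unity `ω = e^{2πi/k}`. -/
noncomputable def omega : Circle := Circle.exp (2 * Real.pi / M.k)

/-- The eigenspace `𝔤_j` of `σ` in `𝔤^ℂ` for the eigenvalue `ω^j`. -/
def gr (j : ℤ) : Set A := {X | X ∈ lieAlg M.GC ∧ M.dσ X = ((M.omega : ℂ) ^ j) • X}

/-- `𝔨 = 𝔤 ∩ 𝔤_0`. -/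
def kAlg : Set A := lieAlg M.G ∩ M.gr 0

/-- `𝔪^ℂ = ∑_{j ≠ 0} 𝔤_j`. -/
noncomputable def mAlgC : Submodule ℂ A := Submodule.span ℂ (⋃ j ∈ Set.Ioo (0 : ℤ) M.k, M.gr j)

/-- `𝔪 = 𝔤 ∩ 𝔪^ℂ`. -/
def mAlg : Set A := lieAlg M.G ∩ M.mAlgC

/-- The component in `𝔤_0 = 𝔨^ℂ` of an element of `𝔤^ℂ = 𝔨^ℂ ⊕ 𝔪^ℂ`, obtained by averaging over
the powers of `σ`. -/
noncomputable def kPart (X : A) : A :=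
  (M.k : ℂ)⁻¹ • ∑ l ∈ Finset.range M.k, (M.dσ ^ l) X

/-- The component in `𝔪^ℂ` of an element of `𝔤^ℂ = 𝔨^ℂ ⊕ 𝔪^ℂ`. -/
noncomputable def mPart (X : A) : A := X - M.kPart X

open Classical in
/-- Complex conjugation `a + ib ↦ a - ib` (`a, b ∈ 𝔤`) of `𝔤^ℂ` with respect to `𝔤`
(zero outside `𝔤^ℂ`). -/
noncomputable def conj (X : A) : A :=
  if h : ∃ p : A × A, p.1 ∈ lieAlg M.G ∧ p.2 ∈ lieAlg M.G ∧ X = p.1 + Complex.I • p.2 then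
    h.choose.1 - Complex.I • h.choose.2
  else 0

/-- A metric on `G/K` induced from a bi-invariant (possibly indefinite) metric on `G`, given by an
`Ad(G)`-invariant scalar product on `𝔤` for which `𝔨 ⊥ 𝔪`. -/
structure IsInvariantMetric (B : A →ₗ[ℝ] A →ₗ[ℝ] ℝ) : Prop where
  symm : ∀ X ∈ lieAlg M.G, ∀ Y ∈ lieAlg M.G, B X Y = B Y X
  invariant : ∀ g ∈ M.G, ∀ X ∈ lieAlg M.G, ∀ Y ∈ lieAlg M.G,
    B ((g : A) * X * ((g⁻¹ : Aˣ) : A)) ((g : A) * Y * ((g⁻¹ : Aˣ) : A)) = B X Y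
  nondegenerate : ∀ X ∈ lieAlg M.G, (∀ Y ∈ lieAlg M.G, B X Y = 0) → X = 0
  orthogonal : ∀ X ∈ M.kAlg, ∀ Y ∈ M.mAlg, B X Y = 0

/-! ### Maps into `G/K`, frames, harmonicity -/

/-- `F : S → G` is a (smooth) frame of `f : S → G/K`. -/
def IsFrame (S : Set ℂ) (f : ℂ → M.Quot) (F : ℂ → A) : Prop :=
  ContDiffOn ℝ ∞ F S ∧
    ∀ z ∈ S, ∃ g : M.G, ((g : Aˣ) : A) = F z ∧ f z = (g : M.Quot)

/-- The energy density of the map with frame `F`: half the sum of the squared lengths of the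
two partial derivatives in `T(G/K) ≅ 𝔪`. -/
noncomputable def energyDensity (B : A →ₗ[ℝ] A →ₗ[ℝ] ℝ) (F : ℂ → A) (z : ℂ) : ℝ :=
  (1 / 2) * (B (M.mPart (mcU F z)) (M.mPart (mcU F z)) +
    B (M.mPart (mcV F z)) (M.mPart (mcV F z)))

/-- `f : S → G/K` is a smooth harmonic map: a critical point of the energy under all smooth
variations `f_t`, `f_0 = f`, which are constant in `t` outside a compact set `C ⊆ S`.  The
variation is given by a smooth lift `Φ_t` to `G`. -/
def IsHarmonic (B : A →ₗ[ℝ] A →ₗ[ℝ] ℝ) (S : Set ℂ) (f : ℂ → M.Quot) : Prop :=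
  (∃ F : ℂ → A, M.IsFrame S f F) ∧
    ∀ (C : Set ℂ) (ft : ℝ → ℂ → M.Quot) (Φ : ℝ → ℂ → A),
      IsCompact C → C ⊆ S →
      (∀ z ∈ S, ft 0 z = f z) →
      (∀ t : ℝ, ∀ z ∈ S \ C, ft t z = f z) →
      ContDiffOn ℝ ∞ (fun p : ℝ × ℂ => Φ p.1 p.2) (Set.univ ×ˢ S) →
      (∀ t : ℝ, M.IsFrame S (ft t) (Φ t)) →
      HasDerivAt (fun t : ℝ => ∫ z in C, M.energyDensity B (Φ t) z) 0 0

/-- The coefficient `α'_λ = λ⁻¹ α'_𝔪 + α'_𝔨` of the form `α_λ = α'_λ dz + α''_λ dz̄` made from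
`α = F⁻¹ dF`. -/
noncomputable def alphaZ (F : ℂ → A) (l : Circle) (z : ℂ) : A :=
  (l : ℂ)⁻¹ • M.mPart (mcZ F z) + M.kPart (mcZ F z)

/-- The coefficient `α''_λ = λ α''_𝔪 + α''_𝔨` of the form `α_λ = α'_λ dz + α''_λ dz̄` made from
`α = F⁻¹ dF`. -/
noncomputable def alphaZbar (F : ℂ → A) (l : Circle) (z : ℂ) : A :=
  (l : ℂ) • M.mPart (mcZbar F z) + M.kPart (mcZbar F z)

/-- `f : S → G/K` is primitive harmonic: it is harmonic, and the Maurer-Cartan form of a frame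
satisfies `α'_𝔪 ∈ 𝔤_{-1}`, `α''_𝔪 ∈ 𝔤_1`, and `α_λ` is integrable for all `λ ∈ S¹`. -/
def IsPrimitiveHarmonic (B : A →ₗ[ℝ] A →ₗ[ℝ] ℝ) (S : Set ℂ) (f : ℂ → M.Quot) : Prop :=
  M.IsHarmonic B S f ∧
    ∃ F : ℂ → A, M.IsFrame S f F ∧
      (∀ z ∈ S, M.mPart (mcZ F z) ∈ M.gr (-1) ∧ M.mPart (mcZbar F z) ∈ M.gr 1) ∧
      ∀ l : Circle, IsIntegrableForm S (M.alphaZ F l) (M.alphaZbar F l)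

/-- `f` is translationally equivariant (TE) on the strip `S`: `f (z + t) = R(t) f(z)` for a
one-parameter group `R` in `G`. -/
def IsTE (S : Set ℂ) (f : ℂ → M.Quot) : Prop :=
  ∃ R : ℝ → M.G, Continuous R ∧ (∀ s t : ℝ, R (s + t) = R s * R t) ∧
    ∀ t : ℝ, ∀ z ∈ S, f (z + t) = R t • f z

/-! ### Loop groups and loop algebras -/

/-- `γ ∈ Λ G^ℂ_σ`: a loop in `G^ℂ` with `σ (γ(λ)) = γ(ωλ)`. -/
def IsTwistedLoop (γ : (Loop A)ˣ) : Prop :=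
  ∀ l : Circle, ∃ g : M.GC, ((g : Aˣ) : A) = (γ : Loop A) l ∧
    ((M.σ g : Aˣ) : A) = (γ : Loop A) (M.omega * l)

/-- `γ ∈ Λ G_σ`: a twisted loop with values in `G`. -/
def IsRealLoop (γ : (Loop A)ˣ) : Prop :=
  M.IsTwistedLoop γ ∧ ∀ l : Circle, ∃ g ∈ M.G, (g : A) = (γ : Loop A) l

/-- `γ ∈ Λ⁺ G^ℂ_σ`: a twisted loop which extends holomorphically to the unit disk, with values in
`G^ℂ`. -/
def IsPlusLoop (γ : (Loop A)ˣ) : Prop :=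
  M.IsTwistedLoop γ ∧ ∃ Γ : ℂ → A, DiffContOnCl ℂ Γ (Metric.ball 0 1) ∧
    (∀ w ∈ Metric.closedBall (0 : ℂ) 1, ∃ g ∈ M.GC, (g : A) = Γ w) ∧
    ∀ l : Circle, Γ l = (γ : Loop A) l

/-- `D ∈ Λ 𝔤_σ`: a loop in `𝔤` with `σ (D(λ)) = D(ωλ)`. -/
def IsRealLoopAlg (D : Loop A) : Prop :=
  ∀ l : Circle, D l ∈ lieAlg M.G ∧ M.dσ (D l) = D (M.omega * l)

/-- `C = F · W` is an Iwasawa decomposition: `F ∈ Λ G_σ` and `W ∈ Λ⁺ G^ℂ_σ`. -/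
def IsIwasawa (C : Loop A) (F W : (Loop A)ˣ) : Prop :=
  M.IsRealLoop F ∧ M.IsPlusLoop W ∧ C = (F : Loop A) * (W : Loop A)

/-- `F` is an extended frame of `f : S → G/K`, normalized at `z = 0`: at `λ = 1` it is a frame of
`f`, `F(0, λ) = e`, and `F(·, λ)⁻¹ dF(·, λ) = α_λ` for all `λ ∈ S¹`. -/
def IsExtendedFrame (S : Set ℂ) (f : ℂ → M.Quot) (F : ℂ → (Loop A)ˣ) : Prop :=
  ContDiffOn ℝ ∞ (fun z => (F z : Loop A)) S ∧
    F 0 = 1 ∧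
    M.IsFrame S f (fun z => (F z : Loop A) 1) ∧
    ∀ l : Circle, ∀ z ∈ S,
      mcZ (fun w => (F w : Loop A) l) z = M.alphaZ (fun w => (F w : Loop A) 1) l z ∧
      mcZbar (fun w => (F w : Loop A) l) z = M.alphaZbar (fun w => (F w : Loop A) 1) l z

end KSymmetricSpace

/-!
The loops `S¹ → A` form a Banach algebra `Loop A`, and the loop groups `ΛG_σ` and `Λ⁺G^ℂ_σ` are
closed subgroups of its unit group (`KSymmetricSpace.realLoops`, `KSymmetricSpace.plusLoops`); for
the second one closedness rests on the maximum principle.  The basic tool is the Lie theory of a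
closed subgroup `H` of the units of a Banach algebra, with Lie algebra
`lieAlg H = {X | exp (tX) ∈ H for all real t}`: a velocity at `1` of a curve in `H` lies in
`lieAlg H` (`mem_lieAlg_of_hasDerivAt`), and a solution of `g' = g X` with `X` in `lieAlg H` which
starts in `H` stays in `H` (`mem_subgroup_of_hasDerivAt`).  The second fact is Grönwall's inequality
for the distance to `H`, so neither a manifold structure on `H` nor existence of solutions is
needed.

*From the map to the potential* (`KSymmetricSpace.iwasawa_of_equivariant`).  Differentiating
`F(z + t) = exp(tD) F(z)` in `t` gives `F⁻¹ F_u = F⁻¹ D F`, which is `D` at `z = 0`.  So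
`D = α'_λ(0) + α''_λ(0)`, and `V(v) = exp(-ivD) F(iv)` satisfies `V_v = -2i V α''_λ` and
`V⁻¹ D V = α'_λ + α''_λ`.  Primitivity is a condition on one frame, but it is invariant under the
gauge group `K` and hence holds for the frame `F(·, 1)`.  Therefore `α''_λ = λ α''_𝔪 + α''_𝔨` lies
in the Lie algebra of `Λ⁺G^ℂ_σ`, both components of `α_λ` lie in that of `ΛG_σ`, and both
memberships of the Iwasawa decomposition follow from the flow invariance above.

*From the potential to the map* (`KSymmetricSpace.equivariant_of_iwasawa`).  Since `V` is a curve of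
plus loops, `a = α̃''` extends holomorphically to the disk.  Since `ā = V⁻¹ D V - a`, where `λ D`
extends to the disk, so does `λ ā`.  A loop `a` with both properties is `b₀ + λ b₁`
(`eq_linearLoop_of_forall_dual`), and the twisting condition puts `b₀` into `𝔤₀` and `b₁` into `𝔤₁`.
Hence the Maurer-Cartan form of `F̃ = exp(zD) V`, with components `ā` and `a`, has the required shape
and is real; flow invariance shows that `F̃` takes values in `ΛG_σ`.  Integrability of the family
`α_λ` is the Maurer-Cartan equation of `F̃`.

*Harmonicity.*  The `λ`-coefficients of the Maurer-Cartan equation of `α_λ` give the harmonic map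
equation for a frame, in the form used in `KSymmetricSpace.IsHarmonicFrame`.  A variation of the map
through frames `F_t` has a velocity `Y = F⁻¹ ∂_t F`; by invariance of the metric the derivative of
the energy density is then the divergence of `B(Y, α_𝔪)`.  Outside the support of the variation `Y`
has values in `𝔨`, which is orthogonal to `𝔪`, so the integral of this divergence vanishes
(`KSymmetricSpace.isHarmonic_of_isHarmonicFrame`).
-/

section

open scoped Topology
open Filter Set NormedSpace

set_option linter.unusedSectionVars false

/-! ### Closed subgroups of the units of a Banach algebra -/

section LieTheory

variable {R : Type*} [NormedRing R]

theorem tendsto_slope_norm_smul {E : Type*} [NormedAddCommGroup E] [NormedSpace ℝ E]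
    {f : ℝ → E} {f' : E} {x : ℝ} (h : HasDerivWithinAt f f' (Ioi x) x) :
    Tendsto (fun z => (z - x)⁻¹ * ‖f z - f x‖) (𝓝[>] x) (𝓝 ‖f'‖) := by
  have h1 := (hasDerivWithinAt_iff_tendsto_slope' (self_notMem_Ioi)).1 h
  refine h1.norm.congr' ?_
  filter_upwards [self_mem_nhdsWithin] with z hz
  have : (0 : ℝ) ≤ (z - x)⁻¹ := inv_nonneg.2 (sub_nonneg.2 (le_of_lt hz))
  rw [slope_def_module, norm_smul, Real.norm_of_nonneg this]

/-- Flow invariance: a solution of `g' = g X` starting in `S` stays at distance zero from `S`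
if right multiplication by some curve through `1` with velocity `X` preserves `S`.  This is
Grönwall's inequality for the distance to `S`. -/
theorem infDist_eq_zero_of_hasDerivWithinAt [NormedAlgebra ℝ R] {S : Set R} {g X : ℝ → R} {b K : ℝ}
    (hg : ContinuousOn g (Icc 0 b))
    (hd : ∀ x ∈ Ico 0 b, HasDerivWithinAt g (g x * X x) (Ioi x) x)
    (hK : ∀ x ∈ Ico 0 b, ‖X x‖ ≤ K)
    (hS : ∀ x ∈ Ico 0 b, ∃ γ : ℝ → R, γ 0 = 1 ∧ HasDerivAt γ (X x) 0 ∧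
      ∀ᶠ s in 𝓝[>] 0, ∀ y ∈ S, y * γ s ∈ S)
    (h0 : g 0 ∈ S) : ∀ x ∈ Icc 0 b, Metric.infDist (g x) S = 0 := by
  intro x hx
  have hne : S.Nonempty := ⟨_, h0⟩
  have key := le_gronwallBound_of_liminf_deriv_right_le
    (f := fun x => Metric.infDist (g x) S) (f' := fun x => ‖X x‖ * Metric.infDist (g x) S)
    (δ := 0) (K := K) (ε := 0) (a := 0) (b := b)
    ((Metric.continuous_infDist_pt S).comp_continuousOn hg) ?_ ?_ ?_ x hx
  · simp only [gronwallBound_ε0, zero_mul] at key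
    exact le_antisymm key Metric.infDist_nonneg
  · intro y hy r hr
    obtain ⟨γ, hγ0, hγ, hγS⟩ := hS y hy
    -- the curve `g y * γ (z - y)` is tangent to `g` at `y`
    have hγ' : HasDerivAt (fun z => γ (z - y)) (X y) y := by
      have : HasDerivAt γ (X y) (y - y) := by simpa using hγ
      simpa using this.comp_sub_const y y
    have hdiff : HasDerivWithinAt (fun z => g z - g y * γ (z - y)) 0 (Ioi y) y := by
      simpa using (hd y hy).fun_sub ((hγ'.const_mul (g y)).hasDerivWithinAt)
    have t1 := tendsto_slope_norm_smul hdiff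
    have t2 := (tendsto_slope_norm_smul hγ'.hasDerivWithinAt (x := y)).mul_const
      (Metric.infDist (g y) S)
    have t3 := t1.add t2
    simp only [norm_zero, zero_add, sub_self, hγ0, mul_one, sub_zero] at t3
    refine Eventually.frequently ?_
    have hsub : Tendsto (fun z => z - y) (𝓝[>] y) (𝓝[>] 0) := by
      refine tendsto_nhdsWithin_iff.2 ⟨?_, ?_⟩
      · have : Tendsto (fun z => z - y) (𝓝 y) (𝓝 (y - y)) :=
          (continuous_id.sub continuous_const).tendsto y
        simp only [sub_self] at this
        exact this.mono_left nhdsWithin_le_nhds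
      · filter_upwards [self_mem_nhdsWithin] with z hz
        exact sub_pos.2 (mem_Ioi.1 hz)
    filter_upwards [t3.eventually_lt_const hr, hsub.eventually hγS, self_mem_nhdsWithin]
      with z hz1 hz2 hz3
    refine lt_of_le_of_lt ?_ hz1
    have hpos : 0 < (z - y)⁻¹ := inv_pos.2 (sub_pos.2 (mem_Ioi.1 hz3))
    rw [mul_assoc, ← mul_add]
    refine mul_le_mul_of_nonneg_left ?_ hpos.le
    have hle : ∀ s ∈ S, Metric.infDist (g z) S - ‖g z - g y * γ (z - y)‖ ≤
        dist (g y) s * (1 + ‖γ (z - y) - 1‖) := by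
      intro s hs
      have e1 : Metric.infDist (g z) S ≤ dist (g z) (s * γ (z - y)) :=
        Metric.infDist_le_dist_of_mem (hz2 s hs)
      have e2 : g z - s * γ (z - y) =
        (g z - g y * γ (z - y)) + ((g y - s) + (g y - s) * (γ (z - y) - 1)) := by noncomm_ring
      rw [dist_eq_norm, e2] at e1
      have e3 := norm_add_le (g z - g y * γ (z - y)) ((g y - s) + (g y - s) * (γ (z - y) - 1))
      have e4 := norm_add_le (g y - s) ((g y - s) * (γ (z - y) - 1))
      have e5 := norm_mul_le (g y - s) (γ (z - y) - 1)
      rw [dist_eq_norm]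
      linarith
    have hpos' : 0 < 1 + ‖γ (z - y) - 1‖ := by positivity
    have := (Metric.le_infDist (x := g y) hne).2 fun {s} hs => (div_le_iff₀ hpos').2 (hle s hs)
    rw [div_le_iff₀ hpos'] at this
    linarith
  · simp [Metric.infDist_zero_of_mem h0]
  · intro y hy
    simp only [add_zero]
    exact mul_le_mul_of_nonneg_right (hK y hy) Metric.infDist_nonneg

theorem lieAlg_mono [NormedAlgebra ℂ R] {H H' : Subgroup Rˣ} (h : H ≤ H') : lieAlg H ⊆ lieAlg H' := by
  intro X hX t
  obtain ⟨g, hg, e⟩ := hX t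
  exact ⟨g, h hg, e⟩

variable [CompleteSpace R]

theorem mem_subgroup_of_val_mem_closure {H : Subgroup Rˣ} (hH : IsClosed (H : Set Rˣ)) {g : Rˣ}
    (hg : (g : R) ∈ closure (Units.val '' (H : Set Rˣ))) : g ∈ H := by
  have := (Units.isOpenEmbedding_val (R := R)).isInducing.closure_eq_preimage_closure_image
    (H : Set Rˣ)
  rw [hH.closure_eq] at this
  have h2 : g ∈ Units.val ⁻¹' closure (Units.val '' (H : Set Rˣ)) := hg
  rw [← this] at h2
  exact h2

variable [NormedAlgebra ℂ R]

theorem hasDerivAt_exp_smul_zero (X : R) : HasDerivAt (fun t : ℝ => exp (t • X)) X 0 := by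
  simpa using hasDerivAt_exp_smul_const X (0 : ℝ)

/-- A solution of `g' = g X`, where `X v` is tangent at `1` to a curve in the closed subgroup `H`,
stays in `H` for positive times. -/
theorem mem_subgroup_of_hasDerivAt_of_tangent {H : Subgroup Rˣ} (hH : IsClosed (H : Set Rˣ))
    {g : ℝ → Rˣ} {X : ℝ → R} {b : ℝ} (hb : 0 ≤ b)
    (hd : ∀ v ∈ Icc 0 b, HasDerivAt (fun s => (g s : R)) (g v * X v) v)
    (hX : ContinuousOn X (Icc 0 b))
    (hXH : ∀ v ∈ Icc 0 b, ∃ γ : ℝ → R, γ 0 = 1 ∧ HasDerivAt γ (X v) 0 ∧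
      ∀ᶠ s in 𝓝[>] 0, ∃ h ∈ H, (h : R) = γ s)
    (h0 : g 0 ∈ H) : g b ∈ H := by
  obtain ⟨K, hK⟩ := isCompact_Icc.exists_bound_of_continuousOn hX
  have := infDist_eq_zero_of_hasDerivWithinAt (S := Units.val '' (H : Set Rˣ))
    (g := fun v => (g v : R)) (X := X) (b := b) (K := K)
    (fun v hv => (hd v hv).continuousAt.continuousWithinAt)
    (fun v hv => (hd v (Ico_subset_Icc_self hv)).hasDerivWithinAt)
    (fun v hv => hK v (Ico_subset_Icc_self hv))
    (fun v hv => by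
      obtain ⟨γ, h1, h2, h3⟩ := hXH v (Ico_subset_Icc_self hv)
      refine ⟨γ, h1, h2, ?_⟩
      filter_upwards [h3] with s hs
      rintro _ ⟨y, hy, rfl⟩
      obtain ⟨h, hh, hhs⟩ := hs
      exact ⟨y * h, H.mul_mem hy hh, by simp [hhs]⟩)
    ⟨_, h0, rfl⟩ b ⟨hb, le_rfl⟩
  exact mem_subgroup_of_val_mem_closure hH
    ((Metric.mem_closure_iff_infDist_zero (Set.Nonempty.image _ ⟨1, H.one_mem⟩)).2 this)

/-- The Lie algebra of a closed subgroup consists of the velocities at `1` of its curves. -/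
theorem mem_lieAlg_of_hasDerivAt {H : Subgroup Rˣ} (hH : IsClosed (H : Set Rˣ)) {γ : ℝ → R} {X : R}
    (h0 : γ 0 = 1) (hd : HasDerivAt γ X 0) (hγ : ∀ᶠ s in 𝓝 0, ∃ h ∈ H, (h : R) = γ s) :
    X ∈ lieAlg H := by
  have hpos : ∀ (Y : R) (γ : ℝ → R), γ 0 = 1 → HasDerivAt γ Y 0 →
      (∀ᶠ s in 𝓝 0, ∃ h ∈ H, (h : R) = γ s) → ∀ t : ℝ, 0 ≤ t → ∃ h ∈ H, (h : R) = exp (t • Y) := by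
    intro Y γ h0 hd hγ t ht
    let _ : NormedAlgebra ℚ R := .restrictScalars ℚ ℂ R
    let g : ℝ → Rˣ := fun s => (isUnit_exp (s • Y)).unit
    have hg : ∀ s, (g s : R) = exp (s • Y) := fun s => rfl
    refine ⟨g t, ?_, rfl⟩
    refine mem_subgroup_of_hasDerivAt_of_tangent hH (X := fun _ => Y) ht ?_ continuousOn_const ?_ ?_
    · intro v _
      simp only [hg]
      exact hasDerivAt_exp_smul_const Y v
    · exact fun v _ => ⟨γ, h0, hd, hγ.filter_mono nhdsWithin_le_nhds⟩
    · have : g 0 = 1 := by ext; simp [hg]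
      rw [this]; exact H.one_mem
  intro t
  rcases le_total 0 t with ht | ht
  · exact hpos X γ h0 hd hγ t ht
  · have hneg : Tendsto (fun s : ℝ => -s) (𝓝 0) (𝓝 0) := by
      simpa using (continuous_neg (G := ℝ)).tendsto 0
    have := hpos (-X) (fun s => γ (-s)) (by simp [h0]) (by
      have h1 : HasDerivAt γ X (-0) := by simpa using hd
      simpa [Function.comp_def] using h1.scomp (0 : ℝ) (hasDerivAt_neg (0 : ℝ)))
      (hneg.eventually hγ) (-t) (by linarith)
    simpa using this

/-- A curve solving `g' = g X` with `X` in the Lie algebra of a closed subgroup stays in the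
subgroup. -/
theorem mem_subgroup_of_hasDerivAt {H : Subgroup Rˣ} (hH : IsClosed (H : Set Rˣ))
    {J : Set ℝ} (hJ : J.OrdConnected) (hJ0 : (0 : ℝ) ∈ J) {g : ℝ → Rˣ} {X : ℝ → R}
    (hd : ∀ v ∈ J, HasDerivAt (fun s => (g s : R)) (g v * X v) v)
    (hX : ContinuousOn X J) (hXH : ∀ v ∈ J, X v ∈ lieAlg H) (h0 : g 0 ∈ H) {v : ℝ} (hv : v ∈ J) :
    g v ∈ H := by
  have tan : ∀ Y ∈ lieAlg H, ∃ γ : ℝ → R, γ 0 = 1 ∧ HasDerivAt γ Y 0 ∧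
      ∀ᶠ s in 𝓝[>] 0, ∃ h ∈ H, (h : R) = γ s :=
    fun Y hY => ⟨_, by simp, hasDerivAt_exp_smul_zero Y, Eventually.of_forall fun s => hY s⟩
  rcases le_total 0 v with h | h
  · have hsub : Icc 0 v ⊆ J := hJ.out hJ0 hv
    exact mem_subgroup_of_hasDerivAt_of_tangent hH h (fun s hs => hd s (hsub hs))
      (hX.mono hsub) (fun s hs => tan _ (hXH s (hsub hs))) h0
  · have hsub : ∀ s ∈ Icc 0 (-v), -s ∈ J := fun s hs =>
      hJ.out hv hJ0 ⟨by linarith [hs.2], by linarith [hs.1]⟩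
    have := mem_subgroup_of_hasDerivAt_of_tangent hH (g := fun s => g (-s))
      (X := fun s => - X (-s)) (b := -v) (by linarith)
      (fun s hs => by
        have := (hd (-s) (hsub s hs)).scomp s (hasDerivAt_neg s)
        simpa [Function.comp_def] using this)
      ((hX.comp continuous_neg.continuousOn (fun s hs => hsub s hs)).neg)
      (fun s hs => tan _ (fun t => by simpa using hXH _ (hsub s hs) (-t)))
      (by simpa using h0)
    simpa using this

/-- The Lie algebra of a closed subgroup, as a real vector space. -/
def lieSubmodule (H : Subgroup Rˣ) (hH : IsClosed (H : Set Rˣ)) : Submodule ℝ R where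
  carrier := lieAlg H
  zero_mem' := fun t => ⟨1, H.one_mem, by simp⟩
  add_mem' := by
    intro X Y hX hY
    refine mem_lieAlg_of_hasDerivAt hH (γ := fun t => exp (t • X) * exp (t • Y)) (by simp) ?_ ?_
    · simpa using (hasDerivAt_exp_smul_zero X).fun_mul (hasDerivAt_exp_smul_zero Y)
    · refine Eventually.of_forall fun t => ?_
      obtain ⟨g, hg, eg⟩ := hX t
      obtain ⟨h, hh, eh⟩ := hY t
      exact ⟨g * h, H.mul_mem hg hh, by simp [eg, eh]⟩
  smul_mem' := by
    intro c X hX t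
    simpa [smul_smul] using hX (t * c)

theorem units_exp_conj (g : Rˣ) (X : R) :
    exp ((g : R) * X * ((g⁻¹ : Rˣ) : R)) = g * exp X * ((g⁻¹ : Rˣ) : R) := by
  let _ : NormedAlgebra ℚ R := .restrictScalars ℚ ℂ R
  exact exp_units_conj g X

theorem conj_mem_lieAlg {H : Subgroup Rˣ} {g : Rˣ} (hg : g ∈ H) {X : R} (hX : X ∈ lieAlg H) :
    (g : R) * X * ((g⁻¹ : Rˣ) : R) ∈ lieAlg H := by
  intro t
  obtain ⟨h, hh, e⟩ := hX t
  refine ⟨g * h * g⁻¹, H.mul_mem (H.mul_mem hg hh) (H.inv_mem hg), ?_⟩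
  rw [← smul_mul_assoc, ← mul_smul_comm, units_exp_conj, ← e]
  simp

theorem eq_of_exp_smul_eq {X Y : R} (h : ∀ t : ℝ, exp (t • X) = exp (t • Y)) : X = Y := by
  have hX := hasDerivAt_exp_smul_zero X
  rw [funext h] at hX
  exact hX.unique (hasDerivAt_exp_smul_zero Y)

theorem isClosed_lieAlg {H : Subgroup Rˣ} (hH : IsClosed (H : Set Rˣ)) :
    IsClosed (lieAlg H) := by
  let _ : NormedAlgebra ℚ R := .restrictScalars ℚ ℂ R
  have : lieAlg H = ⋂ t : ℝ, {X | (isUnit_exp (t • X)).unit ∈ H} := by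
    ext X
    simp only [lieAlg, mem_ofPred_eq, mem_iInter]
    refine forall_congr' fun t => ⟨?_, fun h => ⟨_, h, rfl⟩⟩
    rintro ⟨h, hh, e⟩
    convert hh
    ext
    exact e.symm
  rw [this]
  refine isClosed_iInter fun t => ?_
  refine hH.preimage (f := fun X => (isUnit_exp (t • X)).unit) ?_
  refine (Units.isOpenEmbedding_val (R := R)).isInducing.continuous_iff.2 ?_
  exact (exp_continuous (𝔸 := R)).comp (continuous_const_smul t)

theorem mem_submodule_of_hasDerivAt {E : Type*} [NormedAddCommGroup E] [NormedSpace ℝ E]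
    {P : Submodule ℝ E} (hP : IsClosed (P : Set E)) {f : ℝ → E} {f' : E} {x : ℝ}
    (hf : HasDerivAt f f' x) (h : ∀ᶠ s in 𝓝 x, f s ∈ P) : f' ∈ P := by
  have h1 := hasDerivAt_iff_tendsto_slope.1 hf
  refine hP.mem_of_tendsto h1 ?_
  filter_upwards [h.filter_mono nhdsWithin_le_nhds] with s hs
  rw [slope_def_module]
  exact P.smul_mem _ (P.sub_mem hs h.self_of_nhds)

theorem commutator_mem_lieAlg {H : Subgroup Rˣ} (hH : IsClosed (H : Set Rˣ)) {X Y : R}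
    (hX : X ∈ lieAlg H) (hY : Y ∈ lieAlg H) : X * Y - Y * X ∈ lieAlg H := by
  have hd : HasDerivAt (fun t : ℝ => exp (t • X) * Y * exp ((-t) • X)) (X * Y - Y * X) 0 := by
    have h1 := hasDerivAt_exp_smul_zero X
    have h2 : HasDerivAt (fun t : ℝ => exp ((-t) • X)) (-X) 0 := by
      have := hasDerivAt_exp_smul_zero (-X)
      simpa using this
    simpa [sub_eq_add_neg] using (h1.mul_const Y).fun_mul h2
  refine mem_submodule_of_hasDerivAt (P := lieSubmodule H hH) (isClosed_lieAlg hH) hd ?_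
  refine Eventually.of_forall fun t => ?_
  obtain ⟨g, hg, e⟩ := hX t
  have e' : ((g⁻¹ : Rˣ) : R) = exp ((-t) • X) := by
    let _ : NormedAlgebra ℚ R := .restrictScalars ℚ ℂ R
    rw [neg_smul, ← Ring.inverse_exp, ← e, Ring.inverse_unit]
  rw [← e, ← e']
  exact conj_mem_lieAlg hg hY

end LieTheory

/-! ### The disc algebra with values in a Banach algebra -/

section DiscAlgebra

variable {A : Type*} [NormedRing A] [NormedAlgebra ℂ A]

theorem circle_mem_closedBall (l : Circle) : (l : ℂ) ∈ Metric.closedBall (0 : ℂ) 1 := by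
  simp [Circle.norm_coe]

/-- A continuous function on the closed disk, holomorphic inside, is bounded by its values on the
circle. -/
theorem norm_le_of_circle {E : Type*} [NormedAddCommGroup E] [NormedSpace ℂ E] {Γ : ℂ → E} {C : ℝ}
    (hΓ : DiffContOnCl ℂ Γ (Metric.ball 0 1)) (h : ∀ l : Circle, ‖Γ l‖ ≤ C) {w : ℂ}
    (hw : w ∈ Metric.closedBall (0 : ℂ) 1) : ‖Γ w‖ ≤ C := by
  refine Complex.norm_le_of_forall_mem_frontier_norm_le Metric.isBounded_ball hΓ ?_
    (by rwa [closure_ball _ one_ne_zero])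
  intro z hz
  rw [frontier_ball _ one_ne_zero] at hz
  have : ‖z‖ = 1 := by simpa using hz
  exact h ⟨z, mem_sphere_zero_iff_norm.2 this⟩

theorem eqOn_closedBall_of_circle {E : Type*} [NormedAddCommGroup E] [NormedSpace ℂ E]
    {Γ Δ : ℂ → E} (hΓ : DiffContOnCl ℂ Γ (Metric.ball 0 1))
    (hΔ : DiffContOnCl ℂ Δ (Metric.ball 0 1)) (h : ∀ l : Circle, Γ l = Δ l) {w : ℂ}
    (hw : w ∈ Metric.closedBall (0 : ℂ) 1) : Γ w = Δ w := by
  have := norm_le_of_circle (C := 0) (hΓ.sub hΔ) (fun l => by simp [h l]) hw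
  exact sub_eq_zero.1 (norm_le_zero_iff.1 (by simpa using this))

theorem DiffContOnCl.fun_mul' {f g : ℂ → A} {s : Set ℂ} (hf : DiffContOnCl ℂ f s)
    (hg : DiffContOnCl ℂ g s) : DiffContOnCl ℂ (fun z => f z * g z) s :=
  ⟨hf.1.fun_mul hg.1, hf.2.fun_mul hg.2⟩

/-- The disc algebra: the loops which extend to continuous functions on the closed unit disk which
are holomorphic in the interior. -/
def discAlgebra (A : Type*) [NormedRing A] [NormedAlgebra ℂ A] : Subalgebra ℂ (Loop A) where
  carrier := {γ | ∃ Γ : ℂ → A, DiffContOnCl ℂ Γ (Metric.ball 0 1) ∧ ∀ l : Circle, Γ l = γ l}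
  mul_mem' := by
    rintro γ δ ⟨Γ, h1, h2⟩ ⟨Δ, h3, h4⟩
    exact ⟨_, h1.fun_mul' h3, fun l => by simp [h2, h4]⟩
  add_mem' := by
    rintro γ δ ⟨Γ, h1, h2⟩ ⟨Δ, h3, h4⟩
    exact ⟨_, h1.add h3, fun l => by simp [h2, h4]⟩
  algebraMap_mem' := fun c => ⟨fun _ => algebraMap ℂ A c, diffContOnCl_const, fun l => rfl⟩

theorem isClosed_discAlgebra [CompleteSpace A] : IsClosed (discAlgebra A : Set (Loop A)) := by
  refine isClosed_of_closure_subset fun γ hγ => ?_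
  obtain ⟨u, hu, hlim⟩ := mem_closure_iff_seq_limit.1 hγ
  choose Γ hΓ hΓu using hu
  have hcauchy : UniformCauchySeqOn Γ atTop (Metric.closedBall 0 1) := by
    rw [Metric.uniformCauchySeqOn_iff]
    intro ε hε
    obtain ⟨N, hN⟩ := Metric.cauchySeq_iff.1 hlim.cauchySeq ε hε
    refine ⟨N, fun m hm n hn w hw => ?_⟩
    rw [dist_eq_norm]
    refine lt_of_le_of_lt (norm_le_of_circle (C := dist (u m) (u n)) ((hΓ m).sub (hΓ n)) ?_ hw)
      (hN m hm n hn)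
    intro l
    have := (u m - u n).norm_coe_le_norm l
    simpa [hΓu, dist_eq_norm] using this
  have hpt : ∀ w, ∃ x, w ∈ Metric.closedBall (0 : ℂ) 1 → Tendsto (fun n => Γ n w) atTop (𝓝 x) := by
    intro w
    by_cases hw : w ∈ Metric.closedBall (0 : ℂ) 1
    · obtain ⟨x, hx⟩ := cauchySeq_tendsto_of_complete (hcauchy.cauchySeq hw)
      exact ⟨x, fun _ => hx⟩
    · exact ⟨0, fun h => absurd h hw⟩
  choose Δ hΔ using hpt
  have hunif : TendstoUniformlyOn Γ Δ atTop (Metric.closedBall 0 1) :=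
    hcauchy.tendstoUniformlyOn_of_tendsto fun w hw => hΔ w hw
  refine ⟨Δ, ⟨?_, ?_⟩, fun l => ?_⟩
  · exact ((hunif.mono Metric.ball_subset_closedBall).tendstoLocallyUniformlyOn).differentiableOn
      (Eventually.of_forall fun n => (hΓ n).1) Metric.isOpen_ball
  · rw [closure_ball _ one_ne_zero]
    exact hunif.continuousOn (Frequently.of_forall fun n => (hΓ n).continuousOn_ball)
  · refine tendsto_nhds_unique (hΔ l (circle_mem_closedBall l)) ?_
    simp only [hΓu]
    exact ((ContinuousMap.evalCLM ℂ l).continuous.tendsto γ).comp hlim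

/-- The loop `λ ↦ X₀ + λ X₁`. -/
def linearLoop (X₀ X₁ : A) : Loop A := ⟨fun l => X₀ + (l : ℂ) • X₁, by fun_prop⟩

@[simp]
theorem linearLoop_apply (X₀ X₁ : A) (l : Circle) : linearLoop X₀ X₁ l = X₀ + (l : ℂ) • X₁ := rfl

theorem diffContOnCl_linear (X₀ X₁ : A) (s : Set ℂ) :
    DiffContOnCl ℂ (fun w : ℂ => X₀ + w • X₁) s :=
  Differentiable.diffContOnCl (by fun_prop)

theorem linearLoop_mem_discAlgebra (X₀ X₁ : A) : linearLoop X₀ X₁ ∈ discAlgebra A :=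
  ⟨_, diffContOnCl_linear X₀ X₁ _, fun _ => rfl⟩

theorem mem_discAlgebra_of_exp_mem [CompleteSpace A] {X : Loop A}
    (h : ∀ t : ℝ, exp (t • X) ∈ discAlgebra A) : X ∈ discAlgebra A :=
  mem_submodule_of_hasDerivAt
    (P := (Subalgebra.toSubmodule (discAlgebra A)).restrictScalars ℝ) isClosed_discAlgebra
    (hasDerivAt_exp_smul_zero X) (Eventually.of_forall h)

/-- A function holomorphic in the disk with real boundary values is constant. -/
theorem eq_const_of_im_eq_zero_on_circle {h : ℂ → ℂ} (hh : DiffContOnCl ℂ h (Metric.ball 0 1))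
    (him : ∀ l : Circle, (h l).im = 0) {w : ℂ} (hw : w ∈ Metric.closedBall (0 : ℂ) 1) :
    h w = h 0 := by
  have hzero : ∀ z ∈ Metric.ball (0 : ℂ) 1, (h z).im = 0 := by
    obtain ⟨C, hC⟩ := (isCompact_closedBall (0 : ℂ) 1).exists_bound_of_continuousOn
      hh.continuousOn_ball
    intro z hz
    -- the maximum principle for `h + it`, for all real `t`
    have key : ∀ t : ℝ, ‖h z + t * Complex.I‖ ^ 2 ≤ C ^ 2 + t ^ 2 := by
      intro t
      have h1 : ‖h z + t * Complex.I‖ ≤ Real.sqrt (C ^ 2 + t ^ 2) := by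
        refine norm_le_of_circle (hh.add_const (t * Complex.I)) (fun l => ?_)
          (Metric.ball_subset_closedBall hz)
        refine Real.le_sqrt_of_sq_le ?_
        have h2 := hC l (circle_mem_closedBall l)
        have h3 : ‖h l‖ ^ 2 = (h l).re ^ 2 := by
          rw [Complex.sq_norm, Complex.normSq_apply, him l]; ring
        have h4 : ‖h l + t * Complex.I‖ ^ 2 = (h l).re ^ 2 + t ^ 2 := by
          rw [Complex.sq_norm, Complex.normSq_apply]; simp [him l]; ring
        rw [h4, ← h3]
        have := norm_nonneg (h l)
        gcongr
      calc _ ≤ Real.sqrt (C ^ 2 + t ^ 2) ^ 2 := by gcongr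
        _ = _ := Real.sq_sqrt (by positivity)
    have key2 : ∀ t : ℝ, (h z).im * t ≤ C ^ 2 / 2 := by
      intro t
      have := key t
      rw [Complex.sq_norm, Complex.normSq_apply] at this
      simp at this
      nlinarith [sq_nonneg (h z).re, sq_nonneg (h z).im]
    by_contra hne
    have := key2 ((C ^ 2 / 2 + 1) / (h z).im)
    rw [mul_div_cancel₀ _ hne] at this
    linarith
  have hball : ∀ z ∈ Metric.ball (0 : ℂ) 1, h z = h 0 := by
    have han : AnalyticOnNhd ℂ h (Metric.ball 0 1) := hh.1.analyticOnNhd Metric.isOpen_ball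
    rcases han.is_constant_or_isOpen (convex_ball 0 1).isPreconnected with ⟨c, hc⟩ | hopen
    · intro z hz
      rw [hc z hz, hc 0 (by simp)]
    · exfalso
      have ho := hopen _ subset_rfl Metric.isOpen_ball
      have h0 : h 0 ∈ h '' Metric.ball 0 1 := ⟨0, by simp, rfl⟩
      obtain ⟨ε, hε, hsub⟩ := Metric.isOpen_iff.1 ho _ h0
      obtain ⟨z, hz, hz'⟩ := hsub (show h 0 + (ε / 2 : ℝ) * Complex.I ∈ Metric.ball (h 0) ε by
        simp [abs_of_pos hε]; linarith)
      have h1 := hzero z hz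
      rw [hz'] at h1
      simp [hzero 0 (by simp)] at h1
      linarith
  have hEq : EqOn h (fun _ => h 0) (Metric.ball 0 1) := hball
  exact hEq.of_subset_closure hh.continuousOn_ball continuousOn_const Metric.ball_subset_closedBall
    (by rw [closure_ball _ one_ne_zero]) hw

/-- If `f` and the complex conjugate of `f` both extend holomorphically from the circle to the disk,
then `f` is constant. -/
theorem eq_const_of_eq_conj_on_circle {f g : ℂ → ℂ} (hf : DiffContOnCl ℂ f (Metric.ball 0 1))
    (hg : DiffContOnCl ℂ g (Metric.ball 0 1))
    (h : ∀ l : Circle, f l = starRingEnd ℂ (g l)) {w : ℂ}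
    (hw : w ∈ Metric.closedBall (0 : ℂ) 1) : f w = f 0 := by
  have h1 := eq_const_of_im_eq_zero_on_circle (hf.add hg) (fun l => by simp [h l]) hw
  have h2 := eq_const_of_im_eq_zero_on_circle ((hf.sub hg).const_smul Complex.I)
    (fun l => by simp [h l]) hw
  simp only [Pi.add_apply, Pi.sub_apply, Pi.smul_apply, smul_eq_mul] at h1 h2
  have h3 := mul_left_cancel₀ Complex.I_ne_zero h2
  linear_combination (h1 + h3) / 2

/-- If `p(λ)` and `λ` times the conjugate of `p(λ)` extend holomorphically to the disk, then `p` is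
an affine function of `λ`. -/
theorem eq_affine_of_eq_mul_conj_on_circle {p q : ℂ → ℂ}
    (hp : DiffContOnCl ℂ p (Metric.ball 0 1)) (hq : DiffContOnCl ℂ q (Metric.ball 0 1))
    (h : ∀ l : Circle, p l = l * starRingEnd ℂ (q l)) :
    ∃ c : ℂ, ∀ l : Circle, p l = p 0 + l * c := by
  have hnhds : Metric.ball (0 : ℂ) 1 ∈ 𝓝 0 := Metric.ball_mem_nhds _ one_pos
  have hd : DiffContOnCl ℂ (dslope p 0) (Metric.ball 0 1) := by
    refine ⟨(Complex.differentiableOn_dslope hnhds).2 hp.1, ?_⟩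
    exact (continuousOn_dslope (mem_of_superset hnhds subset_closure)).2
      ⟨hp.2, hp.differentiableAt' hnhds⟩
  have hg : DiffContOnCl ℂ (fun w => q w - w • starRingEnd ℂ (p 0)) (Metric.ball 0 1) :=
    hq.sub (Differentiable.diffContOnCl (by fun_prop))
  have hslope : ∀ l : Circle, p l = p 0 + l * dslope p 0 l := by
    intro l
    have := sub_smul_dslope p 0 (l : ℂ)
    simp only [sub_zero, smul_eq_mul] at this
    rw [this]; ring
  refine ⟨dslope p 0 0, fun l => ?_⟩
  rw [← eq_const_of_eq_conj_on_circle hd hg (fun l => ?_) (circle_mem_closedBall l)]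
  · exact hslope l
  · have hl : (l : ℂ) ≠ 0 := l.coe_ne_zero
    have hll : (l : ℂ) * starRingEnd ℂ (l : ℂ) = 1 := by
      rw [Complex.mul_conj, Circle.normSq_coe, Complex.ofReal_one]
    refine mul_left_cancel₀ hl ?_
    have h1 := hslope l
    simp only [map_sub, smul_eq_mul, map_mul, Complex.conj_conj]
    linear_combination h l - h1 + p 0 * hll

/-- Vector-valued form of `eq_affine_of_eq_mul_conj_on_circle`, tested on linear functionals. -/
theorem eq_linearLoop_of_forall_dual [FiniteDimensional ℂ A] {γ δ : Loop A}
    (hγ : γ ∈ discAlgebra A) (hδ : δ ∈ discAlgebra A)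
    (h : ∀ φ : A →ₗ[ℂ] ℂ, ∃ ψ : A →ₗ[ℂ] ℂ, ∀ l : Circle,
      φ (γ l) = l * starRingEnd ℂ (ψ (δ l))) :
    ∃ X₀ X₁ : A, γ = linearLoop X₀ X₁ := by
  obtain ⟨Γ, hΓ, hΓγ⟩ := hγ
  obtain ⟨Δ, hΔ, hΔδ⟩ := hδ
  refine ⟨Γ 0, γ 1 - Γ 0, ?_⟩
  ext l
  rw [← sub_eq_zero, ← Module.forall_dual_apply_eq_zero_iff ℂ]
  intro φ
  obtain ⟨ψ, hψ⟩ := h φ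
  have hφΓ : DiffContOnCl ℂ (fun w => φ (Γ w)) (Metric.ball 0 1) :=
    (LinearMap.toContinuousLinearMap φ).differentiable.comp_diffContOnCl hΓ
  have hψΔ : DiffContOnCl ℂ (fun w => ψ (Δ w)) (Metric.ball 0 1) :=
    (LinearMap.toContinuousLinearMap ψ).differentiable.comp_diffContOnCl hΔ
  obtain ⟨c, hc⟩ := eq_affine_of_eq_mul_conj_on_circle hφΓ hψΔ
    (fun l => by simp only [hΓγ, hΔδ]; exact hψ l)
  have h1 := hc l
  have h2 := hc 1
  simp only [hΓγ, Circle.coe_one, one_mul] at h1 h2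
  rw [show Γ 1 = γ 1 by simpa using hΓγ 1] at h2
  simp only [linearLoop_apply, map_sub, map_add, map_smul, smul_eq_mul]
  linear_combination h1 - (l : ℂ) * h2

end DiscAlgebra

/-! ### The Lie algebras of a `k`-symmetric space and their gradings -/

theorem geom_sum_eq_zero_of_pow_eq_one {ζ : ℂ} {n : ℕ} (h1 : ζ ^ n = 1) (h2 : ζ ≠ 1) :
    ∑ j ∈ Finset.range n, ζ ^ j = 0 := by
  rw [geom_sum_eq h2, h1]; simp

namespace KSymmetricSpace

variable {A : Type*} [NormedRing A] [NormedAlgebra ℂ A] [FiniteDimensional ℂ A]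
  (M : KSymmetricSpace A)

/-- The Lie algebra `𝔤` as a real vector space. -/
def realAlg : Submodule ℝ A := lieSubmodule M.G M.isClosed_G

theorem isClosed_realAlg : IsClosed (M.realAlg : Set A) := isClosed_lieAlg M.isClosed_G

theorem add_I_smul_mem {a b : A} (ha : a ∈ lieAlg M.G) (hb : b ∈ lieAlg M.G) :
    a + Complex.I • b ∈ lieAlg M.GC := (M.complexification _).2 ⟨a, ha, b, hb, rfl⟩

/-- The Lie algebra `𝔤^ℂ` as a complex vector space. -/
def complexAlg : Submodule ℂ A where
  carrier := lieAlg M.GC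
  zero_mem' := (lieSubmodule M.GC M.isClosed_GC).zero_mem
  add_mem' := (lieSubmodule M.GC M.isClosed_GC).add_mem
  smul_mem' := by
    intro c X hX
    obtain ⟨a, ha, b, hb, rfl⟩ := (M.complexification X).1 hX
    refine (M.complexification _).2 ⟨c.re • a - c.im • b,
      M.realAlg.sub_mem (M.realAlg.smul_mem _ ha) (M.realAlg.smul_mem _ hb),
      c.im • a + c.re • b,
      M.realAlg.add_mem (M.realAlg.smul_mem _ ha) (M.realAlg.smul_mem _ hb), ?_⟩
    simp only [← Complex.coe_smul]
    conv_lhs => rw [← Complex.re_add_im c]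
    have := Complex.I_mul_I
    match_scalars
    · ring
    · linear_combination (c.im : ℂ) * this

theorem mem_complexAlg_of_mem {X : A} (h : X ∈ lieAlg M.G) : X ∈ lieAlg M.GC :=
  lieAlg_mono M.G_le_GC h

/-! ### The automorphism -/

theorem exists_exp {X : A} (hX : X ∈ lieAlg M.GC) (t : ℝ) :
    ∃ g : M.GC, ((g : Aˣ) : A) = exp (t • X) ∧ ((M.σ g : Aˣ) : A) = exp (t • M.dσ X) := by
  obtain ⟨g, hg, e⟩ := hX t
  refine ⟨⟨g, hg⟩, e, ?_⟩
  have h1 : t • X ∈ lieAlg M.GC := (lieSubmodule M.GC M.isClosed_GC).smul_mem t hX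
  have := M.σ_exp _ h1 ⟨g, hg⟩ e
  rw [this, ← Complex.coe_smul t X, map_smul, Complex.coe_smul]

theorem dσ_mem {X : A} (hX : X ∈ lieAlg M.GC) : M.dσ X ∈ lieAlg M.GC := by
  intro t
  obtain ⟨g, _, e⟩ := M.exists_exp hX t
  exact ⟨M.σ g, (M.σ g).2, e⟩

theorem dσ_mem_real {X : A} (hX : X ∈ lieAlg M.G) : M.dσ X ∈ lieAlg M.G := by
  intro t
  obtain ⟨g, e, e'⟩ := M.exists_exp (M.mem_complexAlg_of_mem hX) t
  obtain ⟨h, hh, eh⟩ := hX t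
  have : (g : Aˣ) = h := Units.ext (e.trans eh.symm)
  exact ⟨M.σ g, M.σ_mem_G g (this ▸ hh), e'⟩

theorem dσ_pow_mem {X : A} (hX : X ∈ lieAlg M.GC) (n : ℕ) : (M.dσ ^ n) X ∈ lieAlg M.GC := by
  induction n with
  | zero => simpa using hX
  | succ n ih => rw [pow_succ', Module.End.mul_apply]; exact M.dσ_mem ih

theorem dσ_pow_mem_real {X : A} (hX : X ∈ lieAlg M.G) (n : ℕ) : (M.dσ ^ n) X ∈ lieAlg M.G := by
  induction n with
  | zero => simpa using hX
  | succ n ih => rw [pow_succ', Module.End.mul_apply]; exact M.dσ_mem_real ih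

theorem dσ_pow_k {X : A} (hX : X ∈ lieAlg M.GC) : (M.dσ ^ M.k) X = X := by
  refine eq_of_exp_smul_eq fun t => ?_
  have : ∀ n : ℕ, ∃ g : M.GC, ((g : Aˣ) : A) = exp (t • X) ∧
      (((M.σ ^ n) g : M.GC) : Aˣ) = exp (t • (M.dσ ^ n) X) := by
    intro n
    obtain ⟨g, e, -⟩ := M.exists_exp hX t
    refine ⟨g, e, ?_⟩
    induction n with
    | zero => simpa using e
    | succ n ih =>
      obtain ⟨g', h1, h2⟩ := M.exists_exp (M.dσ_pow_mem hX n) t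
      have : g' = (M.σ ^ n) g := Subtype.ext (Units.ext (h1.trans ih.symm))
      rw [pow_succ', pow_succ', MulAut.mul_apply, Module.End.mul_apply, ← this, h2]
  obtain ⟨g, h1, h2⟩ := this M.k
  rw [← h2, M.σ_pow, MulAut.one_apply, h1]

theorem dσ_conj_units (g : M.GC) {X : A} (hX : X ∈ lieAlg M.GC) :
    M.dσ ((g : Aˣ) * X * (((g : Aˣ)⁻¹ : Aˣ) : A)) =
      (M.σ g : Aˣ) * M.dσ X * (((M.σ g : Aˣ)⁻¹ : Aˣ) : A) := by
  refine eq_of_exp_smul_eq fun t => ?_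
  obtain ⟨h, h1, h2⟩ := M.exists_exp (conj_mem_lieAlg g.2 hX) t
  obtain ⟨h', h1', h2'⟩ := M.exists_exp hX t
  have : h = g * h' * g⁻¹ := by
    refine Subtype.ext (Units.ext ?_)
    rw [h1, ← smul_mul_assoc, ← mul_smul_comm, units_exp_conj]
    simp [h1']
  rw [← h2, this, ← smul_mul_assoc, ← mul_smul_comm, units_exp_conj, ← h2']
  simp

/-! ### Complex conjugation -/

theorem conj_add_I_smul {a b : A} (ha : a ∈ lieAlg M.G) (hb : b ∈ lieAlg M.G) :
    M.conj (a + Complex.I • b) = a - Complex.I • b := by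
  have h : ∃ p : A × A, p.1 ∈ lieAlg M.G ∧ p.2 ∈ lieAlg M.G ∧
      a + Complex.I • b = p.1 + Complex.I • p.2 := ⟨(a, b), ha, hb, rfl⟩
  unfold conj
  rw [dif_pos h]
  obtain ⟨h1, h2, h3⟩ := h.choose_spec
  set p := h.choose
  have e1 : Complex.I • (p.2 - b) = a - p.1 := by
    rw [smul_sub, sub_eq_sub_iff_add_eq_add, h3, add_comm]
  have e2 : p.2 - b = 0 := by
    refine M.totally_real _ (M.realAlg.sub_mem h2 hb) ?_
    rw [e1]; exact M.realAlg.sub_mem ha h1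
  rw [e2, smul_zero] at e1
  rw [sub_eq_zero.1 e2, ← sub_eq_zero.1 e1.symm]

theorem conj_mem {X : A} (h : X ∈ lieAlg M.GC) : M.conj X ∈ lieAlg M.GC := by
  obtain ⟨a, ha, b, hb, rfl⟩ := (M.complexification X).1 h
  rw [M.conj_add_I_smul ha hb, sub_eq_add_neg, ← smul_neg]
  exact M.add_I_smul_mem ha (M.realAlg.neg_mem hb)

theorem conj_conj {X : A} (h : X ∈ lieAlg M.GC) : M.conj (M.conj X) = X := by
  obtain ⟨a, ha, b, hb, rfl⟩ := (M.complexification X).1 h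
  rw [M.conj_add_I_smul ha hb, sub_eq_add_neg, ← smul_neg,
    M.conj_add_I_smul ha (M.realAlg.neg_mem hb)]
  simp

theorem conj_add {X Y : A} (hX : X ∈ lieAlg M.GC) (hY : Y ∈ lieAlg M.GC) :
    M.conj (X + Y) = M.conj X + M.conj Y := by
  obtain ⟨a, ha, b, hb, rfl⟩ := (M.complexification X).1 hX
  obtain ⟨c, hc, d, hd, rfl⟩ := (M.complexification Y).1 hY
  have : a + Complex.I • b + (c + Complex.I • d) = (a + c) + Complex.I • (b + d) := by
    rw [smul_add]; abel
  rw [this, M.conj_add_I_smul ha hb, M.conj_add_I_smul hc hd,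
    M.conj_add_I_smul (M.realAlg.add_mem ha hc) (M.realAlg.add_mem hb hd), smul_add]
  abel

theorem conj_smul (c : ℂ) {X : A} (hX : X ∈ lieAlg M.GC) :
    M.conj (c • X) = starRingEnd ℂ c • M.conj X := by
  obtain ⟨a, ha, b, hb, rfl⟩ := (M.complexification X).1 hX
  have h1 : c • (a + Complex.I • b) =
      (c.re • a - c.im • b) + Complex.I • (c.im • a + c.re • b) := by
    simp only [← Complex.coe_smul]
    conv_lhs => rw [← Complex.re_add_im c]
    have := Complex.I_mul_I
    match_scalars
    · ring
    · linear_combination (c.im : ℂ) * this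
  rw [h1, M.conj_add_I_smul ha hb, M.conj_add_I_smul
    (M.realAlg.sub_mem (M.realAlg.smul_mem _ ha) (M.realAlg.smul_mem _ hb))
    (M.realAlg.add_mem (M.realAlg.smul_mem _ ha) (M.realAlg.smul_mem _ hb))]
  have h2 : starRingEnd ℂ c = c.re - c.im * Complex.I := by
    apply Complex.ext <;> simp
  rw [h2]
  simp only [← Complex.coe_smul]
  have := Complex.I_mul_I
  match_scalars
  · ring
  · linear_combination -(c.im : ℂ) * this

theorem add_conj_mem {X : A} (hX : X ∈ lieAlg M.GC) : M.conj X + X ∈ lieAlg M.G := by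
  obtain ⟨a, ha, b, hb, rfl⟩ := (M.complexification X).1 hX
  rw [M.conj_add_I_smul ha hb]
  have : a - Complex.I • b + (a + Complex.I • b) = a + a := by abel
  rw [this]
  exact M.realAlg.add_mem ha ha

theorem I_smul_conj_sub_mem {X : A} (hX : X ∈ lieAlg M.GC) :
    Complex.I • (M.conj X - X) ∈ lieAlg M.G := by
  have h := M.add_conj_mem (M.complexAlg.smul_mem (-Complex.I) hX)
  rw [M.conj_smul _ hX] at h
  convert h using 1
  simp [sub_eq_add_neg]

theorem dσ_conj {X : A} (hX : X ∈ lieAlg M.GC) : M.dσ (M.conj X) = M.conj (M.dσ X) := by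
  obtain ⟨a, ha, b, hb, rfl⟩ := (M.complexification X).1 hX
  rw [M.conj_add_I_smul ha hb, map_add, map_smul,
    M.conj_add_I_smul (M.dσ_mem_real ha) (M.dσ_mem_real hb), map_sub, map_smul]

/-! ### The eigenspace decomposition -/

theorem k_pos : 0 < M.k := lt_of_lt_of_le two_pos M.two_le_k

theorem k_ne_zero : (M.k : ℂ) ≠ 0 := Nat.cast_ne_zero.2 M.k_pos.ne'

theorem omega_isPrimitiveRoot : IsPrimitiveRoot (M.omega : ℂ) M.k := by
  have := Complex.isPrimitiveRoot_exp M.k M.k_pos.ne'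
  have h : (M.omega : ℂ) = Complex.exp (2 * Real.pi * Complex.I / M.k) := by
    rw [omega, Circle.coe_exp]; push_cast; ring_nf
  rwa [h]

theorem omega_ne_zero : (M.omega : ℂ) ≠ 0 := M.omega.coe_ne_zero

theorem omega_ne_one : (M.omega : ℂ) ≠ 1 :=
  M.omega_isPrimitiveRoot.ne_one M.two_le_k

theorem dσ_pow_of_mem_gr {j : ℤ} {X : A} (hX : X ∈ M.gr j) (n : ℕ) :
    (M.dσ ^ n) X = (((M.omega : ℂ) ^ j) ^ n) • X := by
  induction n with
  | zero => simp
  | succ n ih => rw [pow_succ', Module.End.mul_apply, ih, map_smul, hX.2, smul_smul, pow_succ]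

theorem gr_smul {j : ℤ} (c : ℂ) {X : A} (hX : X ∈ M.gr j) : c • X ∈ M.gr j :=
  ⟨M.complexAlg.smul_mem c hX.1, by rw [map_smul, hX.2, smul_comm]⟩

theorem gr_conj {j : ℤ} {X : A} (hX : X ∈ M.gr j) : M.conj X ∈ M.gr (-j) := by
  refine ⟨M.conj_mem hX.1, ?_⟩
  rw [M.dσ_conj hX.1, hX.2, M.conj_smul _ hX.1, map_zpow₀, ← Circle.coe_inv_eq_conj,
    Circle.coe_inv, inv_zpow, zpow_neg]

/-- The projection onto `𝔨^ℂ`, as a linear map. -/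
noncomputable def kPartL : A →ₗ[ℂ] A :=
  (M.k : ℂ)⁻¹ • ∑ l ∈ Finset.range M.k, M.dσ ^ l

theorem kPartL_apply (X : A) : M.kPartL X = M.kPart X := by
  simp [kPartL, kPart]

/-- The projection onto `𝔪^ℂ`, as a linear map. -/
noncomputable def mPartL : A →ₗ[ℂ] A := LinearMap.id - M.kPartL

theorem mPartL_apply (X : A) : M.mPartL X = M.mPart X := by
  simp [mPartL, mPart, kPartL_apply]

theorem mPart_add_kPart (X : A) : M.mPart X + M.kPart X = X := by simp [mPart]

theorem kPart_of_mem_gr_zero {X : A} (hX : X ∈ M.gr 0) : M.kPart X = X := by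
  simp [kPart, M.dσ_pow_of_mem_gr hX, ← Nat.cast_smul_eq_nsmul ℂ, smul_smul, M.k_ne_zero]

theorem mPart_of_mem_gr_zero {X : A} (hX : X ∈ M.gr 0) : M.mPart X = 0 := by
  simp [mPart, M.kPart_of_mem_gr_zero hX]

theorem kPart_of_mem_gr {j : ℤ} (hj : (M.omega : ℂ) ^ j ≠ 1) {X : A} (hX : X ∈ M.gr j) :
    M.kPart X = 0 := by
  simp only [kPart, M.dσ_pow_of_mem_gr hX]
  rw [← Finset.sum_smul, geom_sum_eq_zero_of_pow_eq_one _ hj]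
  · simp
  · rw [← zpow_natCast, ← zpow_mul, mul_comm, zpow_mul, zpow_natCast,
      M.omega_isPrimitiveRoot.pow_eq_one, one_zpow]

theorem mPart_of_mem_gr {j : ℤ} (hj : (M.omega : ℂ) ^ j ≠ 1) {X : A} (hX : X ∈ M.gr j) :
    M.mPart X = X := by
  simp [mPart, M.kPart_of_mem_gr hj hX]

theorem omega_zpow_one_ne : (M.omega : ℂ) ^ (1 : ℤ) ≠ 1 := by simpa using M.omega_ne_one

theorem omega_zpow_neg_one_ne : (M.omega : ℂ) ^ (-1 : ℤ) ≠ 1 := by simpa using M.omega_ne_one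

/-- The component of `X` in the eigenspace `𝔤_j`. -/
noncomputable def eigenPart (j : ℕ) (X : A) : A :=
  (M.k : ℂ)⁻¹ • ∑ l ∈ Finset.range M.k, (((M.omega : ℂ) ^ j)⁻¹ ^ l) • (M.dσ ^ l) X

theorem eigenPart_zero (X : A) : M.eigenPart 0 X = M.kPart X := by
  simp [eigenPart, kPart]

theorem eigenPart_mem {X : A} (hX : X ∈ lieAlg M.GC) (j : ℕ) : M.eigenPart j X ∈ M.gr j := by
  refine ⟨M.complexAlg.smul_mem _ (M.complexAlg.sum_mem fun l _ =>
    M.complexAlg.smul_mem _ (M.dσ_pow_mem hX l)), ?_⟩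
  have hj : (M.omega : ℂ) ^ j ≠ 0 := pow_ne_zero _ M.omega_ne_zero
  set ζ : ℂ := (M.omega : ℂ) ^ j with hζ
  have hζk : ζ⁻¹ ^ M.k = 1 := by
    rw [hζ, inv_pow, ← pow_mul, mul_comm, pow_mul, M.omega_isPrimitiveRoot.pow_eq_one, one_pow,
      inv_one]
  have h1 := Finset.sum_range_succ (fun l => (ζ⁻¹ ^ l) • (M.dσ ^ l) X) M.k
  rw [Finset.sum_range_succ', hζk, M.dσ_pow_k hX] at h1
  simp only [pow_zero, one_smul, Module.End.one_apply, add_left_inj] at h1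
  rw [zpow_natCast, ← hζ, eigenPart, ← hζ, map_smul, map_sum, smul_comm]
  congr 1
  rw [← h1, Finset.smul_sum]
  refine Finset.sum_congr rfl fun l _ => ?_
  rw [map_smul, pow_succ' M.dσ, Module.End.mul_apply, smul_smul, pow_succ', ← mul_assoc,
    mul_inv_cancel₀ hj, one_mul]

/-- The sum of the eigencomponents, by orthogonality of the powers of `ω`. -/
theorem sum_eigenPart (X : A) : ∑ j ∈ Finset.range M.k, M.eigenPart j X = X := by
  simp only [eigenPart]
  rw [← Finset.smul_sum, Finset.sum_comm]
  have : ∀ l ∈ Finset.range M.k, l ≠ 0 →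
      ∑ j ∈ Finset.range M.k, (((M.omega : ℂ) ^ j)⁻¹ ^ l) • (M.dσ ^ l) X = 0 := by
    intro l hl hl0
    have h1 : ∀ j : ℕ, ((M.omega : ℂ) ^ j)⁻¹ ^ l = (((M.omega : ℂ) ^ l)⁻¹) ^ j := by
      intro j; rw [inv_pow, inv_pow, ← pow_mul, ← pow_mul, mul_comm]
    simp only [h1]
    rw [← Finset.sum_smul, geom_sum_eq_zero_of_pow_eq_one, zero_smul]
    · rw [inv_pow, ← pow_mul, mul_comm, pow_mul, M.omega_isPrimitiveRoot.pow_eq_one, one_pow,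
        inv_one]
    · rw [Ne, inv_eq_one]
      exact M.omega_isPrimitiveRoot.pow_ne_one_of_pos_of_lt hl0 (Finset.mem_range.1 hl)
  rw [Finset.sum_eq_single_of_mem 0 (Finset.mem_range.2 M.k_pos) this]
  simp [← Nat.cast_smul_eq_nsmul ℂ, smul_smul, M.k_ne_zero]

theorem kPart_mem_gr_zero {X : A} (hX : X ∈ lieAlg M.GC) : M.kPart X ∈ M.gr 0 := by
  simpa [eigenPart_zero] using M.eigenPart_mem hX 0

theorem kPart_mem_real {X : A} (hX : X ∈ lieAlg M.G) : M.kPart X ∈ lieAlg M.G := by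
  have : M.kPart X = (M.k : ℝ)⁻¹ • ∑ l ∈ Finset.range M.k, (M.dσ ^ l) X := by
    rw [kPart, ← Complex.coe_smul]; simp
  rw [this]
  exact M.realAlg.smul_mem _ (M.realAlg.sum_mem fun l _ => M.dσ_pow_mem_real hX l)

theorem mPart_mem_real {X : A} (hX : X ∈ lieAlg M.G) : M.mPart X ∈ lieAlg M.G :=
  M.realAlg.sub_mem hX (M.kPart_mem_real hX)

theorem kPart_mem_kAlg {X : A} (hX : X ∈ lieAlg M.G) : M.kPart X ∈ M.kAlg :=
  ⟨M.kPart_mem_real hX, M.kPart_mem_gr_zero (M.mem_complexAlg_of_mem hX)⟩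

theorem mPart_mem_mAlgC {X : A} (hX : X ∈ lieAlg M.GC) : M.mPart X ∈ M.mAlgC := by
  have h := M.sum_eigenPart X
  obtain ⟨n, hn⟩ : ∃ n, M.k = n + 1 := ⟨M.k - 1, by have := M.k_pos; omega⟩
  rw [hn, Finset.sum_range_succ', eigenPart_zero] at h
  have : M.mPart X = ∑ j ∈ Finset.range n, M.eigenPart (j + 1) X :=
    sub_eq_of_eq_add h.symm
  rw [this]
  refine Submodule.sum_mem _ fun j hj => Submodule.subset_span ?_
  have := Finset.mem_range.1 hj
  refine mem_iUnion₂.2 ⟨((j + 1 : ℕ) : ℤ), ⟨by positivity, ?_⟩, M.eigenPart_mem hX (j + 1)⟩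
  rw [hn]; exact_mod_cast Nat.succ_lt_succ this

theorem mPart_mem_mAlg {X : A} (hX : X ∈ lieAlg M.G) : M.mPart X ∈ M.mAlg :=
  ⟨M.mPart_mem_real hX, M.mPart_mem_mAlgC (M.mem_complexAlg_of_mem hX)⟩

/-! ### The isotropy group -/

theorem K_le_G : M.K ≤ M.G := fun g hg => (M.K_le_fix g hg).1

theorem lieAlg_K_subset : lieAlg M.K ⊆ M.kAlg := by
  intro X hX
  have hG : X ∈ lieAlg M.G := lieAlg_mono M.K_le_G hX
  refine ⟨hG, M.mem_complexAlg_of_mem hG, ?_⟩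
  rw [zpow_zero, one_smul]
  refine eq_of_exp_smul_eq fun t => ?_
  obtain ⟨g, h1, h2⟩ := M.exists_exp (M.mem_complexAlg_of_mem hG) t
  obtain ⟨h, hh, e⟩ := hX t
  obtain ⟨_, hC, hfix⟩ := M.K_le_fix h hh
  have : g = ⟨h, hC⟩ := Subtype.ext (Units.ext (h1.trans e.symm))
  rw [← h2, ← e, this, hfix]

theorem dσ_conj_K {g : Aˣ} (hg : g ∈ M.K) {X : A} (hX : X ∈ lieAlg M.GC) :
    M.dσ (g * X * ((g⁻¹ : Aˣ) : A)) = g * M.dσ X * ((g⁻¹ : Aˣ) : A) := by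
  obtain ⟨_, hC, hfix⟩ := M.K_le_fix g hg
  have := M.dσ_conj_units ⟨g, hC⟩ hX
  rwa [hfix] at this

theorem gr_conj_K {g : Aˣ} (hg : g ∈ M.K) {j : ℤ} {X : A} (hX : X ∈ M.gr j) :
    g * X * ((g⁻¹ : Aˣ) : A) ∈ M.gr j := by
  refine ⟨conj_mem_lieAlg (M.G_le_GC (M.K_le_G hg)) hX.1, ?_⟩
  rw [M.dσ_conj_K hg hX.1, hX.2]
  simp

theorem mPart_conj_K {g : Aˣ} (hg : g ∈ M.K) {X : A} (hX : X ∈ lieAlg M.GC) :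
    M.mPart (g * X * ((g⁻¹ : Aˣ) : A)) = g * M.mPart X * ((g⁻¹ : Aˣ) : A) := by
  have h : ∀ l : ℕ, (M.dσ ^ l) (g * X * ((g⁻¹ : Aˣ) : A)) =
      g * (M.dσ ^ l) X * ((g⁻¹ : Aˣ) : A) := by
    intro l
    induction l with
    | zero => simp
    | succ l ih =>
      rw [pow_succ', Module.End.mul_apply, ih, M.dσ_conj_K hg (M.dσ_pow_mem hX l),
        Module.End.mul_apply]
  simp only [mPart, kPart, h]
  rw [← Finset.sum_mul, ← Finset.mul_sum]
  simp [mul_sub, sub_mul]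

end KSymmetricSpace

/-! ### Loop groups and their Lie algebras -/

section LoopGroups

variable {A : Type*} [NormedRing A] [NormedAlgebra ℂ A] [FiniteDimensional ℂ A]

/-- Evaluation of loops, as a ring homomorphism. -/
noncomputable def evalLoop (l : Circle) : Loop A →+* A where
  toFun γ := γ l
  map_one' := rfl
  map_mul' _ _ := rfl
  map_zero' := rfl
  map_add' _ _ := rfl

/-- Evaluation of invertible loops. -/
noncomputable def evalUnit (l : Circle) : (Loop A)ˣ →* Aˣ :=
  Units.map (evalLoop l : Loop A →+* A).toMonoidHom

@[simp]
theorem evalUnit_val (l : Circle) (γ : (Loop A)ˣ) : (evalUnit l γ : A) = (γ : Loop A) l := rfl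

theorem continuous_evalLoop (l : Circle) : Continuous (evalLoop l : Loop A →+* A) :=
  (ContinuousMap.evalCLM ℂ l : Loop A →L[ℂ] A).continuous

theorem continuous_evalUnit (l : Circle) : Continuous (evalUnit l : (Loop A)ˣ → Aˣ) :=
  Continuous.units_map _ (continuous_evalLoop l)

theorem exp_loop_apply (X : Loop A) (l : Circle) : (exp X : Loop A) l = exp (X l) := by
  let _ : NormedAlgebra ℚ (Loop A) := .restrictScalars ℚ ℂ (Loop A)
  let _ : NormedAlgebra ℚ A := .restrictScalars ℚ ℂ A
  exact map_exp (evalLoop l) (continuous_evalLoop l) X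

theorem exp_smul_loop_apply (t : ℝ) (X : Loop A) (l : Circle) :
    (exp (t • X) : Loop A) l = exp (t • X l) := exp_loop_apply _ l

/-- The exponential of a loop as an invertible loop. -/
noncomputable def expLoop (X : Loop A) : (Loop A)ˣ :=
  have _ : NormedAlgebra ℚ (Loop A) := .restrictScalars ℚ ℂ (Loop A)
  (isUnit_exp X).unit

@[simp]
theorem expLoop_val (X : Loop A) : (expLoop X : Loop A) = exp X := rfl

/-- An invertible loop in the disc algebra whose inverse is in the disc algebra extends to the disk
with invertible values. -/
theorem exists_extension_inv {γ : (Loop A)ˣ} (h1 : (γ : Loop A) ∈ discAlgebra A)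
    (h2 : ((γ⁻¹ : (Loop A)ˣ) : Loop A) ∈ discAlgebra A) :
    ∃ Γ : ℂ → A, DiffContOnCl ℂ Γ (Metric.ball 0 1) ∧ (∀ l : Circle, Γ l = (γ : Loop A) l) ∧
      ∀ w ∈ Metric.closedBall (0 : ℂ) 1, IsUnit (Γ w) := by
  obtain ⟨Γ, hΓ, hΓγ⟩ := h1
  obtain ⟨Δ, hΔ, hΔγ⟩ := h2
  refine ⟨Γ, hΓ, hΓγ, fun w hw => ?_⟩
  have e1 : Γ w * Δ w = 1 := eqOn_closedBall_of_circle (hΓ.fun_mul' hΔ) diffContOnCl_const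
    (Δ := fun _ => 1) (fun l => by
      simp only [hΓγ, hΔγ, ← ContinuousMap.mul_apply, Units.mul_inv, ContinuousMap.one_apply]) hw
  have e2 : Δ w * Γ w = 1 := eqOn_closedBall_of_circle (hΔ.fun_mul' hΓ) diffContOnCl_const
    (Δ := fun _ => 1) (fun l => by
      simp only [hΓγ, hΔγ, ← ContinuousMap.mul_apply, Units.inv_mul, ContinuousMap.one_apply]) hw
  exact ⟨⟨_, _, e1, e2⟩, rfl⟩

theorem DiffContOnCl.ringInverse {Γ : ℂ → A} (h : DiffContOnCl ℂ Γ (Metric.ball 0 1))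
    (hu : ∀ w ∈ Metric.closedBall (0 : ℂ) 1, IsUnit (Γ w)) :
    DiffContOnCl ℂ (fun w => Ring.inverse (Γ w)) (Metric.ball 0 1) := by
  refine DiffContOnCl.mk_ball ?_ ?_
  · intro w hw
    obtain ⟨u, hu⟩ := hu w (Metric.ball_subset_closedBall hw)
    have h1 := differentiableAt_inverse (𝕜 := ℂ) (x := Γ w) ⟨u, hu⟩
    exact h1.comp_differentiableWithinAt w (h.1 w hw)
  · intro w hw
    obtain ⟨u, hu⟩ := hu w hw
    have h1 := NormedRing.inverse_continuousAt u
    rw [hu] at h1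
    exact h1.comp_continuousWithinAt (h.continuousOn_ball w hw)

end LoopGroups

namespace KSymmetricSpace

variable {A : Type*} [NormedRing A] [NormedAlgebra ℂ A] [FiniteDimensional ℂ A]
  (M : KSymmetricSpace A)

/-- The group `Λ G^ℂ_σ` of twisted loops. -/
def twistedLoops : Subgroup (Loop A)ˣ where
  carrier := {γ | M.IsTwistedLoop γ}
  one_mem' := fun _ => ⟨1, rfl, by simp⟩
  mul_mem' := by
    intro γ δ hγ hδ l
    obtain ⟨g, h1, h2⟩ := hγ l
    obtain ⟨h, h3, h4⟩ := hδ l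
    exact ⟨g * h, by simp [h1, h3], by simp [h2, h4]⟩
  inv_mem' := by
    intro γ hγ l
    obtain ⟨g, h1, h2⟩ := hγ l
    have e1 : (g : Aˣ) = evalUnit l γ := Units.ext h1
    have e2 : (M.σ g : Aˣ) = evalUnit (M.omega * l) γ := Units.ext h2
    refine ⟨g⁻¹, ?_, ?_⟩
    · rw [Subgroup.coe_inv, e1, ← map_inv, evalUnit_val]
    · rw [map_inv, Subgroup.coe_inv, e2, ← map_inv, evalUnit_val]

theorem isTwistedLoop_iff {γ : (Loop A)ˣ} : M.IsTwistedLoop γ ↔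
    ∀ l, (evalUnit l γ, evalUnit (M.omega * l) γ) ∈
      (fun p : M.GC × Aˣ => ((p.1 : Aˣ), p.2)) '' {p | (M.σ p.1 : Aˣ) = p.2} := by
  refine forall_congr' fun l => ⟨?_, ?_⟩
  · rintro ⟨g, h1, h2⟩
    exact ⟨(g, evalUnit (M.omega * l) γ), Units.ext h2, Prod.ext (Units.ext h1) rfl⟩
  · rintro ⟨⟨g, h⟩, h1, h2⟩
    simp only [Prod.mk.injEq] at h2
    have h1' : (M.σ g : Aˣ) = h := h1
    exact ⟨g, by rw [h2.1]; rfl, by rw [h1', h2.2]; rfl⟩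

theorem isClosed_twistedLoops : IsClosed (M.twistedLoops : Set (Loop A)ˣ) := by
  have : (M.twistedLoops : Set (Loop A)ˣ) = ⋂ l : Circle,
      (fun γ => (evalUnit l γ, evalUnit (M.omega * l) γ)) ⁻¹'
        ((fun p : M.GC × Aˣ => ((p.1 : Aˣ), p.2)) '' {p | (M.σ p.1 : Aˣ) = p.2}) := by
    ext γ
    simp only [mem_iInter, mem_preimage]
    exact M.isTwistedLoop_iff
  rw [this]
  refine isClosed_iInter fun l => IsClosed.preimage
    ((continuous_evalUnit l).prodMk (continuous_evalUnit _)) ?_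
  have hemb : Topology.IsClosedEmbedding (fun p : M.GC × Aˣ => ((p.1 : Aˣ), p.2)) :=
    M.isClosed_GC.isClosedEmbedding_subtypeVal.prodMap Topology.IsClosedEmbedding.id
  exact hemb.isClosedMap _ (isClosed_eq
    (continuous_subtype_val.comp (M.σ_continuous.comp continuous_fst)) continuous_snd)

/-- The group `Λ G_σ` of real twisted loops. -/
noncomputable def realLoops : Subgroup (Loop A)ˣ :=
  M.twistedLoops ⊓ ⨅ l : Circle, M.G.comap (evalUnit l)

theorem mem_realLoops {γ : (Loop A)ˣ} : γ ∈ M.realLoops ↔ M.IsRealLoop γ := by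
  simp only [realLoops, Subgroup.mem_inf, Subgroup.mem_iInf, Subgroup.mem_comap]
  refine and_congr Iff.rfl (forall_congr' fun l => ⟨fun h => ⟨_, h, rfl⟩, ?_⟩)
  rintro ⟨g, hg, e⟩
  have : evalUnit l γ = g := Units.ext e.symm
  rwa [this]

theorem isClosed_realLoops : IsClosed (M.realLoops : Set (Loop A)ˣ) := by
  simp only [realLoops, Subgroup.coe_inf, Subgroup.coe_iInf, Subgroup.coe_comap]
  exact M.isClosed_twistedLoops.inter
    (isClosed_iInter fun l => M.isClosed_G.preimage (continuous_evalUnit l))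

/-- The group `Λ⁺ G^ℂ_σ` of twisted loops which extend holomorphically to the disk. -/
def plusLoops : Subgroup (Loop A)ˣ where
  carrier := {γ | M.IsPlusLoop γ}
  one_mem' := ⟨M.twistedLoops.one_mem, fun _ => 1, diffContOnCl_const,
    fun _ _ => ⟨1, M.GC.one_mem, rfl⟩, fun _ => rfl⟩
  mul_mem' := by
    rintro γ δ ⟨hγ, Γ, h1, h2, h3⟩ ⟨hδ, Δ, h4, h5, h6⟩
    refine ⟨M.twistedLoops.mul_mem hγ hδ, _, h1.fun_mul' h4, fun w hw => ?_, fun l => by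
      simp [h3, h6]⟩
    obtain ⟨g, hg, e⟩ := h2 w hw
    obtain ⟨h, hh, e'⟩ := h5 w hw
    exact ⟨g * h, M.GC.mul_mem hg hh, by simp [e, e']⟩
  inv_mem' := by
    rintro γ ⟨hγ, Γ, h1, h2, h3⟩
    refine ⟨M.twistedLoops.inv_mem hγ, _, h1.ringInverse fun w hw => ?_, fun w hw => ?_,
      fun l => ?_⟩
    · obtain ⟨g, -, e⟩ := h2 w hw
      exact ⟨g, e⟩
    · obtain ⟨g, hg, e⟩ := h2 w hw
      exact ⟨g⁻¹, M.GC.inv_mem hg, by rw [← e, Ring.inverse_unit]⟩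
    · rw [h3, ← evalUnit_val, ← evalUnit_val, Ring.inverse_unit, map_inv]

theorem mem_plusLoops {γ : (Loop A)ˣ} : γ ∈ M.plusLoops ↔ M.IsPlusLoop γ := Iff.rfl

theorem plusLoops_le_twistedLoops : M.plusLoops ≤ M.twistedLoops := fun _ h => h.1

theorem mem_discAlgebra_of_mem_plusLoops {γ : (Loop A)ˣ} (h : γ ∈ M.plusLoops) :
    (γ : Loop A) ∈ discAlgebra A := by
  obtain ⟨-, Γ, h1, -, h3⟩ := h
  exact ⟨Γ, h1, h3⟩

/-- The extensions to the disk of a convergent sequence of plus loops converge uniformly by the maximum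
principle; so the limit extends as well, with values in the closed group `G^ℂ`.  Its extension is
invertible because the inverse loop is a limit of plus loops too. -/
theorem isClosed_plusLoops : IsClosed (M.plusLoops : Set (Loop A)ˣ) := by
  refine isClosed_of_closure_subset fun γ hγ => ?_
  have htw : γ ∈ M.twistedLoops :=
    closure_minimal M.plusLoops_le_twistedLoops M.isClosed_twistedLoops hγ
  have hdisc : (γ : Loop A) ∈ discAlgebra A :=
    closure_minimal (t := Units.val ⁻¹' (discAlgebra A : Set (Loop A)))
      (fun δ hδ => M.mem_discAlgebra_of_mem_plusLoops hδ)
      (isClosed_discAlgebra.preimage Units.continuous_val) hγ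
  have hdisc' : ((γ⁻¹ : (Loop A)ˣ) : Loop A) ∈ discAlgebra A :=
    closure_minimal (t := (fun δ : (Loop A)ˣ => ((δ⁻¹ : (Loop A)ˣ) : Loop A)) ⁻¹'
        (discAlgebra A : Set (Loop A)))
      (fun δ hδ => M.mem_discAlgebra_of_mem_plusLoops (M.plusLoops.inv_mem hδ))
      (isClosed_discAlgebra.preimage (Units.continuous_val.comp continuous_inv)) hγ
  obtain ⟨Γ, hΓ, hΓγ, hu⟩ := exists_extension_inv hdisc hdisc'
  refine ⟨htw, Γ, hΓ, fun w hw => ?_, hΓγ⟩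
  obtain ⟨u, eu⟩ := hu w hw
  refine ⟨u, mem_subgroup_of_val_mem_closure M.isClosed_GC ?_, eu⟩
  -- plus loops close to `γ` have values at `w` close to `Γ w`, by the maximum principle
  rw [Metric.mem_closure_iff]
  intro ε hε
  have hopen : IsOpen (Units.val ⁻¹' Metric.ball (γ : Loop A) ε : Set (Loop A)ˣ) :=
    Metric.isOpen_ball.preimage Units.continuous_val
  obtain ⟨δ, hδ1, -, Δ, h1, h2, h3⟩ :=
    mem_closure_iff.1 hγ _ hopen (Metric.mem_ball_self (x := (γ : Loop A)) hε)
  obtain ⟨g, hg, eg⟩ := h2 w hw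
  refine ⟨g, ⟨g, hg, rfl⟩, ?_⟩
  rw [eu, eg, dist_eq_norm]
  have hlt : ‖(γ : Loop A) - (δ : Loop A)‖ < ε := by
    rw [← dist_eq_norm, dist_comm]; exact hδ1
  refine lt_of_le_of_lt (norm_le_of_circle (hΓ.sub h1) (fun l => ?_) hw) hlt
  have := ((γ : Loop A) - (δ : Loop A)).norm_coe_le_norm l
  simpa [hΓγ, h3] using this

/-! ### Lie algebras of the loop groups -/

theorem mem_lieAlg_twistedLoops {X : Loop A} : X ∈ lieAlg M.twistedLoops ↔
    ∀ l, X l ∈ lieAlg M.GC ∧ M.dσ (X l) = X (M.omega * l) := by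
  constructor
  · intro h l
    have hl : X l ∈ lieAlg M.GC := by
      intro t
      obtain ⟨γ, hγ, e⟩ := h t
      obtain ⟨g, h1, -⟩ := hγ l
      exact ⟨g, g.2, by rw [h1, e, exp_smul_loop_apply]⟩
    refine ⟨hl, eq_of_exp_smul_eq fun t => ?_⟩
    obtain ⟨γ, hγ, e⟩ := h t
    obtain ⟨g, h1, h2⟩ := hγ l
    obtain ⟨g', h3, h4⟩ := M.exists_exp hl t
    have : g = g' := by
      refine Subtype.ext (Units.ext ?_)
      rw [h1, h3, e, exp_smul_loop_apply]
    rw [← h4, ← this, h2, e, exp_smul_loop_apply]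
  · intro h t
    refine ⟨expLoop (t • X), fun l => ?_, rfl⟩
    obtain ⟨g, h1, h2⟩ := M.exists_exp (h l).1 t
    refine ⟨g, ?_, ?_⟩
    · rw [h1, expLoop_val, exp_smul_loop_apply]
    · rw [h2, expLoop_val, exp_smul_loop_apply, (h l).2]

theorem mem_lieAlg_realLoops {X : Loop A} (h : M.IsRealLoopAlg X) : X ∈ lieAlg M.realLoops := by
  intro t
  have h1 : X ∈ lieAlg M.twistedLoops :=
    M.mem_lieAlg_twistedLoops.2 fun l => ⟨M.mem_complexAlg_of_mem (h l).1, (h l).2⟩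
  obtain ⟨γ, hγ, e⟩ := h1 t
  refine ⟨γ, M.mem_realLoops.2 ⟨hγ, fun l => ?_⟩, e⟩
  obtain ⟨g, hg, eg⟩ := (h l).1 t
  exact ⟨g, hg, by rw [eg, e, exp_smul_loop_apply]⟩

theorem mem_discAlgebra_of_mem_lieAlg_plusLoops {X : Loop A} (h : X ∈ lieAlg M.plusLoops) :
    X ∈ discAlgebra A := by
  refine mem_discAlgebra_of_exp_mem fun t => ?_
  obtain ⟨γ, hγ, e⟩ := h t
  rw [← e]
  exact M.mem_discAlgebra_of_mem_plusLoops hγ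

theorem dσ_linear {X₀ X₁ : A} (h0 : X₀ ∈ M.gr 0) (h1 : X₁ ∈ M.gr 1) (l : Circle) :
    M.dσ (X₀ + (l : ℂ) • X₁) = X₀ + ((M.omega * l : Circle) : ℂ) • X₁ := by
  rw [map_add, map_smul, h0.2, h1.2, zpow_zero, one_smul, zpow_one, smul_smul, Circle.coe_mul,
    mul_comm]

theorem linearLoop_mem_lieAlg_plusLoops {X₀ X₁ : A} (h0 : X₀ ∈ M.gr 0) (h1 : X₁ ∈ M.gr 1) :
    linearLoop X₀ X₁ ∈ lieAlg M.plusLoops := by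
  intro t
  have htw : linearLoop X₀ X₁ ∈ lieAlg M.twistedLoops := M.mem_lieAlg_twistedLoops.2 fun l =>
    ⟨M.complexAlg.add_mem h0.1 (M.complexAlg.smul_mem _ h1.1), M.dσ_linear h0 h1 l⟩
  obtain ⟨γ, hγ, e⟩ := htw t
  refine ⟨γ, ⟨hγ, fun w => exp (t • (X₀ + w • X₁)), ?_, ?_, ?_⟩, e⟩
  · have h1 : Differentiable ℂ (exp : A → A) := by
      intro x; exact (exp_analytic (𝕂 := ℂ) x).differentiableAt
    have h2 : Differentiable ℂ (fun w : ℂ => t • (X₀ + w • X₁)) := by fun_prop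
    exact (h1.comp h2).diffContOnCl
  · intro w _
    exact M.complexAlg.add_mem h0.1 (M.complexAlg.smul_mem w h1.1) t
  · intro l
    rw [e, exp_smul_loop_apply, linearLoop_apply]

end KSymmetricSpace

/-! ### The Maurer-Cartan form -/

section MaurerCartan

variable {E : Type*} [NormedAddCommGroup E] [NormedSpace ℝ E]
  {R : Type*} [NormedRing R] [NormedAlgebra ℂ R] [CompleteSpace R]

/-- The Maurer-Cartan form `G⁻¹ dG` at the point `x`, in the direction `e`. -/
noncomputable def mcForm (G : E → R) (e : E) (x : E) : R :=
  Ring.inverse (G x) * fderiv ℝ G x e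

theorem mcU_eq (F : ℂ → R) (z : ℂ) : mcU F z = mcForm F 1 z := rfl

theorem mcV_eq (F : ℂ → R) (z : ℂ) : mcV F z = mcForm F Complex.I z := rfl

theorem mcZ_eq (F : ℂ → R) (z : ℂ) :
    mcZ F z = (1 / 2 : ℂ) • (mcForm F 1 z - Complex.I • mcForm F Complex.I z) := by
  simp [mcZ, dZ, mcForm, mul_sub]

theorem mcZbar_eq (F : ℂ → R) (z : ℂ) :
    mcZbar F z = (1 / 2 : ℂ) • (mcForm F 1 z + Complex.I • mcForm F Complex.I z) := by
  simp [mcZbar, dZbar, mcForm, mul_add]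

theorem mcForm_one_eq (F : ℂ → R) (z : ℂ) : mcForm F 1 z = mcZ F z + mcZbar F z := by
  rw [mcZ_eq, mcZbar_eq]; module

theorem mcForm_I_eq (F : ℂ → R) (z : ℂ) :
    mcForm F Complex.I z = Complex.I • (mcZ F z - mcZbar F z) := by
  rw [mcZ_eq, mcZbar_eq]
  have := Complex.I_mul_I
  match_scalars <;> first | linear_combination this | linear_combination (0 : ℂ) * this

theorem fderiv_eq_mul_mcForm {G : E → R} {x : E} (h : IsUnit (G x)) (e : E) :
    fderiv ℝ G x e = G x * mcForm G e x := by
  rw [mcForm, ← mul_assoc, Ring.mul_inverse_cancel _ h, one_mul]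

theorem mcForm_congr {G H : E → R} {x : E} (h : G =ᶠ[𝓝 x] H) (e : E) :
    mcForm G e x = mcForm H e x := by
  rw [mcForm, mcForm, h.fderiv_eq, h.eq_of_nhds]

theorem mcForm_mul {F h : E → R} {x : E} (hF : DifferentiableAt ℝ F x)
    (hh : DifferentiableAt ℝ h x) (uF : IsUnit (F x)) (uh : IsUnit (h x)) (e : E) :
    mcForm (fun y => F y * h y) e x =
      Ring.inverse (h x) * mcForm F e x * h x + mcForm h e x := by
  have h1 : Ring.inverse (F x * h x) = Ring.inverse (h x) * Ring.inverse (F x) := by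
    obtain ⟨u, hu⟩ := uF
    obtain ⟨v, hv⟩ := uh
    rw [← hu, ← hv, ← Units.val_mul, Ring.inverse_unit, Ring.inverse_unit, Ring.inverse_unit,
      mul_inv_rev, Units.val_mul]
  have h2 : fderiv ℝ (fun y => F y * h y) x e = F x * fderiv ℝ h x e + fderiv ℝ F x e * h x := by
    rw [fderiv_fun_mul' hF hh]; simp
  rw [mcForm, h1, h2, mcForm, mcForm, mul_add, add_comm]
  congr 1
  · simp only [mul_assoc]
  · rw [mul_assoc, ← mul_assoc (Ring.inverse (F x)), Ring.inverse_mul_cancel _ uF, one_mul]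

theorem hasDerivAt_line {G : E → R} {x : E} (h : DifferentiableAt ℝ G x) (e : E) :
    HasDerivAt (fun s : ℝ => G (x + s • e)) (fderiv ℝ G x e) 0 :=
  (h.hasFDerivAt.hasLineDerivAt e)

/-- The Maurer-Cartan form of a map into a closed group has values in its Lie algebra. -/
theorem mcForm_mem_lieAlg {H : Subgroup Rˣ} (hH : IsClosed (H : Set Rˣ)) {G : E → R} {x : E}
    (hG : DifferentiableAt ℝ G x) (h : ∀ᶠ y in 𝓝 x, ∃ g ∈ H, (g : R) = G y) (e : E) :
    mcForm G e x ∈ lieAlg H := by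
  obtain ⟨g, hg, eg⟩ := h.self_of_nhds
  refine mem_lieAlg_of_hasDerivAt hH (γ := fun s : ℝ => Ring.inverse (G x) * G (x + s • e)) ?_
    ((hasDerivAt_line hG e).const_mul _) ?_
  · simp [← eg]
  · have : Tendsto (fun s : ℝ => x + s • e) (𝓝 0) (𝓝 x) := by
      have : Continuous fun s : ℝ => x + s • e := by fun_prop
      simpa using this.tendsto 0
    filter_upwards [this.eventually h] with s hs
    obtain ⟨g', hg', eg'⟩ := hs
    exact ⟨g⁻¹ * g', H.mul_mem (H.inv_mem hg) hg', by simp [← eg, ← eg']⟩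

theorem contDiffAt_mcForm {G : E → R} {x : E} (hG : ContDiffAt ℝ ∞ G x) (hu : IsUnit (G x))
    (e : E) : ContDiffAt ℝ ∞ (mcForm G e) x := by
  obtain ⟨u, hu⟩ := hu
  have h1 : ContDiffAt ℝ ∞ (fun y => Ring.inverse (G y)) x := by
    have := contDiffAt_ringInverse ℝ (n := ∞) u
    rw [hu] at this
    exact this.comp x hG
  have h2 : ContDiffAt ℝ ∞ (fun y => fderiv ℝ G y e) x :=
    (hG.fderiv_right (m := ∞) (by simp)).clm_apply contDiffAt_const
  exact h1.mul h2

theorem differentiableAt_mcForm {G : E → R} {x : E} (hG : ContDiffAt ℝ ∞ G x) (hu : IsUnit (G x))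
    (e : E) : DifferentiableAt ℝ (mcForm G e) x :=
  (contDiffAt_mcForm hG hu e).differentiableAt (by simp)

/-- The Maurer-Cartan equation. -/
theorem fderiv_mcForm_sub {G : E → R} {x : E} (hG : ContDiffAt ℝ ∞ G x) (hu : IsUnit (G x))
    (e₁ e₂ : E) :
    fderiv ℝ (mcForm G e₂) x e₁ - fderiv ℝ (mcForm G e₁) x e₂ =
      mcForm G e₂ x * mcForm G e₁ x - mcForm G e₁ x * mcForm G e₂ x := by
  have key : ∀ a b : E, fderiv ℝ (mcForm G a) x b =
      Ring.inverse (G x) * fderiv ℝ (fderiv ℝ G) x b a - mcForm G b x * mcForm G a x := by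
    intro a b
    have hd : DifferentiableAt ℝ (fun y => fderiv ℝ G y a) x :=
      ((hG.fderiv_right (m := ∞) (by simp)).clm_apply contDiffAt_const).differentiableAt (by simp)
    have hdG : DifferentiableAt ℝ (fderiv ℝ G) x :=
      (hG.fderiv_right (m := ∞) (by simp)).differentiableAt (by simp)
    obtain ⟨u, hu⟩ := hu
    have hi : HasFDerivAt (fun y => Ring.inverse (G y))
        ((-ContinuousLinearMap.mulLeftRight ℝ R ↑u⁻¹ ↑u⁻¹).comp (fderiv ℝ G x)) x := by
      have := hasFDerivAt_ringInverse (𝕜 := ℝ) u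
      rw [hu] at this
      exact this.comp x (hG.differentiableAt (by simp)).hasFDerivAt
    have h1 : fderiv ℝ (mcForm G a) x b = _ :=
      congrArg (fun T => T b) (hi.mul' hd.hasFDerivAt).fderiv
    rw [h1]
    have h2 : fderiv ℝ (fun y => fderiv ℝ G y a) x b = fderiv ℝ (fderiv ℝ G) x b a := by
      rw [fderiv_clm_apply hdG (differentiableAt_const a)]; simp
    have h3 : Ring.inverse (G x) = ↑u⁻¹ := by rw [← hu, Ring.inverse_unit]
    simp [h2, h3, mcForm, mul_assoc, sub_eq_add_neg]
  have hsymm := hG.isSymmSndFDerivAt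
    (by simpa using WithTop.coe_le_coe.2 (le_top : (2 : ℕ∞) ≤ ⊤)) e₁ e₂
  rw [key, key, hsymm]
  abel

end MaurerCartan

/-! ### Slices and integrals of derivatives -/

section Slices

variable {N : Type*} [NormedAddCommGroup N] [NormedSpace ℝ N] {g : ℝ × ℂ → N} {t : ℝ} {z : ℂ}

theorem hasDerivAt_slice_left (h : DifferentiableAt ℝ g (t, z)) :
    HasDerivAt (fun s => g (s, z)) (fderiv ℝ g (t, z) (1, 0)) t :=
  h.hasFDerivAt.comp_hasDerivAt (x := t) (f := fun s => (s, z))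
    ((hasDerivAt_id t).prodMk (hasDerivAt_const t z))

theorem fderiv_slice_right (h : DifferentiableAt ℝ g (t, z)) (e : ℂ) :
    fderiv ℝ (fun w => g (t, w)) z e = fderiv ℝ g (t, z) (0, e) := by
  have h1 : HasFDerivAt (fun w : ℂ => (t, w)) (ContinuousLinearMap.inr ℝ ℝ ℂ) z :=
    hasFDerivAt_prodMk_right t z
  have h2 : fderiv ℝ (fun w => g (t, w)) z = _ := (h.hasFDerivAt.comp z h1).fderiv
  simp [h2]

end Slices

section Integration

open MeasureTheory

/-- The integral of a directional derivative of a function supported in a compact subset of an open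
set vanishes. -/
theorem setIntegral_fderiv_eq_zero {S C : Set ℂ} (hS : IsOpen S) (hC : IsCompact C) (hCS : C ⊆ S)
    {Y : ℂ → ℝ} (hY : ContDiffOn ℝ 1 Y S) (h0 : ∀ z ∈ S \ C, Y z = 0) (e : ℂ) :
    ∫ z in C, fderiv ℝ Y z e = 0 := by
  set Z : ℂ → ℝ := C.indicator Y with hZ
  have hZS : ∀ z ∈ S, Z =ᶠ[𝓝 z] Y := fun z hz => by
    filter_upwards [hS.mem_nhds hz] with w hw
    by_cases hwC : w ∈ C
    · exact indicator_of_mem hwC _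
    · rw [hZ, indicator_of_notMem hwC, h0 w ⟨hw, hwC⟩]
  have hZC : ∀ z ∉ C, Z =ᶠ[𝓝 z] fun _ => 0 := fun z hz => by
    filter_upwards [hC.isClosed.isOpen_compl.mem_nhds hz] with w hw
    exact indicator_of_notMem hw _
  have hcd : ContDiff ℝ 1 Z := by
    rw [contDiff_iff_contDiffAt]
    intro z
    by_cases hz : z ∈ C
    · exact (hY.contDiffAt (hS.mem_nhds (hCS hz))).congr_of_eventuallyEq (hZS z (hCS hz))
    · exact contDiffAt_const.congr_of_eventuallyEq (hZC z hz)
  have hsupp : HasCompactSupport Z := by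
    refine HasCompactSupport.intro hC fun z hz => ?_
    exact indicator_of_notMem hz _
  have hcont : Continuous fun z => fderiv ℝ Z z e :=
    (hcd.continuous_fderiv one_ne_zero).clm_apply continuous_const
  have hsupp' : HasCompactSupport fun z => fderiv ℝ Z z e := hsupp.fderiv_apply ℝ e
  have h1 : ∫ z in C, fderiv ℝ Y z e = ∫ z in C, fderiv ℝ Z z e := by
    refine setIntegral_congr_fun hC.measurableSet fun z hz => ?_
    simp only [(hZS z (hCS hz)).fderiv_eq]
  have h2 : ∫ z in C, fderiv ℝ Z z e = ∫ z, fderiv ℝ Z z e := by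
    refine setIntegral_eq_integral_of_forall_compl_eq_zero fun z hz => ?_
    rw [(hZC z hz).fderiv_eq]; simp
  have h3 := integral_mul_fderiv_eq_neg_fderiv_mul_of_integrable (𝕜 := ℝ) (μ := (volume : Measure ℂ))
    (f := Z) (g := fun _ => (1 : ℝ)) (v := e)
    (by simpa using hcont.integrable_of_hasCompactSupport hsupp')
    (by simp) (by simpa using hcd.continuous.integrable_of_hasCompactSupport hsupp)
    (fun x _ => hcd.differentiable one_ne_zero x) (fun x _ => differentiableAt_const _)
  rw [h1, h2]
  simpa using h3

/-- Differentiation under the integral sign over a compact set. -/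
theorem hasDerivAt_setIntegral_of_contDiffOn {S C : Set ℂ} (hS : IsOpen S) (hC : IsCompact C)
    (hCS : C ⊆ S) {e : ℝ × ℂ → ℝ} (he : ContDiffOn ℝ 1 e (univ ×ˢ S)) (t₀ : ℝ) :
    HasDerivAt (fun t => ∫ z in C, e (t, z)) (∫ z in C, fderiv ℝ e (t₀, z) (1, 0)) t₀ := by
  have hopen : IsOpen ((univ : Set ℝ) ×ˢ S) := isOpen_univ.prod hS
  have hfd : ContinuousOn (fun p : ℝ × ℂ => fderiv ℝ e p (1, 0)) (univ ×ˢ S) :=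
    (he.continuousOn_fderiv_of_isOpen hopen le_rfl).clm_apply continuousOn_const
  have hcomp : IsCompact (Icc (t₀ - 1) (t₀ + 1) ×ˢ C) := isCompact_Icc.prod hC
  obtain ⟨K, hK⟩ := hcomp.exists_bound_of_continuousOn
    (hfd.mono (prod_mono (subset_univ _) hCS))
  have hslice : ∀ t : ℝ, ContinuousOn (fun z => e (t, z)) C := fun t =>
    he.continuousOn.comp (by fun_prop) fun z hz => ⟨mem_univ _, hCS hz⟩
  have hslice' : ContinuousOn (fun z => fderiv ℝ e (t₀, z) (1, 0)) C :=
    hfd.comp (f := fun z => (t₀, z)) (by fun_prop) fun z hz => ⟨mem_univ _, hCS hz⟩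
  refine (hasDerivAt_integral_of_dominated_loc_of_deriv_le (μ := volume.restrict C)
    (F := fun t z => e (t, z)) (F' := fun t z => fderiv ℝ e (t, z) (1, 0)) (bound := fun _ => K)
    (Icc_mem_nhds (sub_one_lt t₀) (lt_add_one t₀)) ?_ ?_ ?_ ?_ ?_ ?_).2
  · exact Eventually.of_forall fun t => (hslice t).aestronglyMeasurable hC.measurableSet
  · exact (hslice t₀).integrableOn_compact hC
  · exact hslice'.aestronglyMeasurable hC.measurableSet
  · filter_upwards [ae_restrict_mem hC.measurableSet] with z hz t ht
    exact hK (t, z) ⟨ht, hz⟩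
  · have : IsFiniteMeasure (volume.restrict C) := ⟨by simpa using hC.measure_lt_top⟩
    exact integrable_const _
  · filter_upwards [ae_restrict_mem hC.measurableSet] with z hz t ht
    exact hasDerivAt_slice_left
      ((he.contDiffAt (hopen.mem_nhds ⟨mem_univ _, hCS hz⟩)).differentiableAt one_ne_zero)

end Integration

namespace KSymmetricSpace

variable {A : Type*} [NormedRing A] [NormedAlgebra ℂ A] [FiniteDimensional ℂ A]
  {M : KSymmetricSpace A}

/-! ### Frames -/

theorem IsFrame.isUnit {S : Set ℂ} {f : ℂ → M.Quot} {F : ℂ → A} (h : M.IsFrame S f F) {z : ℂ}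
    (hz : z ∈ S) : IsUnit (F z) := by
  obtain ⟨g, hg, -⟩ := h.2 z hz
  exact ⟨g, hg⟩

theorem IsFrame.exists_mem_G {S : Set ℂ} {f : ℂ → M.Quot} {F : ℂ → A} (h : M.IsFrame S f F) {z : ℂ}
    (hz : z ∈ S) : ∃ g ∈ M.G, (g : A) = F z := by
  obtain ⟨g, hg, -⟩ := h.2 z hz
  exact ⟨g, g.2, hg⟩

theorem IsFrame.contDiffAt {S : Set ℂ} (hS : IsOpen S) {f : ℂ → M.Quot} {F : ℂ → A}
    (h : M.IsFrame S f F) {z : ℂ} (hz : z ∈ S) : ContDiffAt ℝ ∞ F z :=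
  h.1.contDiffAt (hS.mem_nhds hz)

theorem IsFrame.mcForm_mem {S : Set ℂ} (hS : IsOpen S) {f : ℂ → M.Quot} {F : ℂ → A}
    (h : M.IsFrame S f F) {z : ℂ} (hz : z ∈ S) (e : ℂ) : mcForm F e z ∈ lieAlg M.G := by
  refine mcForm_mem_lieAlg M.isClosed_G ((h.contDiffAt hS hz).differentiableAt (by simp)) ?_ e
  filter_upwards [hS.mem_nhds hz] with w hw
  exact h.exists_mem_G hw

/-- Two representatives of a point of `G/K` differ by an element of `K`. -/
theorem exists_mem_K {q : M.Quot} {a b : A} (ha : ∃ g : M.G, ((g : Aˣ) : A) = a ∧ q = (g : M.Quot))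
    (hb : ∃ g : M.G, ((g : Aˣ) : A) = b ∧ q = (g : M.Quot)) :
    ∃ k ∈ M.K, (k : A) = Ring.inverse a * b := by
  obtain ⟨g, rfl, hg⟩ := ha
  obtain ⟨h, rfl, hh⟩ := hb
  have := QuotientGroup.eq.1 (hg.symm.trans hh)
  rw [Subgroup.mem_subgroupOf] at this
  exact ⟨_, this, by simp⟩

/-- A change of frame by a `K`-valued map conjugates the `𝔪`-part of the Maurer-Cartan form. -/
theorem mPart_mcForm_mul {E : Type*} [NormedAddCommGroup E] [NormedSpace ℝ E] {F h : E → A} {x : E}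
    (hF : DifferentiableAt ℝ F x) (hh : DifferentiableAt ℝ h x)
    (hFG : ∀ᶠ y in 𝓝 x, ∃ g ∈ M.G, (g : A) = F y) {k : Aˣ} (hk : k ∈ M.K) (hkx : (k : A) = h x)
    (hhK : ∀ᶠ y in 𝓝 x, ∃ g ∈ M.K, (g : A) = h y) (e : E) :
    M.mPart (mcForm (fun y => F y * h y) e x) =
      ((k⁻¹ : Aˣ) : A) * M.mPart (mcForm F e x) * k := by
  obtain ⟨g, -, hg⟩ := hFG.self_of_nhds
  rw [mcForm_mul hF hh ⟨g, hg⟩ ⟨k, hkx⟩]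
  have h1 : mcForm h e x ∈ M.kAlg := M.lieAlg_K_subset (mcForm_mem_lieAlg M.isClosed_K hh hhK e)
  have h2 := M.mem_complexAlg_of_mem (mcForm_mem_lieAlg M.isClosed_G hF hFG e)
  rw [← mPartL_apply, map_add, mPartL_apply, mPartL_apply, M.mPart_of_mem_gr_zero h1.2, add_zero,
    ← hkx, Ring.inverse_unit]
  simpa using M.mPart_conj_K (M.K.inv_mem hk) h2

theorem energyDensity_mul {B : A →ₗ[ℝ] A →ₗ[ℝ] ℝ} (hB : M.IsInvariantMetric B) {F h : ℂ → A} {z : ℂ}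
    (hF : DifferentiableAt ℝ F z) (hh : DifferentiableAt ℝ h z)
    (hFG : ∀ᶠ y in 𝓝 z, ∃ g ∈ M.G, (g : A) = F y)
    (hhK : ∀ᶠ y in 𝓝 z, ∃ g ∈ M.K, (g : A) = h y) :
    M.energyDensity B (fun y => F y * h y) z = M.energyDensity B F z := by
  obtain ⟨k, hk, hkx⟩ := hhK.self_of_nhds
  have hm : ∀ e : ℂ, M.mPart (mcForm F e z) ∈ lieAlg M.G := fun e =>
    M.mPart_mem_real (mcForm_mem_lieAlg M.isClosed_G hF hFG e)
  have key : ∀ e : ℂ, B (M.mPart (mcForm (fun y => F y * h y) e z))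
      (M.mPart (mcForm (fun y => F y * h y) e z)) =
        B (M.mPart (mcForm F e z)) (M.mPart (mcForm F e z)) := by
    intro e
    rw [mPart_mcForm_mul hF hh hFG hk hkx hhK e]
    simpa using hB.invariant k⁻¹ (M.G.inv_mem (M.K_le_G hk)) _ (hm e) _ (hm e)
  simp only [energyDensity, mcU_eq, mcV_eq, key]

/-! ### The invariant metric -/

theorem IsInvariantMetric.mPart_kPart {B : A →ₗ[ℝ] A →ₗ[ℝ] ℝ} (hB : M.IsInvariantMetric B) {X Y : A}
    (hX : X ∈ lieAlg M.G) (hY : Y ∈ lieAlg M.G) : B (M.mPart X) (M.kPart Y) = 0 := by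
  rw [hB.symm _ (M.mPart_mem_real hX) _ (M.kPart_mem_real hY)]
  exact hB.orthogonal _ (M.kPart_mem_kAlg hY) _ (M.mPart_mem_mAlg hX)

theorem hasDerivAt_bilin (B : A →ₗ[ℝ] A →ₗ[ℝ] ℝ) {x y : ℝ → A} {x' y' : A} {t : ℝ}
    (hx : HasDerivAt x x' t) (hy : HasDerivAt y y' t) :
    HasDerivAt (fun s => B (x s) (y s)) (B x' (y t) + B (x t) y') t := by
  have : FiniteDimensional ℝ A := FiniteDimensional.complexToReal A
  exact (B.toContinuousBilinearMap.hasFDerivAt.comp_hasDerivAt t hx).clm_apply hy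

theorem IsInvariantMetric.ad_invariant {B : A →ₗ[ℝ] A →ₗ[ℝ] ℝ} (hB : M.IsInvariantMetric B)
    {X Y Z : A} (hX : X ∈ lieAlg M.G) (hY : Y ∈ lieAlg M.G) (hZ : Z ∈ lieAlg M.G) :
    B (Z * X - X * Z) Y + B X (Z * Y - Y * Z) = 0 := by
  have hd : ∀ W : A, HasDerivAt (fun t : ℝ => exp (t • Z) * W * exp (t • -Z)) (Z * W - W * Z) 0 := by
    intro W
    simpa [sub_eq_add_neg] using
      ((hasDerivAt_exp_smul_zero Z).mul_const W).fun_mul (hasDerivAt_exp_smul_zero (-Z))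
  have h1 := hasDerivAt_bilin B (hd X) (hd Y)
  have h2 : (fun t : ℝ => B (exp (t • Z) * X * exp (t • -Z)) (exp (t • Z) * Y * exp (t • -Z))) =
      fun _ => B X Y := by
    funext t
    obtain ⟨g, hg, e⟩ := hZ t
    have e' : ((g⁻¹ : Aˣ) : A) = exp (t • -Z) := by
      let _ : NormedAlgebra ℚ A := .restrictScalars ℚ ℂ A
      rw [smul_neg, ← Ring.inverse_exp, ← e, Ring.inverse_unit]
    rw [← e, ← e']
    exact hB.invariant g hg X hX Y hY
  rw [h2] at h1
  simpa using h1.unique (hasDerivAt_const _ _)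

/-! ### The harmonic map equation -/

variable (M) in
/-- The harmonic map equation for a frame `F` with `β = F⁻¹ dF`:
`∑ₑ (∂ₑ β_𝔪(e) + [β_𝔨(e), β_𝔪(e)]) = 0`, where `e` runs through the two coordinate directions. -/
def IsHarmonicFrame (S : Set ℂ) (F : ℂ → A) : Prop :=
  ∀ z ∈ S, ∑ e ∈ ({1, Complex.I} : Finset ℂ),
    (M.mPart (fderiv ℝ (mcForm F e) z e) +
      (M.kPart (mcForm F e z) * M.mPart (mcForm F e z) -
        M.mPart (mcForm F e z) * M.kPart (mcForm F e z))) = 0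

theorem sum_one_I {N : Type*} [AddCommMonoid N] (φ : ℂ → N) :
    ∑ e ∈ ({1, Complex.I} : Finset ℂ), φ e = φ 1 + φ Complex.I := by
  refine Finset.sum_pair fun h => ?_
  have := congrArg Complex.re h
  simp at this

theorem energyDensity_eq_sum (B : A →ₗ[ℝ] A →ₗ[ℝ] ℝ) (F : ℂ → A) (z : ℂ) :
    M.energyDensity B F z = (1 / 2) * ∑ e ∈ ({1, Complex.I} : Finset ℂ),
      B (M.mPart (mcForm F e z)) (M.mPart (mcForm F e z)) := by
  rw [sum_one_I]; rfl

variable (M) in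
/-- The projection onto `𝔪^ℂ` as a continuous real linear map. -/
noncomputable def mPartC : A →L[ℝ] A :=
  have : FiniteDimensional ℝ A := FiniteDimensional.complexToReal A
  LinearMap.toContinuousLinearMap (M.mPartL.restrictScalars ℝ)

theorem mPartC_apply (X : A) : M.mPartC X = M.mPart X := M.mPartL_apply X

theorem fderiv_mem_realAlg {E : Type*} [NormedAddCommGroup E] [NormedSpace ℝ E] {ξ : E → A} {x : E}
    (hξ : DifferentiableAt ℝ ξ x) (h : ∀ᶠ y in 𝓝 x, ξ y ∈ lieAlg M.G) (e : E) :
    fderiv ℝ ξ x e ∈ lieAlg M.G := by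
  refine mem_submodule_of_hasDerivAt (P := M.realAlg) M.isClosed_realAlg (hasDerivAt_line hξ e) ?_
  have : Tendsto (fun s : ℝ => x + s • e) (𝓝 0) (𝓝 x) := by
    have : Continuous fun s : ℝ => x + s • e := by fun_prop
    simpa using this.tendsto 0
  exact this.eventually h

/-- The pointwise algebra behind the first variation formula, where `β = F⁻¹ ∂F`, `β' = ∂β` and
`ξ' = ∂ξ`. -/
theorem bilin_first_variation {B : A →ₗ[ℝ] A →ₗ[ℝ] ℝ} (hB : M.IsInvariantMetric B)
    {β β' ξ ξ' : A} (hβ : β ∈ lieAlg M.G) (hξ : ξ ∈ lieAlg M.G) (hξ' : ξ' ∈ lieAlg M.G) :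
    B (M.mPart β) (M.mPart (ξ' - (ξ * β - β * ξ))) =
      (B (M.mPart β') ξ + B (M.mPart β) ξ') -
        B (M.mPart β' + (M.kPart β * M.mPart β - M.mPart β * M.kPart β)) ξ := by
  have hc : ξ * β - β * ξ ∈ lieAlg M.G := commutator_mem_lieAlg M.isClosed_G hξ hβ
  have hW : ξ' - (ξ * β - β * ξ) ∈ lieAlg M.G := M.realAlg.sub_mem hξ' hc
  have h1 : B (M.mPart β) (M.mPart (ξ' - (ξ * β - β * ξ))) =
      B (M.mPart β) (ξ' - (ξ * β - β * ξ)) := by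
    conv_rhs => rw [← M.mPart_add_kPart (ξ' - (ξ * β - β * ξ))]
    rw [map_add, hB.mPart_kPart hβ hW, add_zero]
  have h2 := hB.ad_invariant (M.mPart_mem_real hβ) hξ hβ
  have h0 : ∀ m k b : A, m + k = b → k * m - m * k = b * m - m * b := by
    rintro m k _ rfl
    noncomm_ring
  -- `[β_𝔨, β_𝔪] = [β, β_𝔪]`
  have h3 := h0 _ _ _ (M.mPart_add_kPart β)
  rw [h1, h3, map_sub, map_add, LinearMap.add_apply]
  have h4 : B (M.mPart β) (ξ * β - β * ξ) = - B (M.mPart β) (β * ξ - ξ * β) := by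
    rw [← map_neg, neg_sub]
  rw [h4]
  linarith

/-- The harmonic map equation for a frame implies that the map is a critical point of the energy:
the first variation of the energy density is a divergence. -/
theorem isHarmonic_of_isHarmonicFrame {B : A →ₗ[ℝ] A →ₗ[ℝ] ℝ} (hB : M.IsInvariantMetric B)
    {S : Set ℂ} (hS : IsOpen S) {f : ℂ → M.Quot} {F : ℂ → A} (hF : M.IsFrame S f F)
    (hHM : M.IsHarmonicFrame S F) : M.IsHarmonic B S f := by
  refine ⟨⟨F, hF⟩, fun C ft Φ hC hCS hf0 hfC hΦ hΦF => ?_⟩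
  have hopen : IsOpen ((univ : Set ℝ) ×ˢ S) := isOpen_univ.prod hS
  -- change the frames `Φ t` by a `K`-valued map so that the variation starts at `F`
  let h : ℂ → A := fun z => Ring.inverse (Φ 0 z) * F z
  have hhK : ∀ z ∈ S, ∃ k ∈ M.K, (k : A) = h z := fun z hz =>
    exists_mem_K ((hΦF 0).2 z hz) (by rw [hf0 z hz]; exact hF.2 z hz)
  have hhd : ∀ z ∈ S, ContDiffAt ℝ ∞ h z := by
    intro z hz
    obtain ⟨u, hu⟩ := (hΦF 0).isUnit hz
    have h1 := contDiffAt_ringInverse ℝ (n := ∞) u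
    rw [hu] at h1
    exact (h1.comp z ((hΦF 0).contDiffAt hS hz)).mul (hF.contDiffAt hS hz)
  let Ψ : ℝ × ℂ → A := fun p => Φ p.1 p.2 * h p.2
  have hΨd : ∀ t : ℝ, ∀ z ∈ S, ContDiffAt ℝ ∞ Ψ (t, z) := by
    intro t z hz
    exact (hΦ.contDiffAt (hopen.mem_nhds ⟨mem_univ _, hz⟩)).mul
      ((hhd z hz).comp (t, z) contDiffAt_snd)
  have hΨG : ∀ t : ℝ, ∀ z ∈ S, ∃ g ∈ M.G, (g : A) = Ψ (t, z) := by
    intro t z hz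
    obtain ⟨g, hg, e⟩ := (hΦF t).exists_mem_G hz
    obtain ⟨k, hk, e'⟩ := hhK z hz
    exact ⟨g * k, M.G.mul_mem hg (M.K_le_G hk), by simp [Ψ, e, e']⟩
  have hΨG' : ∀ t : ℝ, ∀ z ∈ S, ∀ᶠ p in 𝓝 (t, z), ∃ g ∈ M.G, (g : A) = Ψ p := by
    intro t z hz
    filter_upwards [hopen.mem_nhds (show (t, z) ∈ univ ×ˢ S from ⟨mem_univ _, hz⟩)] with p hp
    exact hΨG p.1 p.2 hp.2
  have hΨu : ∀ t : ℝ, ∀ z ∈ S, IsUnit (Ψ (t, z)) := by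
    intro t z hz
    obtain ⟨g, -, e⟩ := hΨG t z hz
    exact ⟨g, e⟩
  have hΨ0 : ∀ z ∈ S, Ψ (0, z) = F z := by
    intro z hz
    simp only [Ψ, h]
    rw [← mul_assoc, Ring.mul_inverse_cancel _ ((hΦF 0).isUnit hz), one_mul]
  have hθ : ∀ (t : ℝ) (e : ℝ × ℂ), ∀ z ∈ S, mcForm Ψ e (t, z) ∈ lieAlg M.G := fun t e z hz =>
    mcForm_mem_lieAlg M.isClosed_G ((hΨd t z hz).differentiableAt (by simp)) (hΨG' t z hz) e
  have hθd : ∀ (t : ℝ) (e : ℝ × ℂ), ∀ z ∈ S, ContDiffAt ℝ ∞ (mcForm Ψ e) (t, z) :=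
    fun t e z hz => contDiffAt_mcForm (hΨd t z hz) (hΨu t z hz) e
  -- the Maurer-Cartan form of a slice
  have hslice : ∀ (t : ℝ) (e : ℂ), ∀ z ∈ S,
      mcForm (fun w => Ψ (t, w)) e z = mcForm Ψ (0, e) (t, z) := by
    intro t e z hz
    rw [mcForm, fderiv_slice_right ((hΨd t z hz).differentiableAt (by simp)), mcForm]
  let en : ℝ × ℂ → ℝ := fun p => (1 / 2) * ∑ e ∈ ({1, Complex.I} : Finset ℂ),
    B (M.mPart (mcForm Ψ (0, e) p)) (M.mPart (mcForm Ψ (0, e) p))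
  have hen : ∀ t : ℝ, ∀ z ∈ S, M.energyDensity B (Φ t) z = en (t, z) := by
    intro t z hz
    have h1 := energyDensity_mul hB (F := Φ t) (h := h) (z := z)
      (((hΦF t).contDiffAt hS hz).differentiableAt (by simp))
      ((hhd z hz).differentiableAt (by simp))
      (by filter_upwards [hS.mem_nhds hz] with w hw using (hΦF t).exists_mem_G hw)
      (by filter_upwards [hS.mem_nhds hz] with w hw using hhK w hw)
    rw [← h1, energyDensity_eq_sum]
    simp only [en]
    congr 1
    refine Finset.sum_congr rfl fun e _ => ?_
    have := hslice t e z hz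
    simp only [Ψ] at this ⊢
    rw [this]
  have : FiniteDimensional ℝ A := FiniteDimensional.complexToReal A
  have hend : ContDiffOn ℝ 1 en (univ ×ˢ S) := by
    intro p hp
    refine ContDiffAt.contDiffWithinAt ?_
    refine contDiffAt_const.mul (ContDiffAt.sum fun e _ => ?_)
    have h1 : ContDiffAt ℝ 1 (fun p => M.mPartC (mcForm Ψ (0, e) p)) p :=
      M.mPartC.contDiff.contDiffAt.comp p ((hθd p.1 (0, e) p.2 hp.2).of_le (by simp))
    simp only [mPartC_apply] at h1
    exact (B.toContinuousBilinearMap.contDiff.contDiffAt.comp p h1).clm_apply h1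
  have hder := hasDerivAt_setIntegral_of_contDiffOn hS hC hCS hend 0
  have hint : (fun t => ∫ z in C, M.energyDensity B (Φ t) z) = fun t => ∫ z in C, en (t, z) := by
    funext t
    exact MeasureTheory.setIntegral_congr_fun hC.measurableSet fun z hz => hen t z (hCS hz)
  rw [hint]
  convert hder using 1
  -- the variation field and the vector field whose divergence is the first variation
  let ξ : ℂ → A := fun z => mcForm Ψ (1, 0) (0, z)
  have hξd : ∀ z ∈ S, ContDiffAt ℝ ∞ ξ z := fun z hz =>
    (hθd 0 (1, 0) z hz).comp z (contDiffAt_const.prodMk contDiffAt_id)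
  have hξG : ∀ z ∈ S, ξ z ∈ lieAlg M.G := fun z hz => hθ 0 (1, 0) z hz
  let Y : ℂ → ℂ → ℝ := fun e z => B (M.mPart (mcForm F e z)) (ξ z)
  have hβd : ∀ e : ℂ, ∀ z ∈ S, ContDiffAt ℝ ∞ (mcForm F e) z := fun e z hz =>
    contDiffAt_mcForm (hF.contDiffAt hS hz) (hF.isUnit hz) e
  have hYd : ∀ e, ContDiffOn ℝ 1 (Y e) S := by
    intro e z hz
    refine ContDiffAt.contDiffWithinAt ?_
    have h1 : ContDiffAt ℝ 1 (fun z => M.mPartC (mcForm F e z)) z :=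
      M.mPartC.contDiff.contDiffAt.comp z ((hβd e z hz).of_le (by simp))
    simp only [mPartC_apply] at h1
    exact (B.toContinuousBilinearMap.contDiff.contDiffAt.comp z h1).clm_apply
      ((hξd z hz).of_le (by simp))
  have hY0 : ∀ e, ∀ z ∈ S \ C, Y e z = 0 := by
    intro e z hz
    -- outside `C` the variation is `K`-valued relative to `F`
    have hcurve : ∀ t : ℝ, ∃ k ∈ M.K, (k : A) = Ring.inverse (Ψ (0, z)) * Ψ (t, z) := by
      intro t
      have h1 := hF.2 z hz.1
      rw [← hΨ0 z hz.1] at h1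
      refine exists_mem_K h1 ?_
      obtain ⟨g, hg, hg'⟩ := (hΦF t).2 z hz.1
      rw [hfC t z hz] at hg'
      obtain ⟨k, hk, e'⟩ := hhK z hz.1
      refine ⟨g * ⟨k, M.K_le_G hk⟩, by simp [Ψ, hg, e'], ?_⟩
      rw [hg', QuotientGroup.eq, Subgroup.mem_subgroupOf]
      simpa using hk
    have hξK : ξ z ∈ M.kAlg := by
      refine M.lieAlg_K_subset (mem_lieAlg_of_hasDerivAt M.isClosed_K
        (γ := fun t => Ring.inverse (Ψ (0, z)) * Ψ (t, z))
        (Ring.inverse_mul_cancel _ (hΨu 0 z hz.1)) ?_ (Eventually.of_forall hcurve))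
      exact (hasDerivAt_slice_left ((hΨd 0 z hz.1).differentiableAt (by simp))).const_mul _
    have h5 := hB.mPart_kPart (hF.mcForm_mem hS hz.1 e) hξK.1
    rwa [M.kPart_of_mem_gr_zero hξK.2] at h5
  have hdiv : ∀ z ∈ S, fderiv ℝ en (0, z) (1, 0) =
      ∑ e ∈ ({1, Complex.I} : Finset ℂ), fderiv ℝ (Y e) z e := by
    intro z hz
    have hb0 : ∀ e : ℂ, mcForm Ψ (0, e) (0, z) = mcForm F e z := by
      intro e
      rw [← hslice 0 e z hz]
      refine mcForm_congr ?_ e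
      filter_upwards [hS.mem_nhds hz] with w hw using hΨ0 w hw
    -- by the Maurer-Cartan equation, `∂ₜ β(e) = ∂ₑ ξ - [ξ, β(e)]`
    have hb : ∀ e : ℂ, HasDerivAt (fun t : ℝ => M.mPart (mcForm Ψ (0, e) (t, z)))
        (M.mPart (fderiv ℝ ξ z e - (ξ z * mcForm F e z - mcForm F e z * ξ z))) 0 := by
      intro e
      have h1 := M.mPartC.hasFDerivAt.comp_hasDerivAt (0 : ℝ)
        (hasDerivAt_slice_left ((hθd 0 (0, e) z hz).differentiableAt (by simp)))
      have h2 := fderiv_mcForm_sub (hΨd 0 z hz) (hΨu 0 z hz) (1, 0) (0, e)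
      have h3 : fderiv ℝ ξ z e = fderiv ℝ (mcForm Ψ (1, 0)) (0, z) (0, e) :=
        fderiv_slice_right ((hθd 0 (1, 0) z hz).differentiableAt (by simp)) e
      have h4 : fderiv ℝ (mcForm Ψ (0, e)) (0, z) (1, 0) =
          fderiv ℝ ξ z e - (ξ z * mcForm F e z - mcForm F e z * ξ z) := by
        rw [← hb0 e, h3, ← neg_sub (mcForm Ψ (0, e) (0, z) * ξ z), sub_neg_eq_add, add_comm]
        exact eq_add_of_sub_eq h2
      rw [← h4]
      simpa only [Function.comp_def, mPartC_apply] using h1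
    have hβ : ∀ e, mcForm F e z ∈ lieAlg M.G := fun e => hF.mcForm_mem hS hz e
    have hξ' : ∀ e, fderiv ℝ ξ z e ∈ lieAlg M.G := fun e =>
      fderiv_mem_realAlg ((hξd z hz).differentiableAt (by simp))
        (by filter_upwards [hS.mem_nhds hz] with w hw using hξG w hw) e
    have hen' : HasDerivAt (fun t : ℝ => en (t, z)) ((1 / 2) *
        ∑ e ∈ ({1, Complex.I} : Finset ℂ),
          (B (M.mPart (fderiv ℝ ξ z e - (ξ z * mcForm F e z - mcForm F e z * ξ z)))
              (M.mPart (mcForm Ψ (0, e) (0, z))) +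
            B (M.mPart (mcForm Ψ (0, e) (0, z)))
              (M.mPart (fderiv ℝ ξ z e - (ξ z * mcForm F e z - mcForm F e z * ξ z))))) 0 :=
      (HasDerivAt.fun_sum fun e _ => hasDerivAt_bilin B (hb e) (hb e)).const_mul _
    have hen'' : HasDerivAt (fun t : ℝ => en (t, z)) (fderiv ℝ en (0, z) (1, 0)) 0 := by
      exact hasDerivAt_slice_left ((hend.contDiffAt (hopen.mem_nhds (show ((0 : ℝ), z) ∈ univ ×ˢ S
        from ⟨mem_univ _, hz⟩))).differentiableAt one_ne_zero)
    rw [hen''.unique hen']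
    have hYder : ∀ e, fderiv ℝ (Y e) z e =
        B (M.mPart (fderiv ℝ (mcForm F e) z e)) (ξ z) +
          B (M.mPart (mcForm F e z)) (fderiv ℝ ξ z e) := by
      intro e
      have h1 := hasDerivAt_line (R := A) ((hβd e z hz).differentiableAt (by simp)) e
      have h2 := M.mPartC.hasFDerivAt.comp_hasDerivAt (0 : ℝ) h1
      have h3 := hasDerivAt_line (R := A) ((hξd z hz).differentiableAt (by simp)) e
      simp only [Function.comp_def, mPartC_apply] at h2
      have h4 := hasDerivAt_bilin B h2 h3
      simp only [zero_smul, add_zero] at h4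
      have h5 : HasDerivAt (fun s : ℝ => Y e (z + s • e)) (fderiv ℝ (Y e) z e) 0 :=
        ((((hYd e).contDiffAt (hS.mem_nhds hz)).differentiableAt
          one_ne_zero).hasFDerivAt.hasLineDerivAt e)
      exact h5.unique h4
    have hterm : ∀ e, B (M.mPart (mcForm F e z))
        (M.mPart (fderiv ℝ ξ z e - (ξ z * mcForm F e z - mcForm F e z * ξ z))) =
        fderiv ℝ (Y e) z e - B (M.mPart (fderiv ℝ (mcForm F e) z e) +
          (M.kPart (mcForm F e z) * M.mPart (mcForm F e z) -
            M.mPart (mcForm F e z) * M.kPart (mcForm F e z))) (ξ z) := by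
      intro e
      rw [hYder e]
      exact bilin_first_variation hB (hβ e) (hξG z hz) (hξ' e)
    have hsym : ∀ e, B (M.mPart (fderiv ℝ ξ z e - (ξ z * mcForm F e z - mcForm F e z * ξ z)))
        (M.mPart (mcForm F e z)) = B (M.mPart (mcForm F e z))
        (M.mPart (fderiv ℝ ξ z e - (ξ z * mcForm F e z - mcForm F e z * ξ z))) := by
      intro e
      refine hB.symm _ (M.mPart_mem_real ?_) _ (M.mPart_mem_real (hβ e))
      exact M.realAlg.sub_mem (hξ' e) (commutator_mem_lieAlg M.isClosed_G (hξG z hz) (hβ e))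
    simp only [hb0, hsym, hterm]
    have hHMz := congrArg (fun X => B X (ξ z)) (hHM z hz)
    simp only [sum_one_I, map_add, LinearMap.add_apply, map_zero, LinearMap.zero_apply] at hHMz ⊢
    linarith
  symm
  rw [MeasureTheory.setIntegral_congr_fun hC.measurableSet fun z hz => hdiv z (hCS hz)]
  simp only [sum_one_I]
  have hI : ∀ e, MeasureTheory.IntegrableOn (fun z => fderiv ℝ (Y e) z e) C := fun e =>
    (((hYd e).continuousOn_fderiv_of_isOpen hS le_rfl).clm_apply
      continuousOn_const).mono hCS |>.integrableOn_compact hC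
  rw [MeasureTheory.integral_add (hI 1) (hI Complex.I),
    setIntegral_fderiv_eq_zero hS hC hCS (hYd 1) (hY0 1) 1,
    setIntegral_fderiv_eq_zero hS hC hCS (hYd _) (hY0 _) Complex.I, add_zero]

end KSymmetricSpace

/-! ### Wirtinger derivatives and integrability of the loop of forms -/

section Wirtinger

variable {R : Type*} [NormedRing R] [NormedAlgebra ℂ R]

theorem dZ_congr {F G : ℂ → R} {z : ℂ} (h : F =ᶠ[𝓝 z] G) : dZ F z = dZ G z := by
  rw [dZ, dZ, h.fderiv_eq]

theorem dZbar_congr {F G : ℂ → R} {z : ℂ} (h : F =ᶠ[𝓝 z] G) : dZbar F z = dZbar G z := by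
  rw [dZbar, dZbar, h.fderiv_eq]

theorem dZ_smul_add {p q : ℂ → R} {z : ℂ} (c : ℂ) (hp : DifferentiableAt ℝ p z)
    (hq : DifferentiableAt ℝ q z) : dZ (fun w => c • p w + q w) z = c • dZ p z + dZ q z := by
  have h1 : fderiv ℝ (fun w => c • p w + q w) z = c • fderiv ℝ p z + fderiv ℝ q z := by
    rw [fderiv_fun_add (hp.fun_const_smul c) hq, fderiv_fun_const_smul hp]
  simp only [dZ, h1, add_apply, smul_apply]
  module

theorem dZbar_smul_add {p q : ℂ → R} {z : ℂ} (c : ℂ) (hp : DifferentiableAt ℝ p z)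
    (hq : DifferentiableAt ℝ q z) :
    dZbar (fun w => c • p w + q w) z = c • dZbar p z + dZbar q z := by
  have h1 : fderiv ℝ (fun w => c • p w + q w) z = c • fderiv ℝ p z + fderiv ℝ q z := by
    rw [fderiv_fun_add (hp.fun_const_smul c) hq, fderiv_fun_const_smul hp]
  simp only [dZbar, h1, add_apply, smul_apply]
  module

variable [CompleteSpace R]

theorem differentiableAt_mcZ {G : ℂ → R} {z : ℂ} (hG : ContDiffAt ℝ ∞ G z) (hu : IsUnit (G z)) :
    DifferentiableAt ℝ (mcZ G) z := by
  rw [funext (mcZ_eq G)]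
  exact ((differentiableAt_mcForm hG hu 1).fun_sub
    ((differentiableAt_mcForm hG hu Complex.I).fun_const_smul Complex.I)).fun_const_smul (1 / 2 : ℂ)

theorem differentiableAt_mcZbar {G : ℂ → R} {z : ℂ} (hG : ContDiffAt ℝ ∞ G z)
    (hu : IsUnit (G z)) : DifferentiableAt ℝ (mcZbar G) z := by
  rw [funext (mcZbar_eq G)]
  exact ((differentiableAt_mcForm hG hu 1).fun_add
    ((differentiableAt_mcForm hG hu Complex.I).fun_const_smul Complex.I)).fun_const_smul (1 / 2 : ℂ)

/-- The Maurer-Cartan equation in terms of the Wirtinger derivatives. -/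
theorem isIntegrableForm_mc {S : Set ℂ} {G : ℂ → R} (hG : ∀ z ∈ S, ContDiffAt ℝ ∞ G z)
    (hu : ∀ z ∈ S, IsUnit (G z)) : IsIntegrableForm S (mcZ G) (mcZbar G) := by
  intro z hz
  have h1 := differentiableAt_mcForm (hG z hz) (hu z hz) 1
  have hI := differentiableAt_mcForm (hG z hz) (hu z hz) Complex.I
  have key := fderiv_mcForm_sub (hG z hz) (hu z hz) 1 Complex.I
  have e1 : mcZ G = fun w => (-Complex.I / 2) • mcForm G Complex.I w +
      (1 / 2 : ℂ) • mcForm G 1 w := by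
    funext w; rw [mcZ_eq]; module
  have e2 : mcZbar G = fun w => (Complex.I / 2) • mcForm G Complex.I w +
      (1 / 2 : ℂ) • mcForm G 1 w := by
    funext w; rw [mcZbar_eq]; module
  have h1' : DifferentiableAt ℝ (fun w => (1 / 2 : ℂ) • mcForm G 1 w) z := h1.fun_const_smul _
  have e3 : dZ (fun w => (1 / 2 : ℂ) • mcForm G 1 w) z = (1 / 2 : ℂ) • dZ (mcForm G 1) z := by
    simp only [dZ, fderiv_fun_const_smul h1, smul_apply]; module
  have e4 : dZbar (fun w => (1 / 2 : ℂ) • mcForm G 1 w) z =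
      (1 / 2 : ℂ) • dZbar (mcForm G 1) z := by
    simp only [dZbar, fderiv_fun_const_smul h1, smul_apply]; module
  rw [e1, e2, dZ_smul_add _ hI h1', dZbar_smul_add _ hI h1', e3, e4]
  simp only [dZ, dZbar]
  generalize mcForm G 1 z = m at *
  generalize mcForm G Complex.I z = n at *
  rw [sub_eq_iff_eq_add] at key
  rw [key]
  simp only [add_mul, mul_add, smul_mul_assoc, mul_smul_comm]
  module

end Wirtinger

section Laurent

/-- A Laurent polynomial of degree one vanishing on the circle has vanishing coefficients. -/
theorem laurent_eq_zero {E : Type*} [AddCommGroup E] [Module ℂ E] {X Y Z : E}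
    (h : ∀ l : Circle, (l : ℂ)⁻¹ • X + Y + (l : ℂ) • Z = 0) : X = 0 ∧ Y = 0 ∧ Z = 0 := by
  let i : Circle := ⟨Complex.I, mem_sphere_zero_iff_norm.2 (by simp)⟩
  have hi : (i : ℂ) = Complex.I := rfl
  have h1 := h 1
  have h2 := h (i * i)
  have h3 := h i
  rw [Circle.coe_mul, hi, Complex.I_mul_I] at h2
  rw [hi, Complex.inv_I] at h3
  rw [Circle.coe_one] at h1
  norm_num at h1 h2
  have hY : Y = 0 := by
    have : (2 : ℂ) • Y = (X + Y + Z) + (-X + Y + -Z) := by module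
    rw [h1, h2, add_zero] at this
    exact (smul_eq_zero.1 this).resolve_left two_ne_zero
  rw [hY] at h1 h3
  rw [add_zero] at h1 h3
  have hXZ : Z = -X := eq_neg_of_add_eq_zero_right h1
  rw [hXZ] at h3
  have hX : X = 0 := by
    have : (-2 * Complex.I) • X = (-Complex.I) • X + Complex.I • -X := by module
    rw [h3] at this
    exact (smul_eq_zero.1 this).resolve_left (by simp)
  exact ⟨hX, hY, by rw [hXZ, hX, neg_zero]⟩

end Laurent

namespace KSymmetricSpace

variable {A : Type*} [NormedRing A] [NormedAlgebra ℂ A] [FiniteDimensional ℂ A]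
  {M : KSymmetricSpace A}

theorem differentiableAt_mPart {E : Type*} [NormedAddCommGroup E] [NormedSpace ℝ E] {β : E → A}
    {x : E} (h : DifferentiableAt ℝ β x) : DifferentiableAt ℝ (fun y => M.mPart (β y)) x := by
  simp only [← mPartC_apply]
  exact M.mPartC.differentiableAt.comp x h

theorem differentiableAt_kPart {E : Type*} [NormedAddCommGroup E] [NormedSpace ℝ E] {β : E → A}
    {x : E} (h : DifferentiableAt ℝ β x) : DifferentiableAt ℝ (fun y => M.kPart (β y)) x := by
  have : (fun y => M.kPart (β y)) = fun y => β y - M.mPart (β y) := by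
    funext y; simp [mPart]
  rw [this]
  exact h.fun_sub (differentiableAt_mPart h)

theorem fderiv_mPart {E : Type*} [NormedAddCommGroup E] [NormedSpace ℝ E] {β : E → A}
    {x : E} (h : DifferentiableAt ℝ β x) (e : E) :
    fderiv ℝ (fun y => M.mPart (β y)) x e = M.mPart (fderiv ℝ β x e) := by
  simp only [← mPartC_apply]
  have : fderiv ℝ (fun y => M.mPartC (β y)) x = _ :=
    (M.mPartC.hasFDerivAt.comp x h.hasFDerivAt).fderiv
  rw [this]; rfl

/-- The harmonic map equation consists of the coefficients of `λ` and `λ⁻¹` in the integrability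
condition of the family `α_λ`. -/
theorem isHarmonicFrame_of_isIntegrableForm {S : Set ℂ} {F : ℂ → A}
    (hF : ∀ z ∈ S, ContDiffAt ℝ ∞ F z) (hu : ∀ z ∈ S, IsUnit (F z))
    (h : ∀ l : Circle, IsIntegrableForm S (M.alphaZ F l) (M.alphaZbar F l)) :
    M.IsHarmonicFrame S F := by
  intro z hz
  have hZ := differentiableAt_mcZ (hF z hz) (hu z hz)
  have hZb := differentiableAt_mcZbar (hF z hz) (hu z hz)
  have dQ := differentiableAt_mPart (M := M) hZ
  have dP := differentiableAt_mPart (M := M) hZb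
  have dc := differentiableAt_kPart (M := M) hZ
  have dd := differentiableAt_kPart (M := M) hZb
  have e1 : M.mPart (fderiv ℝ (mcForm F 1) z 1) =
      fderiv ℝ (fun w => M.mPart (mcZ F w)) z 1 + fderiv ℝ (fun w => M.mPart (mcZbar F w)) z 1 := by
    rw [← fderiv_mPart (differentiableAt_mcForm (hF z hz) (hu z hz) 1)]
    have : (fun w => M.mPart (mcForm F 1 w)) =
        fun w => M.mPart (mcZ F w) + M.mPart (mcZbar F w) := by
      funext w
      rw [mcForm_one_eq, ← mPartL_apply, map_add, mPartL_apply, mPartL_apply]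
    rw [this, fderiv_fun_add dQ dP]; rfl
  have e2 : M.mPart (fderiv ℝ (mcForm F Complex.I) z Complex.I) =
      Complex.I • (fderiv ℝ (fun w => M.mPart (mcZ F w)) z Complex.I -
        fderiv ℝ (fun w => M.mPart (mcZbar F w)) z Complex.I) := by
    rw [← fderiv_mPart (differentiableAt_mcForm (hF z hz) (hu z hz) Complex.I)]
    have : (fun w => M.mPart (mcForm F Complex.I w)) =
        fun w => Complex.I • (M.mPart (mcZ F w) - M.mPart (mcZbar F w)) := by
      funext w
      rw [mcForm_I_eq, ← mPartL_apply, map_smul, map_sub, mPartL_apply, mPartL_apply]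
    rw [this, fderiv_fun_const_smul (dQ.fun_sub dP), fderiv_fun_sub dQ dP]; rfl
  have e3 : M.mPart (mcForm F 1 z) = M.mPart (mcZ F z) + M.mPart (mcZbar F z) := by
    rw [mcForm_one_eq, ← mPartL_apply, map_add, mPartL_apply, mPartL_apply]
  have e4 : M.mPart (mcForm F Complex.I z) =
      Complex.I • (M.mPart (mcZ F z) - M.mPart (mcZbar F z)) := by
    rw [mcForm_I_eq, ← mPartL_apply, map_smul, map_sub, mPartL_apply, mPartL_apply]
  have e5 : M.kPart (mcForm F 1 z) = M.kPart (mcZ F z) + M.kPart (mcZbar F z) := by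
    rw [mcForm_one_eq, ← kPartL_apply, map_add, kPartL_apply, kPartL_apply]
  have e6 : M.kPart (mcForm F Complex.I z) =
      Complex.I • (M.kPart (mcZ F z) - M.kPart (mcZbar F z)) := by
    rw [mcForm_I_eq, ← kPartL_apply, map_smul, map_sub, kPartL_apply, kPartL_apply]
  have hint : ∀ l : Circle,
      (l : ℂ)⁻¹ • (-dZbar (fun w => M.mPart (mcZ F w)) z +
        (M.mPart (mcZ F z) * M.kPart (mcZbar F z) - M.kPart (mcZbar F z) * M.mPart (mcZ F z))) +
      (dZ (fun w => M.kPart (mcZbar F w)) z - dZbar (fun w => M.kPart (mcZ F w)) z +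
        (M.mPart (mcZ F z) * M.mPart (mcZbar F z) - M.mPart (mcZbar F z) * M.mPart (mcZ F z)) +
        (M.kPart (mcZ F z) * M.kPart (mcZbar F z) - M.kPart (mcZbar F z) * M.kPart (mcZ F z))) +
      (l : ℂ) • (dZ (fun w => M.mPart (mcZbar F w)) z +
        (M.kPart (mcZ F z) * M.mPart (mcZbar F z) - M.mPart (mcZbar F z) * M.kPart (mcZ F z)))
        = 0 := by
    intro l
    have h1 := h l z hz
    have h2 : dZ (M.alphaZbar F l) z = _ := dZ_smul_add (l : ℂ) dP dd
    have h3 : dZbar (M.alphaZ F l) z = _ := dZbar_smul_add (l : ℂ)⁻¹ dQ dc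
    rw [h2, h3, alphaZ, alphaZbar] at h1
    have hl : (l : ℂ)⁻¹ * l = 1 := inv_mul_cancel₀ l.coe_ne_zero
    rw [← h1]
    simp only [add_mul, mul_add, smul_mul_assoc, mul_smul_comm]
    match_scalars <;>
      first | linear_combination (0 : ℂ) * hl | linear_combination hl | linear_combination -hl
  obtain ⟨hX, -, hZ⟩ := laurent_eq_zero hint
  rw [sum_one_I, e1, e2, e3, e4, e5, e6]
  -- twice the coefficient of `λ` minus twice the coefficient of `λ⁻¹`
  have hfin := congrArg₂ (fun U W => (2 : ℂ) • (W - U)) hX hZ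
  simp only [sub_zero, smul_zero, dZ, dZbar] at hfin
  rw [← hfin]
  simp only [add_mul, mul_add, sub_mul, mul_sub, smul_mul_assoc, mul_smul_comm]
  have := Complex.I_mul_I
  match_scalars <;>
    first | linear_combination (0 : ℂ) * this | linear_combination this | linear_combination -this

end KSymmetricSpace

/-! ### Evaluation of loops, strips and translations -/

section Evaluation

variable {A : Type*} [NormedRing A] [NormedAlgebra ℂ A] [FiniteDimensional ℂ A]
  {E : Type*} [NormedAddCommGroup E] [NormedSpace ℝ E]

theorem fderiv_eval {G : E → Loop A} {x : E} (h : DifferentiableAt ℝ G x) (l : Circle) (e : E) :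
    fderiv ℝ (fun y => G y l) x e = (fderiv ℝ G x e) l := by
  have : fderiv ℝ (fun y => G y l) x = _ :=
    ((ContinuousMap.evalCLM ℝ l : Loop A →L[ℝ] A).hasFDerivAt.comp x h.hasFDerivAt).fderiv
  rw [this]; rfl

theorem ringInverse_eval {γ : Loop A} (h : IsUnit γ) (l : Circle) :
    Ring.inverse (γ l) = (Ring.inverse γ) l := by
  obtain ⟨u, rfl⟩ := h
  rw [← evalUnit_val, Ring.inverse_unit, Ring.inverse_unit, ← map_inv, evalUnit_val]

theorem mcForm_eval {G : E → Loop A} {x : E} (h : DifferentiableAt ℝ G x) (hu : IsUnit (G x))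
    (l : Circle) (e : E) : mcForm (fun y => G y l) e x = (mcForm G e x) l := by
  rw [mcForm, mcForm, fderiv_eval h, ringInverse_eval hu]; rfl

theorem mcZ_eval {G : ℂ → Loop A} {z : ℂ} (h : DifferentiableAt ℝ G z) (hu : IsUnit (G z))
    (l : Circle) : mcZ (fun y => G y l) z = (mcZ G z) l := by
  rw [mcZ_eq, mcZ_eq, mcForm_eval h hu, mcForm_eval h hu]; rfl

theorem mcZbar_eval {G : ℂ → Loop A} {z : ℂ} (h : DifferentiableAt ℝ G z) (hu : IsUnit (G z))
    (l : Circle) : mcZbar (fun y => G y l) z = (mcZbar G z) l := by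
  rw [mcZbar_eq, mcZbar_eq, mcForm_eval h hu, mcForm_eval h hu]; rfl

theorem contDiffAt_eval {G : E → Loop A} {x : E} (h : ContDiffAt ℝ ∞ G x) (l : Circle) :
    ContDiffAt ℝ ∞ (fun y => G y l) x :=
  (ContinuousMap.evalCLM ℝ l : Loop A →L[ℝ] A).contDiff.contDiffAt.comp x h

theorem hasDerivAt_eval {g : ℝ → Loop A} {g' : Loop A} {t : ℝ} (h : HasDerivAt g g' t)
    (l : Circle) : HasDerivAt (fun s => g s l) (g' l) t :=
  (ContinuousMap.evalCLM ℝ l : Loop A →L[ℝ] A).hasFDerivAt.comp_hasDerivAt t h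

end Evaluation

section Strip

theorem isOpen_strip {J : Set ℝ} (hJ : IsOpen J) : IsOpen (strip J) :=
  hJ.preimage Complex.continuous_im

theorem I_mul_mem_strip {J : Set ℝ} {v : ℝ} (hv : v ∈ J) : Complex.I * v ∈ strip J := by
  show (Complex.I * v).im ∈ J
  simpa using hv

theorem add_real_mem_strip {J : Set ℝ} {z : ℂ} (hz : z ∈ strip J) (t : ℝ) : z + t ∈ strip J := by
  have hz' : z.im ∈ J := hz
  show (z + t).im ∈ J
  simpa using hz'

theorem I_mul_im_add_re (z : ℂ) : Complex.I * (z.im : ℝ) + (z.re : ℝ) = z := by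
  conv_rhs => rw [← Complex.re_add_im z]
  ring

variable {R : Type*} [NormedRing R] [NormedAlgebra ℂ R] [CompleteSpace R]

theorem exp_smul_add (a b : ℂ) (X : R) : exp ((a + b) • X) = exp (a • X) * exp (b • X) := by
  let _ : NormedAlgebra ℚ R := .restrictScalars ℚ ℂ R
  rw [add_smul, exp_add_of_commute]
  exact ((Commute.refl X).smul_left a).smul_right b

theorem exp_ofReal_smul (t : ℝ) (X : R) : exp ((t : ℂ) • X) = exp (t • X) := by
  rw [Complex.coe_smul]

theorem commute_exp_smul (a : ℂ) (X : R) : Commute X (exp (a • X)) := by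
  let _ : NormedAlgebra ℚ R := .restrictScalars ℚ ℂ R
  exact ((Commute.refl X).smul_right a).exp_right

theorem hasDerivAt_imaginary_axis {F : ℂ → R} {v : ℝ}
    (hF : DifferentiableAt ℝ F (Complex.I * v)) :
    HasDerivAt (fun s : ℝ => F (Complex.I * s)) (fderiv ℝ F (Complex.I * v) Complex.I) v := by
  have h1 : HasDerivAt (fun s : ℝ => Complex.I * (s : ℂ)) Complex.I v := by
    simpa using (Complex.ofRealCLM.hasDerivAt (x := v)).const_mul Complex.I
  exact hF.hasFDerivAt.comp_hasDerivAt v h1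

/-- Maurer-Cartan forms of translationally equivariant maps are translation invariant. -/
theorem mcForm_translate {J : Set ℝ} (hJ : IsOpen J) {F : ℂ → R} {D : R}
    (hu : ∀ z ∈ strip J, IsUnit (F z))
    (hF : ∀ z ∈ strip J, DifferentiableAt ℝ F z)
    (h : ∀ t : ℝ, ∀ z ∈ strip J, F (z + t) = exp (t • D) * F z) {z : ℂ} (hz : z ∈ strip J) (t : ℝ)
    (e : ℂ) : mcForm F e (z + t) = mcForm F e z := by
  have h1 : (fun w => F (w + t)) =ᶠ[𝓝 z] fun w => exp (t • D) * F w := by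
    filter_upwards [(isOpen_strip hJ).mem_nhds hz] with w hw using h t w hw
  have h2 : fderiv ℝ F (z + t) e = exp (t • D) * fderiv ℝ F z e := by
    rw [← fderiv_comp_add_right, h1.fderiv_eq, fderiv_const_mul (hF z hz)]; rfl
  rw [mcForm, h2, h t z hz, mcForm]
  obtain ⟨u, hu⟩ := hu z hz
  have hexp : ∃ g : Rˣ, (g : R) = exp (t • D) := by
    let _ : NormedAlgebra ℚ R := .restrictScalars ℚ ℂ R
    exact ⟨(isUnit_exp (t • D)).unit, rfl⟩
  obtain ⟨g, hg⟩ := hexp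
  rw [← hu, ← hg, ← Units.val_mul, Ring.inverse_unit, Ring.inverse_unit, mul_inv_rev,
    Units.val_mul, mul_assoc, Units.inv_mul_cancel_left]

/-- The `u`-component of the Maurer-Cartan form of a translationally equivariant map is conjugate to
the generator of the translations. -/
theorem mcForm_one_of_translate {J : Set ℝ} {F : ℂ → R} {D : R}
    (hF : ∀ z ∈ strip J, DifferentiableAt ℝ F z)
    (h : ∀ t : ℝ, ∀ z ∈ strip J, F (z + t) = exp (t • D) * F z) {z : ℂ} (hz : z ∈ strip J) :
    mcForm F 1 z = Ring.inverse (F z) * D * F z := by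
  have h1 := hasDerivAt_line (hF z hz) 1
  have h2 : (fun s : ℝ => F (z + s • (1 : ℂ))) = fun s : ℝ => exp (s • D) * F z := by
    funext s
    rw [← h s z hz, Complex.real_smul, mul_one]
  rw [h2] at h1
  have h3 := h1.unique ((hasDerivAt_exp_smul_zero D).mul_const (F z))
  rw [mcForm, h3, mul_assoc]

end Strip

namespace KSymmetricSpace

variable {A : Type*} [NormedRing A] [NormedAlgebra ℂ A] [FiniteDimensional ℂ A]
  {M : KSymmetricSpace A}

theorem expLoop_mem_realLoops {D : Loop A} (hD : M.IsRealLoopAlg D) (t : ℝ) :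
    expLoop (t • D) ∈ M.realLoops := by
  obtain ⟨γ, hγ, e⟩ := M.mem_lieAlg_realLoops hD t
  have : expLoop (t • D) = γ := Units.ext e.symm
  rwa [this]

/-- A translationally equivariant family of loops whose Maurer-Cartan form is real and twisted
consists of real twisted loops. -/
theorem mem_realLoops_of_translate {J : Set ℝ} (hJ : J.OrdConnected)
    (hJ0 : (0 : ℝ) ∈ J) {F : ℂ → (Loop A)ˣ} {D : Loop A}
    (hF : ∀ z ∈ strip J, ContDiffAt ℝ ∞ (fun z => (F z : Loop A)) z) (hF0 : F 0 = 1)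
    (hD : M.IsRealLoopAlg D)
    (htr : ∀ t : ℝ, ∀ z ∈ strip J, (F (z + t) : Loop A) = exp (t • D) * (F z : Loop A))
    (hI : ∀ v ∈ J, M.IsRealLoopAlg
      (mcForm (fun z => (F z : Loop A)) Complex.I (Complex.I * (v : ℝ)))) :
    ∀ z ∈ strip J, F z ∈ M.realLoops := by
  intro z hz
  have haxis : F (Complex.I * (z.im : ℝ)) ∈ M.realLoops := by
    refine mem_subgroup_of_hasDerivAt M.isClosed_realLoops hJ hJ0
      (g := fun v : ℝ => F (Complex.I * v))
      (X := fun v : ℝ => mcForm (fun z => (F z : Loop A)) Complex.I (Complex.I * v)) ?_ ?_ ?_ ?_ hz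
    · intro v hv
      have h1 := hasDerivAt_imaginary_axis
        ((hF _ (I_mul_mem_strip hv)).differentiableAt (by simp))
      rwa [fderiv_eq_mul_mcForm (G := fun z => (F z : Loop A))
        (F (Complex.I * v)).isUnit] at h1
    · intro v hv
      refine ContinuousAt.continuousWithinAt ?_
      have h1 := (contDiffAt_mcForm (G := fun z => (F z : Loop A)) (hF _ (I_mul_mem_strip hv))
        (F (Complex.I * v)).isUnit Complex.I).continuousAt
      exact ContinuousAt.comp (g := mcForm (fun z => (F z : Loop A)) Complex.I)
        (f := fun s : ℝ => Complex.I * (s : ℂ)) h1 (by fun_prop)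
    · exact fun v hv => M.mem_lieAlg_realLoops (hI v hv)
    · simp [hF0, M.realLoops.one_mem]
  have h2 : F z = expLoop (z.re • D) * F (Complex.I * (z.im : ℝ)) := by
    refine Units.ext ?_
    have := htr z.re _ (I_mul_mem_strip hz)
    rw [I_mul_im_add_re] at this
    exact this
  rw [h2]
  exact M.realLoops.mul_mem (expLoop_mem_realLoops hD _) haxis

/-! ### The Maurer-Cartan form of a frame of a primitive map -/

theorem mcZbar_mem_complexAlg {S : Set ℂ} (hS : IsOpen S) {f : ℂ → M.Quot} {F : ℂ → A}
    (h : M.IsFrame S f F) {z : ℂ} (hz : z ∈ S) : mcZbar F z ∈ lieAlg M.GC := by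
  rw [mcZbar_eq]
  exact M.complexAlg.smul_mem _ (M.complexAlg.add_mem
    (M.mem_complexAlg_of_mem (h.mcForm_mem hS hz 1))
    (M.complexAlg.smul_mem _ (M.mem_complexAlg_of_mem (h.mcForm_mem hS hz _))))

/-- For `X`, `Y` the two components of a real form this says that `α'` is the conjugate of `α''`. -/
theorem conj_half_add {X Y : A} (hX : X ∈ lieAlg M.G) (hY : Y ∈ lieAlg M.G) :
    M.conj ((1 / 2 : ℂ) • (X + Complex.I • Y)) = (1 / 2 : ℂ) • (X - Complex.I • Y) := by
  rw [M.conj_smul _ (M.add_I_smul_mem hX hY), M.conj_add_I_smul hX hY, map_div₀, map_one,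
    map_ofNat]

/-- Primitivity does not depend on the frame. -/
theorem mPart_mem_gr_of_frames {S : Set ℂ} (hS : IsOpen S) {f : ℂ → M.Quot} {Φ F : ℂ → A}
    (hΦ : M.IsFrame S f Φ) (hF : M.IsFrame S f F) {z : ℂ} (hz : z ∈ S)
    (h : M.mPart (mcZ Φ z) ∈ M.gr (-1) ∧ M.mPart (mcZbar Φ z) ∈ M.gr 1) :
    M.mPart (mcZ F z) ∈ M.gr (-1) ∧ M.mPart (mcZbar F z) ∈ M.gr 1 := by
  let k : ℂ → A := fun w => Ring.inverse (Φ w) * F w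
  have hk : ∀ w ∈ S, ∃ g ∈ M.K, (g : A) = k w := fun w hw => exists_mem_K (hΦ.2 w hw) (hF.2 w hw)
  have hkd : DifferentiableAt ℝ k z := by
    obtain ⟨u, hu⟩ := hΦ.isUnit hz
    have h1 := contDiffAt_ringInverse ℝ (n := ∞) u
    rw [hu] at h1
    exact ((h1.comp z (hΦ.contDiffAt hS hz)).mul (hF.contDiffAt hS hz)).differentiableAt (by simp)
  obtain ⟨g, hg, eg⟩ := hk z hz
  have hm : ∀ e, M.mPart (mcForm F e z) =
      ((g⁻¹ : Aˣ) : A) * M.mPart (mcForm Φ e z) * (((g⁻¹)⁻¹ : Aˣ) : A) := by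
    intro e
    rw [inv_inv, ← mPart_mcForm_mul ((hΦ.contDiffAt hS hz).differentiableAt (by simp)) hkd
      (by filter_upwards [hS.mem_nhds hz] with w hw using hΦ.exists_mem_G hw) hg eg
      (by filter_upwards [hS.mem_nhds hz] with w hw using hk w hw)]
    congr 1
    refine mcForm_congr ?_ e
    filter_upwards [hS.mem_nhds hz] with w hw
    simp only [k]
    rw [← mul_assoc, Ring.mul_inverse_cancel _ (hΦ.isUnit hw), one_mul]
  have hZ : M.mPart (mcZ F z) = ((g⁻¹ : Aˣ) : A) * M.mPart (mcZ Φ z) * (((g⁻¹)⁻¹ : Aˣ) : A) := by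
    simp only [mcZ_eq, ← mPartL_apply, map_smul, map_sub]
    simp only [mPartL_apply, hm]
    simp only [mul_smul_comm, smul_mul_assoc, mul_sub, sub_mul]
  have hZb : M.mPart (mcZbar F z) =
      ((g⁻¹ : Aˣ) : A) * M.mPart (mcZbar Φ z) * (((g⁻¹)⁻¹ : Aˣ) : A) := by
    simp only [mcZbar_eq, ← mPartL_apply, map_smul, map_add]
    simp only [mPartL_apply, hm]
    simp only [mul_smul_comm, smul_mul_assoc, mul_add, add_mul]
  rw [hZ, hZb]
  exact ⟨M.gr_conj_K (M.K.inv_mem hg) h.1, M.gr_conj_K (M.K.inv_mem hg) h.2⟩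

end KSymmetricSpace

/-! ### The Iwasawa decomposition of an equivariant extended frame -/

namespace KSymmetricSpace

variable {A : Type*} [NormedRing A] [NormedAlgebra ℂ A] [FiniteDimensional ℂ A]
  {M : KSymmetricSpace A}

/-- With `p = (X + iY)_𝔪 / 2 ∈ 𝔤₁` the loop `c λ⁻¹ p̄ + c̄ λ p + Z_𝔨` is real and twisted.  The cases
`c = 1` and `c = i` give the two components of the family `α_λ`. -/
theorem isRealLoopAlg_of_forall {X Y : A} (hX : X ∈ lieAlg M.G) (hY : Y ∈ lieAlg M.G)
    (h1 : M.mPart ((1 / 2 : ℂ) • (X + Complex.I • Y)) ∈ M.gr 1)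
    (c : ℂ) {γ : Loop A} {Z : A} (hZ : Z ∈ lieAlg M.G)
    (hγ : ∀ l : Circle, γ l = c • ((l : ℂ)⁻¹ • M.mPart ((1 / 2 : ℂ) • (X - Complex.I • Y))) +
      starRingEnd ℂ c • ((l : ℂ) • M.mPart ((1 / 2 : ℂ) • (X + Complex.I • Y))) + M.kPart Z) :
    M.IsRealLoopAlg γ := by
  set p := M.mPart ((1 / 2 : ℂ) • (X + Complex.I • Y)) with hp
  have hlin : ∀ s : ℂ, M.mPart ((1 / 2 : ℂ) • (X + s • Y)) =
      (1 / 2 : ℂ) • (M.mPart X + s • M.mPart Y) := by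
    intro s
    simp only [← mPartL_apply, map_smul, map_add]
  have hq : M.mPart ((1 / 2 : ℂ) • (X - Complex.I • Y)) = M.conj p := by
    rw [hp, hlin, conj_half_add (M.mPart_mem_real hX) (M.mPart_mem_real hY)]
    have := hlin (-Complex.I)
    simpa only [neg_smul, ← sub_eq_add_neg] using this
  rw [hq] at hγ
  have hconj : ∀ l : Circle, γ l = M.conj ((starRingEnd ℂ c * l) • p) +
      (starRingEnd ℂ c * l) • p + M.kPart Z := by
    intro l
    rw [hγ l, M.conj_smul _ h1.1, map_mul, Complex.conj_conj, smul_smul, smul_smul,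
      ← Circle.coe_inv_eq_conj, Circle.coe_inv]
  have hcp : M.dσ (M.conj p) = (M.omega : ℂ)⁻¹ • M.conj p := by
    simpa using (M.gr_conj h1).2
  intro l
  constructor
  · rw [hconj]
    exact M.realAlg.add_mem (M.add_conj_mem (M.complexAlg.smul_mem _ h1.1)) (M.kPart_mem_real hZ)
  · have h0 := (M.kPart_mem_gr_zero (M.mem_complexAlg_of_mem hZ)).2
    rw [hγ, hγ, map_add, map_add, map_smul, map_smul, map_smul, map_smul, hcp, h1.2, h0, zpow_one,
      zpow_zero, one_smul, Circle.coe_mul, mul_inv]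
    module

variable {J : Set ℝ} {f : ℂ → M.Quot} {F : ℂ → (Loop A)ˣ} {D : Loop A}

theorem IsExtendedFrame.contDiffAt (hJo : IsOpen J) (hF : M.IsExtendedFrame (strip J) f F) {z : ℂ}
    (hz : z ∈ strip J) : ContDiffAt ℝ ∞ (fun z => (F z : Loop A)) z :=
  hF.1.contDiffAt ((isOpen_strip hJo).mem_nhds hz)

theorem IsExtendedFrame.mcZ_apply (hJo : IsOpen J) (hF : M.IsExtendedFrame (strip J) f F) {z : ℂ}
    (hz : z ∈ strip J) (l : Circle) : (mcZ (fun z => (F z : Loop A)) z) l =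
      M.alphaZ (fun w => (F w : Loop A) 1) l z := by
  rw [← (hF.2.2.2 l z hz).1, mcZ_eval ((hF.contDiffAt hJo hz).differentiableAt (by simp))
    (F z).isUnit]

theorem IsExtendedFrame.mcZbar_apply (hJo : IsOpen J) (hF : M.IsExtendedFrame (strip J) f F) {z : ℂ}
    (hz : z ∈ strip J) (l : Circle) : (mcZbar (fun z => (F z : Loop A)) z) l =
      M.alphaZbar (fun w => (F w : Loop A) 1) l z := by
  rw [← (hF.2.2.2 l z hz).2, mcZbar_eval ((hF.contDiffAt hJo hz).differentiableAt (by simp))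
    (F z).isUnit]

theorem IsExtendedFrame.mcZbar_eq_linearLoop (hJo : IsOpen J)
    (hF : M.IsExtendedFrame (strip J) f F) {z : ℂ} (hz : z ∈ strip J) :
    mcZbar (fun z => (F z : Loop A)) z =
      linearLoop (M.kPart (mcZbar (fun w => (F w : Loop A) 1) z))
        (M.mPart (mcZbar (fun w => (F w : Loop A) 1) z)) := by
  ext l
  rw [hF.mcZbar_apply hJo hz, linearLoop_apply, alphaZbar, add_comm]

theorem IsExtendedFrame.isRealLoopAlg_one (hJo : IsOpen J) (hF : M.IsExtendedFrame (strip J) f F)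
    {z : ℂ} (hz : z ∈ strip J)
    (hgr : M.mPart (mcZbar (fun w => (F w : Loop A) 1) z) ∈ M.gr 1) :
    M.IsRealLoopAlg (mcForm (fun z => (F z : Loop A)) 1 z) := by
  have hfr := hF.2.2.1
  have hS := isOpen_strip hJo
  refine isRealLoopAlg_of_forall (hfr.mcForm_mem hS hz 1) (hfr.mcForm_mem hS hz Complex.I)
    (by rwa [← mcZbar_eq]) 1 (hfr.mcForm_mem hS hz 1) fun l => ?_
  rw [mcForm_one_eq, ContinuousMap.add_apply, hF.mcZ_apply hJo hz, hF.mcZbar_apply hJo hz,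
    ← mcZ_eq, ← mcZbar_eq, mcForm_one_eq, alphaZ, alphaZbar]
  have : M.kPart (mcZ (fun w => (F w : Loop A) 1) z + mcZbar (fun w => (F w : Loop A) 1) z) =
      M.kPart (mcZ (fun w => (F w : Loop A) 1) z) +
        M.kPart (mcZbar (fun w => (F w : Loop A) 1) z) := by
    simp only [← kPartL_apply, map_add]
  rw [this, map_one]
  module

theorem IsExtendedFrame.isRealLoopAlg_I (hJo : IsOpen J) (hF : M.IsExtendedFrame (strip J) f F)
    {z : ℂ} (hz : z ∈ strip J)
    (hgr : M.mPart (mcZbar (fun w => (F w : Loop A) 1) z) ∈ M.gr 1) :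
    M.IsRealLoopAlg (mcForm (fun z => (F z : Loop A)) Complex.I z) := by
  have hfr := hF.2.2.1
  have hS := isOpen_strip hJo
  refine isRealLoopAlg_of_forall (hfr.mcForm_mem hS hz 1) (hfr.mcForm_mem hS hz Complex.I)
    (by rwa [← mcZbar_eq]) Complex.I (hfr.mcForm_mem hS hz Complex.I) fun l => ?_
  rw [mcForm_I_eq, ContinuousMap.smul_apply, ContinuousMap.sub_apply, hF.mcZ_apply hJo hz,
    hF.mcZbar_apply hJo hz, ← mcZ_eq, ← mcZbar_eq, mcForm_I_eq, alphaZ, alphaZbar]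
  have : M.kPart (Complex.I • (mcZ (fun w => (F w : Loop A) 1) z -
      mcZbar (fun w => (F w : Loop A) 1) z)) =
      Complex.I • (M.kPart (mcZ (fun w => (F w : Loop A) 1) z) -
        M.kPart (mcZbar (fun w => (F w : Loop A) 1) z)) := by
    simp only [← kPartL_apply, map_sub, map_smul]
  rw [this, Complex.conj_I]
  module

/-- The factor `V(v) = exp(-ivD) F(iv)`. -/
noncomputable def plusFactor (D : Loop A) (F : ℂ → (Loop A)ˣ) (v : ℝ) : (Loop A)ˣ :=
  expLoop (-(Complex.I * v) • D) * F (Complex.I * v)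

theorem plusFactor_val (D : Loop A) (F : ℂ → (Loop A)ˣ) (v : ℝ) :
    (plusFactor D F v : Loop A) =
      exp (-(Complex.I * v) • D) * (F (Complex.I * v) : Loop A) := rfl

theorem contDiff_exp_smul {R : Type*} [NormedRing R] [NormedAlgebra ℂ R] [CompleteSpace R] (X : R) :
    ContDiff ℝ ∞ fun z : ℂ => exp (z • X) := by
  have h1 : ContDiff ℝ ∞ (exp : R → R) :=
    contDiff_iff_contDiffAt.2 fun x => (exp_analytic (𝕂 := ℝ) x).contDiffAt
  exact h1.comp (contDiff_id.smul contDiff_const)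

theorem hasDerivAt_plusFactor
    (hF : ∀ z ∈ strip J, ContDiffAt ℝ ∞ (fun z => (F z : Loop A)) z)
    (htr : ∀ t : ℝ, ∀ z ∈ strip J, (F (z + t) : Loop A) = exp (t • D) * (F z : Loop A)) {v : ℝ}
    (hv : v ∈ J) : HasDerivAt (fun s => (plusFactor D F s : Loop A))
      ((plusFactor D F v : Loop A) *
        ((-(2 * Complex.I)) • mcZbar (fun z => (F z : Loop A)) (Complex.I * v))) v := by
  have hd : ∀ z ∈ strip J, DifferentiableAt ℝ (fun z => (F z : Loop A)) z :=
    fun z hz => (hF z hz).differentiableAt (by simp)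
  have h1 := hasDerivAt_imaginary_axis (hd _ (I_mul_mem_strip hv))
  have h2 : HasDerivAt (fun s : ℝ => exp (-(Complex.I * s) • D))
      (exp (-(Complex.I * v) • D) * ((-Complex.I) • D)) v := by
    have h3 := hasDerivAt_exp_smul_const ((-Complex.I) • D) v
    have h4 : ∀ s : ℝ, s • (-Complex.I) • D = (-(Complex.I * s)) • D := by
      intro s
      rw [← Complex.coe_smul, smul_smul]
      congr 1
      ring
    simpa only [h4] using h3
  have h5 := h2.fun_mul h1
  simp only [← plusFactor_val] at h5
  refine h5.congr_deriv ?_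
  have e1 := mcForm_one_of_translate hd htr (I_mul_mem_strip hv)
  rw [fderiv_eq_mul_mcForm (G := fun z => (F z : Loop A)) (F (Complex.I * v)).isUnit, mcForm_I_eq,
    plusFactor_val]
  rw [mcForm_one_eq] at e1
  have e2 : D * (F (Complex.I * v) : Loop A) = (F (Complex.I * v) : Loop A) *
      (mcZ (fun z => (F z : Loop A)) (Complex.I * v) +
        mcZbar (fun z => (F z : Loop A)) (Complex.I * v)) := by
    rw [e1, ← mul_assoc, ← mul_assoc, Ring.mul_inverse_cancel _ (F (Complex.I * v)).isUnit, one_mul]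
  simp only [mul_assoc, smul_mul_assoc, e2, mul_smul_comm, mul_add, mul_sub]
  module

theorem isPlusLoop_plusFactor (hJo : IsOpen J) (hJ : J.OrdConnected) (hJ0 : (0 : ℝ) ∈ J)
    (hF : M.IsExtendedFrame (strip J) f F)
    (htr : ∀ t : ℝ, ∀ z ∈ strip J, (F (z + t) : Loop A) = exp (t • D) * (F z : Loop A))
    (hgr : ∀ z ∈ strip J, M.mPart (mcZbar (fun w => (F w : Loop A) 1) z) ∈ M.gr 1) {v : ℝ}
    (hv : v ∈ J) : M.IsPlusLoop (plusFactor D F v) := by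
  have hd : ∀ z ∈ strip J, ContDiffAt ℝ ∞ (fun z => (F z : Loop A)) z :=
    fun z hz => hF.contDiffAt hJo hz
  refine M.mem_plusLoops.1 (mem_subgroup_of_hasDerivAt M.isClosed_plusLoops hJ hJ0
    (fun v hv => hasDerivAt_plusFactor hd htr hv) ?_ (fun v hv => ?_) ?_ hv)
  · intro v hv
    refine ContinuousAt.continuousWithinAt (ContinuousAt.fun_const_smul ?_ _)
    have h1 := (differentiableAt_mcZbar (hd _ (I_mul_mem_strip hv))
      (F (Complex.I * v)).isUnit).continuousAt
    exact ContinuousAt.comp (g := mcZbar (fun z => (F z : Loop A)))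
      (f := fun s : ℝ => Complex.I * (s : ℂ)) h1 (by fun_prop)
  · have hz := I_mul_mem_strip hv
    have h0 := M.kPart_mem_gr_zero (mcZbar_mem_complexAlg (isOpen_strip hJo) hF.2.2.1 hz)
    rw [hF.mcZbar_eq_linearLoop hJo hz]
    have h2 : ∀ (c : ℂ) (X Y : A), c • linearLoop X Y = linearLoop (c • X) (c • Y) := by
      intro c X Y
      ext l
      show c • (X + (l : ℂ) • Y) = c • X + (l : ℂ) • c • Y
      rw [smul_add, smul_comm]
    rw [h2]
    exact M.linearLoop_mem_lieAlg_plusLoops (M.gr_smul _ h0) (M.gr_smul _ (hgr _ hz))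
  · have : plusFactor D F 0 = 1 := Units.ext (by simp [plusFactor_val, hF.2.1])
    rw [this]
    exact M.plusLoops.one_mem

/-- An extended frame of a primitive harmonic map on which translations act by `exp(tD)` is the real
factor in an Iwasawa decomposition of `exp(zD)`, whose plus factor depends only on `Im z`. -/
theorem iwasawa_of_equivariant {B : A →ₗ[ℝ] A →ₗ[ℝ] ℝ} (hJo : IsOpen J) (hJ : J.OrdConnected)
    (hJ0 : (0 : ℝ) ∈ J) (hf : M.IsPrimitiveHarmonic B (strip J) f)
    (hF : M.IsExtendedFrame (strip J) f F)
    (htr : ∀ t : ℝ, ∀ z ∈ strip J, (F (z + t) : Loop A) = exp (t • D) * (F z : Loop A)) :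
    M.IsRealLoopAlg D ∧
    (∀ l : Circle,
      D l = M.alphaZ (fun w => (F w : Loop A) 1) l 0
        + M.alphaZbar (fun w => (F w : Loop A) 1) l 0 ∧
      D l = (l : ℂ)⁻¹ • M.mPart (mcZ (fun w => (F w : Loop A) 1) 0)
        + M.kPart (mcZ (fun w => (F w : Loop A) 1) 0)
        + M.kPart (mcZbar (fun w => (F w : Loop A) 1) 0)
        + (l : ℂ) • M.mPart (mcZbar (fun w => (F w : Loop A) 1) 0)) ∧
    ∃ V : ℝ → (Loop A)ˣ,
      (∀ v ∈ J, (V v : Loop A) =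
        NormedSpace.exp (-(Complex.I * v) • D) * (F (Complex.I * v) : Loop A)) ∧
      ContDiffOn ℝ ∞ (fun v => (V v : Loop A)) J ∧
      (∀ v ∈ J, M.IsPlusLoop (V v)) ∧
      V 0 = 1 ∧
      (∀ z ∈ strip J, ∀ l : Circle,
        HasDerivAt (fun s : ℝ => (V s : Loop A) l)
          ((-(2 * Complex.I)) • ((V z.im : Loop A) l *
            M.alphaZbar (fun w => (F w : Loop A) 1) l z)) z.im ∧
        M.alphaZ (fun w => (F w : Loop A) 1) l z
            + M.alphaZbar (fun w => (F w : Loop A) 1) l z =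
          (((V z.im)⁻¹ : (Loop A)ˣ) : Loop A) l * D l * (V z.im : Loop A) l) ∧
      (∀ z ∈ strip J,
        (F z : Loop A) = NormedSpace.exp (z • D) * (V z.im : Loop A) ∧
        M.IsIwasawa (NormedSpace.exp (z • D)) (F z) (V z.im)⁻¹) := by
  have hS := isOpen_strip hJo
  have h0S : (0 : ℂ) ∈ strip J := hJ0
  have hd : ∀ z ∈ strip J, ContDiffAt ℝ ∞ (fun z => (F z : Loop A)) z :=
    fun z hz => hF.contDiffAt hJo hz
  have hd' : ∀ z ∈ strip J, DifferentiableAt ℝ (fun z => (F z : Loop A)) z :=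
    fun z hz => (hd z hz).differentiableAt (by simp)
  obtain ⟨-, Φ, hΦ, hΦgr, -⟩ := hf
  have hgr : ∀ z ∈ strip J, M.mPart (mcZbar (fun w => (F w : Loop A) 1) z) ∈ M.gr 1 :=
    fun z hz => (mPart_mem_gr_of_frames hS hΦ hF.2.2.1 hz (hΦgr z hz)).2
  -- the generator of the translations is the `u`-component of the Maurer-Cartan form at `0`
  have hD : D = mcForm (fun z => (F z : Loop A)) 1 0 := by
    rw [mcForm_one_of_translate hd' htr h0S]
    simp [hF.2.1]
  have hDreal : M.IsRealLoopAlg D := by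
    rw [hD]
    exact hF.isRealLoopAlg_one hJo h0S (hgr 0 h0S)
  have hDl : ∀ l : Circle, D l = M.alphaZ (fun w => (F w : Loop A) 1) l 0
      + M.alphaZbar (fun w => (F w : Loop A) 1) l 0 := by
    intro l
    rw [← hF.mcZ_apply hJo h0S, ← hF.mcZbar_apply hJo h0S, ← ContinuousMap.add_apply,
      ← mcForm_one_eq, ← hD]
  have hplus : ∀ v ∈ J, M.IsPlusLoop (plusFactor D F v) :=
    fun v hv => isPlusLoop_plusFactor hJo hJ hJ0 hF htr hgr hv
  have hreal : ∀ z ∈ strip J, F z ∈ M.realLoops :=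
    mem_realLoops_of_translate hJ hJ0 hd hF.2.1 hDreal htr fun v hv =>
      hF.isRealLoopAlg_I hJo (I_mul_mem_strip hv) (hgr _ (I_mul_mem_strip hv))
  have htr' : ∀ z ∈ strip J, (F z : Loop A) =
      exp (z.re • D) * (F (Complex.I * (z.im : ℝ)) : Loop A) := by
    intro z hz
    have := htr z.re _ (I_mul_mem_strip (show z.im ∈ J from hz))
    rwa [I_mul_im_add_re] at this
  have hfac : ∀ z ∈ strip J, (F z : Loop A) =
      exp (z • D) * (plusFactor D F z.im : Loop A) := by
    intro z hz
    rw [plusFactor_val, ← mul_assoc, ← exp_smul_add, htr' z hz, ← exp_ofReal_smul]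
    congr 3
    conv_rhs => rw [← I_mul_im_add_re z]
    simp
  have htrans : ∀ z ∈ strip J, ∀ e, mcForm (fun z => (F z : Loop A)) e z =
      mcForm (fun z => (F z : Loop A)) e (Complex.I * (z.im : ℝ)) := by
    intro z hz e
    have := mcForm_translate hJo (fun z _ => (F z).isUnit) hd' htr
      (I_mul_mem_strip (show z.im ∈ J from hz)) z.re e
    rwa [I_mul_im_add_re] at this
  refine ⟨hDreal, fun l => ⟨hDl l, ?_⟩, plusFactor D F, fun v _ => rfl, ?_, hplus, ?_, ?_, ?_⟩
  · rw [hDl l, alphaZ, alphaZbar]; abel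
  · intro v hv
    refine ContDiffAt.contDiffWithinAt ?_
    simp only [plusFactor_val]
    have h1 : ContDiffAt ℝ ∞ (fun s : ℝ => Complex.I * (s : ℂ)) v :=
      contDiffAt_const.mul Complex.ofRealCLM.contDiff.contDiffAt
    exact ((contDiff_exp_smul D).contDiffAt.comp v h1.neg).mul
      (ContDiffAt.comp (g := fun z => (F z : Loop A)) v (hd _ (I_mul_mem_strip hv)) h1)
  · exact Units.ext (by simp [plusFactor_val, hF.2.1])
  · intro z hz l
    have hz' := I_mul_mem_strip (show z.im ∈ J from hz)
    constructor
    · have h1 := hasDerivAt_eval (hasDerivAt_plusFactor hd htr (show z.im ∈ J from hz)) l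
      have h2 : mcZbar (fun z => (F z : Loop A)) (Complex.I * (z.im : ℝ)) =
          mcZbar (fun z => (F z : Loop A)) z := by
        simp only [mcZbar_eq, htrans z hz]
      rw [h2, mul_smul_comm, ContinuousMap.smul_apply, ContinuousMap.mul_apply,
        hF.mcZbar_apply hJo hz] at h1
      exact h1
    · have h1 : mcForm (fun z => (F z : Loop A)) 1 z =
          (((plusFactor D F z.im)⁻¹ : (Loop A)ˣ) : Loop A) * D * (plusFactor D F z.im : Loop A) := by
        rw [htrans z hz, mcForm_one_of_translate hd' htr hz', plusFactor, Ring.inverse_unit,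
          mul_inv_rev, Units.val_mul, Units.val_mul]
        have h2 : (((expLoop (-(Complex.I * (z.im : ℝ)) • D))⁻¹ : (Loop A)ˣ) : Loop A) * D *
            (expLoop (-(Complex.I * (z.im : ℝ)) • D) : Loop A) = D := by
          have h3 := (commute_exp_smul (-(Complex.I * (z.im : ℝ))) D).eq
          rw [mul_assoc, expLoop_val, h3, ← mul_assoc, ← expLoop_val, Units.inv_mul, one_mul]
        conv_lhs => rw [← h2]
        simp only [mul_assoc]
      rw [← hF.mcZ_apply hJo hz, ← hF.mcZbar_apply hJo hz, ← ContinuousMap.add_apply,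
        ← mcForm_one_eq, h1]
      rfl
  · intro z hz
    refine ⟨hfac z hz, M.mem_realLoops.1 (hreal z hz),
      M.plusLoops.inv_mem (hplus z.im hz), ?_⟩
    rw [hfac z hz, mul_assoc, Units.mul_inv, mul_one]

end KSymmetricSpace

/-! ### The equivariant map of a potential -/

namespace KSymmetricSpace

variable {A : Type*} [NormedRing A] [NormedAlgebra ℂ A] [FiniteDimensional ℂ A]
  {M : KSymmetricSpace A}

variable {J : Set ℝ} {V : ℝ → (Loop A)ˣ} {a : ℝ → Loop A} {F : ℂ → (Loop A)ˣ} {D : Loop A}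

/-- The logarithmic derivative of a curve of plus loops lies in the Lie algebra. -/
theorem smul_mem_lieAlg_plusLoops (hJo : IsOpen J) (hV : ∀ v ∈ J, M.IsPlusLoop (V v)) {v : ℝ}
    (hv : v ∈ J) (hd : HasDerivAt (fun s : ℝ => (V s : Loop A))
      ((-(2 * Complex.I)) • ((V v : Loop A) * a v)) v) :
    (-(2 * Complex.I)) • a v ∈ lieAlg M.plusLoops := by
  refine mem_lieAlg_of_hasDerivAt M.isClosed_plusLoops
    (γ := fun s => (((V v)⁻¹ : (Loop A)ˣ) : Loop A) * (V (v + s) : Loop A)) (by simp) ?_ ?_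
  · have h1 : HasDerivAt (fun s : ℝ => (V (v + s) : Loop A))
        ((-(2 * Complex.I)) • ((V v : Loop A) * a v)) 0 := by
      have h2 : HasDerivAt (fun s : ℝ => (V s : Loop A))
        ((-(2 * Complex.I)) • ((V v : Loop A) * a v)) (v + 0) := by simpa using hd
      exact h2.comp_const_add v 0
    have h3 := h1.const_mul (((V v)⁻¹ : (Loop A)ˣ) : Loop A)
    rwa [mul_smul_comm, Units.inv_mul_cancel_left] at h3
  · have h1 : Tendsto (fun s : ℝ => v + s) (𝓝 0) (𝓝 v) := by
      have : Continuous fun s : ℝ => v + s := by fun_prop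
      simpa using this.tendsto 0
    filter_upwards [h1.eventually (hJo.mem_nhds hv)] with s hs
    exact ⟨(V v)⁻¹ * V (v + s), M.plusLoops.mul_mem (M.plusLoops.inv_mem (hV v hv)) (hV _ hs), rfl⟩

/-- If `W⁻¹ D W = ā + a` with a plus loop `W`, a Laurent polynomial `D` of degree one and `a` in the
Lie algebra of the plus loops, then `a` is linear in `λ`: both `a` and `λ ā` extend holomorphically
to the disk. -/
theorem eq_linearLoop_of_conj_add {W : (Loop A)ˣ} (hW : W ∈ M.plusLoops) {b : Loop A}
    (hb : b ∈ discAlgebra A) (hb' : ∀ l, b l ∈ lieAlg M.GC ∧ M.dσ (b l) = b (M.omega * l))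
    {Dm D₀ Dp : A} (hD : ∀ l : Circle, D l = (l : ℂ)⁻¹ • Dm + D₀ + (l : ℂ) • Dp)
    (hL : ∀ l : Circle, ((W⁻¹ : (Loop A)ˣ) : Loop A) l * D l * (W : Loop A) l =
      M.conj (b l) + b l) :
    ∃ b₀ ∈ M.gr 0, ∃ b₁ ∈ M.gr 1, b = linearLoop b₀ b₁ := by
  let δ : Loop A := linearLoop 0 1 * (((W⁻¹ : (Loop A)ˣ) : Loop A) * D * (W : Loop A) - b)
  have hδl : ∀ l : Circle, δ l = (l : ℂ) • M.conj (b l) := by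
    intro l
    have h1 : δ l = (0 + (l : ℂ) • (1 : A)) *
      (((W⁻¹ : (Loop A)ˣ) : Loop A) l * D l * (W : Loop A) l - b l) := rfl
    rw [h1, hL l, zero_add, smul_mul_assoc, one_mul, add_sub_cancel_right]
  have hδ : δ ∈ discAlgebra A := by
    have h1 : linearLoop 0 1 * (((W⁻¹ : (Loop A)ˣ) : Loop A) * D * (W : Loop A)) =
        ((W⁻¹ : (Loop A)ˣ) : Loop A) *
          (linearLoop Dm D₀ + linearLoop 0 1 * linearLoop 0 Dp) * (W : Loop A) := by
      ext l
      have hl : (l : ℂ)⁻¹ * (l : ℂ) = 1 := inv_mul_cancel₀ l.coe_ne_zero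
      simp only [ContinuousMap.mul_apply, ContinuousMap.add_apply, linearLoop_apply, hD l, zero_add,
        smul_mul_assoc, one_mul, mul_add, add_mul, mul_smul_comm, smul_smul, hl, one_smul]
    have h2 : δ = ((W⁻¹ : (Loop A)ˣ) : Loop A) *
          (linearLoop Dm D₀ + linearLoop 0 1 * linearLoop 0 Dp) * (W : Loop A) -
          linearLoop 0 1 * b := by
      rw [← h1, ← mul_sub]
    rw [h2]
    exact sub_mem (mul_mem (mul_mem
      (M.mem_discAlgebra_of_mem_plusLoops (M.plusLoops.inv_mem hW))
      (add_mem (linearLoop_mem_discAlgebra _ _)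
        (mul_mem (linearLoop_mem_discAlgebra _ _) (linearLoop_mem_discAlgebra _ _))))
      (M.mem_discAlgebra_of_mem_plusLoops hW)) (mul_mem (linearLoop_mem_discAlgebra _ _) hb)
  obtain ⟨b₀, b₁, rfl⟩ := eq_linearLoop_of_forall_dual hb hδ fun φ => by
    -- the functional conjugate to `φ` with respect to `𝔤`
    let ψ₀ : M.complexAlg →ₗ[ℂ] ℂ :=
      { toFun := fun X => starRingEnd ℂ (φ (M.conj X))
        map_add' := fun X Y => by
          rw [Submodule.coe_add, M.conj_add X.2 Y.2, map_add, map_add]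
        map_smul' := fun c X => by
          rw [Submodule.coe_smul, M.conj_smul c X.2, map_smul, smul_eq_mul, map_mul,
            Complex.conj_conj]
          rfl }
    obtain ⟨ψ, hψ⟩ := LinearMap.exists_extend ψ₀
    refine ⟨ψ, fun l => ?_⟩
    have hmem : δ l ∈ M.complexAlg := by
      rw [hδl]
      exact M.complexAlg.smul_mem _ (M.conj_mem (hb' l).1)
    have h1 : ψ (δ l) = starRingEnd ℂ (φ (M.conj (δ l))) := LinearMap.congr_fun hψ ⟨δ l, hmem⟩
    have hl : (l : ℂ) * starRingEnd ℂ (l : ℂ) = 1 := by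
      rw [Complex.mul_conj, Circle.normSq_coe, Complex.ofReal_one]
    rw [h1, Complex.conj_conj, hδl, M.conj_smul _ (M.conj_mem (hb' l).1), M.conj_conj (hb' l).1,
      map_smul, smul_eq_mul, ← mul_assoc, hl, one_mul]
  have hmem : ∀ l : Circle, b₀ + (l : ℂ) • b₁ ∈ M.complexAlg := fun l => (hb' l).1
  have hp := hmem 1
  have hm := hmem (Circle.exp Real.pi)
  rw [Circle.coe_exp, Complex.exp_pi_mul_I, neg_one_smul] at hm
  rw [Circle.coe_one, one_smul] at hp
  have h0 : b₀ ∈ M.complexAlg := by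
    have : b₀ = (1 / 2 : ℂ) • ((b₀ + b₁) + (b₀ + -b₁)) := by module
    rw [this]
    exact M.complexAlg.smul_mem _ (M.complexAlg.add_mem hp hm)
  have h1 : b₁ ∈ M.complexAlg := by
    have : b₁ = (b₀ + b₁) - b₀ := by module
    rw [this]
    exact M.complexAlg.sub_mem hp h0
  have heig := laurent_eq_zero (X := (0 : A)) (Y := M.dσ b₀ - b₀)
    (Z := M.dσ b₁ - (M.omega : ℂ) • b₁) fun l => by
      have := (hb' l).2
      rw [linearLoop_apply, linearLoop_apply, map_add, map_smul, Circle.coe_mul,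
        ← sub_eq_zero] at this
      rw [smul_zero, zero_add]
      calc M.dσ b₀ - b₀ + (l : ℂ) • (M.dσ b₁ - (M.omega : ℂ) • b₁) =
          M.dσ b₀ + (l : ℂ) • M.dσ b₁ - (b₀ + ((M.omega : ℂ) * (l : ℂ)) • b₁) := by module
        _ = 0 := this
  exact ⟨b₀, ⟨h0, by rw [zpow_zero, one_smul]; exact sub_eq_zero.1 heig.2.1⟩, b₁,
    ⟨h1, by rw [zpow_one]; exact sub_eq_zero.1 heig.2.2⟩, rfl⟩

/-- The map `F(z) = exp(zD) V(v)` is smooth. -/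
theorem contDiffAt_exp_mul (hJo : IsOpen J) (hV : ContDiffOn ℝ ∞ (fun v => (V v : Loop A)) J)
    (hF : ∀ z ∈ strip J, (F z : Loop A) = exp (z • D) * (V z.im : Loop A)) {z : ℂ}
    (hz : z ∈ strip J) : ContDiffAt ℝ ∞ (fun z => (F z : Loop A)) z := by
  have h1 : (fun z => (F z : Loop A)) =ᶠ[𝓝 z] fun z => exp (z • D) * (V z.im : Loop A) := by
    filter_upwards [(isOpen_strip hJo).mem_nhds hz] with w hw using hF w hw
  refine ContDiffAt.congr_of_eventuallyEq ?_ h1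
  have h2 : ContDiffAt ℝ ∞ (fun v => (V v : Loop A)) z.im := hV.contDiffAt (hJo.mem_nhds hz)
  exact (contDiff_exp_smul D).contDiffAt.mul
    (ContDiffAt.comp (g := fun v => (V v : Loop A)) z h2 Complex.imCLM.contDiff.contDiffAt)

theorem exp_mul_translate
    (hF : ∀ z ∈ strip J, (F z : Loop A) = exp (z • D) * (V z.im : Loop A)) (t : ℝ) {z : ℂ}
    (hz : z ∈ strip J) : (F (z + t) : Loop A) = exp (t • D) * (F z : Loop A) := by
  rw [hF _ (add_real_mem_strip hz t), hF z hz, add_comm z, exp_smul_add, exp_ofReal_smul, mul_assoc]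
  simp

theorem mcForm_one_exp_mul (hJo : IsOpen J) (hV : ContDiffOn ℝ ∞ (fun v => (V v : Loop A)) J)
    (hF : ∀ z ∈ strip J, (F z : Loop A) = exp (z • D) * (V z.im : Loop A)) {z : ℂ}
    (hz : z ∈ strip J) : mcForm (fun z => (F z : Loop A)) 1 z =
      (((V z.im)⁻¹ : (Loop A)ˣ) : Loop A) * D * (V z.im : Loop A) := by
  rw [mcForm_one_of_translate
    (fun z hz => (contDiffAt_exp_mul hJo hV hF hz).differentiableAt (by simp))
    (fun t z hz => exp_mul_translate hF t hz) hz]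
  have h1 : F z = expLoop (z • D) * V z.im := Units.ext (hF z hz)
  have h2 : D * (expLoop (z • D) : Loop A) = (expLoop (z • D) : Loop A) * D :=
    (commute_exp_smul z D).eq
  rw [h1, Ring.inverse_unit, mul_inv_rev, Units.val_mul, Units.val_mul, mul_assoc, mul_assoc,
    ← mul_assoc D, h2, mul_assoc, Units.inv_mul_cancel_left, ← mul_assoc]

theorem mcForm_I_exp_mul (hJo : IsOpen J) (hV : ContDiffOn ℝ ∞ (fun v => (V v : Loop A)) J)
    (hVa : ∀ v ∈ J, HasDerivAt (fun s : ℝ => (V s : Loop A))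
      ((-(2 * Complex.I)) • ((V v : Loop A) * a v)) v)
    (hF : ∀ z ∈ strip J, (F z : Loop A) = exp (z • D) * (V z.im : Loop A)) {z : ℂ}
    (hz : z ∈ strip J) : mcForm (fun z => (F z : Loop A)) Complex.I z =
      Complex.I • ((((V z.im)⁻¹ : (Loop A)ˣ) : Loop A) * D * (V z.im : Loop A)) -
        (2 * Complex.I) • a z.im := by
  have hd : ∀ z ∈ strip J, DifferentiableAt ℝ (fun z => (F z : Loop A)) z :=
    fun z hz => (contDiffAt_exp_mul hJo hV hF hz).differentiableAt (by simp)
  set v : ℝ := z.im with hv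
  have hvJ : v ∈ J := hz
  have hz' := I_mul_mem_strip hvJ
  have htrans := mcForm_translate hJo (fun z _ => (F z).isUnit) hd
    (fun t z hz => exp_mul_translate hF t hz) hz' z.re Complex.I
  rw [I_mul_im_add_re] at htrans
  rw [htrans]
  have h1 := hasDerivAt_imaginary_axis (hd _ hz')
  have h2 : HasDerivAt (fun s : ℝ => exp ((Complex.I * s) • D))
      (exp ((Complex.I * v) • D) * (Complex.I • D)) v := by
    have h3 := hasDerivAt_exp_smul_const (Complex.I • D) v
    have h4 : ∀ s : ℝ, s • Complex.I • D = (Complex.I * s) • D := by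
      intro s
      rw [← Complex.coe_smul, smul_smul, mul_comm]
    simpa only [h4] using h3
  have h5 := h2.fun_mul (hVa v hvJ)
  have h6 : (fun s : ℝ => (F (Complex.I * s) : Loop A)) =ᶠ[𝓝 v]
      fun s : ℝ => exp ((Complex.I * s) • D) * (V s : Loop A) := by
    filter_upwards [hJo.mem_nhds hvJ] with s hs
    rw [hF _ (I_mul_mem_strip hs)]
    simp
  have h7 := (h1.congr_of_eventuallyEq h6.symm).unique h5
  have h8 : F (Complex.I * v) = expLoop ((Complex.I * v) • D) * V v := by
    refine Units.ext ?_
    rw [hF _ hz']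
    simp
  rw [mcForm, h7, h8, Ring.inverse_unit, mul_inv_rev, Units.val_mul, ← expLoop_val]
  simp only [mul_add, mul_assoc, Units.inv_mul_cancel_left, mul_smul_comm, smul_mul_assoc]
  module

/-- If the product `exp(zD) V(Im z)`, with plus loops `V`, has a Maurer-Cartan form with components
`ā` and `a`, then its values are real loops, and every loop parameter gives an equivariant primitive
harmonic map. -/
theorem equivariant_of_iwasawa {B : A →ₗ[ℝ] A →ₗ[ℝ] ℝ} (hB : M.IsInvariantMetric B)
    (hJo : IsOpen J) (hJ : J.OrdConnected) (hJ0 : (0 : ℝ) ∈ J) {Dm D₀ Dp : A}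
    (hDreal : M.IsRealLoopAlg D)
    (hD : ∀ l : Circle, D l = (l : ℂ)⁻¹ • Dm + D₀ + (l : ℂ) • Dp)
    (hV : ContDiffOn ℝ ∞ (fun v => (V v : Loop A)) J)
    (hVplus : ∀ v ∈ J, M.IsPlusLoop (V v)) (hV0 : V 0 = 1)
    (hVa : ∀ v ∈ J, HasDerivAt (fun s : ℝ => (V s : Loop A))
      ((-(2 * Complex.I)) • ((V v : Loop A) * a v)) v)
    (hL : ∀ v ∈ J, ∀ l : Circle,
      (((V v)⁻¹ : (Loop A)ˣ) : Loop A) l * D l * (V v : Loop A) l = M.conj (a v l) + a v l)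
    (hF : ∀ z ∈ strip J, (F z : Loop A) = exp (z • D) * (V z.im : Loop A)) :
    (∀ z ∈ strip J, M.IsIwasawa (exp (z • D)) (F z) (V z.im)⁻¹) ∧
    (∀ (l : Circle) (f : ℂ → M.Quot),
      (∀ z ∈ strip J, ∃ g : M.G, ((g : Aˣ) : A) = (F z : Loop A) l ∧ f z = (g : M.Quot)) →
      M.IsPrimitiveHarmonic B (strip J) f ∧ M.IsTE (strip J) f) ∧
    (∀ z ∈ strip J, ∀ l : Circle,
      mcZbar (fun w => (F w : Loop A) l) z = a z.im l ∧
      mcZ (fun w => (F w : Loop A) l) z = M.conj (a z.im l) ∧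
      M.conj (a z.im l) =
        (((V z.im)⁻¹ : (Loop A)ˣ) : Loop A) l * D l * (V z.im : Loop A) l
          - (Complex.I / 2) • ((((V z.im)⁻¹ : (Loop A)ˣ) : Loop A) l *
              deriv (fun s : ℝ => (V s : Loop A) l) z.im)) := by
  have hS := isOpen_strip hJo
  have hsm : ∀ z ∈ strip J, ContDiffAt ℝ ∞ (fun z => (F z : Loop A)) z :=
    fun z hz => contDiffAt_exp_mul hJo hV hF hz
  have hsm' : ∀ z ∈ strip J, DifferentiableAt ℝ (fun z => (F z : Loop A)) z :=
    fun z hz => (hsm z hz).differentiableAt (by simp)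
  have htr : ∀ t : ℝ, ∀ z ∈ strip J, (F (z + t) : Loop A) = exp (t • D) * (F z : Loop A) :=
    fun t z hz => exp_mul_translate hF t hz
  have hF0 : F 0 = 1 := by
    refine Units.ext ?_
    rw [hF 0 hJ0]
    simp [hV0]
  -- the loop `a v` lies in the Lie algebra of the plus loops
  have hmem : ∀ v ∈ J, a v ∈ discAlgebra A ∧
      ∀ l, a v l ∈ lieAlg M.GC ∧ M.dσ (a v l) = a v (M.omega * l) := by
    intro v hv
    have h1 := smul_mem_lieAlg_plusLoops hJo hVplus hv (hVa v hv)
    have hc : (Complex.I / 2) * (-(2 * Complex.I)) = 1 := by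
      have := Complex.I_mul_I
      linear_combination -this
    have h2 : a v = (Complex.I / 2) • ((-(2 * Complex.I)) • a v) := by
      rw [smul_smul, hc, one_smul]
    have h3 := M.mem_lieAlg_twistedLoops.1 (lieAlg_mono M.plusLoops_le_twistedLoops h1)
    have h4 : ∀ l, a v l = (Complex.I / 2) • ((-(2 * Complex.I)) • a v) l :=
      fun l => congrArg (fun γ : Loop A => γ l) h2
    refine ⟨?_, fun l => ⟨?_, ?_⟩⟩
    · rw [h2]
      exact (discAlgebra A).smul_mem (M.mem_discAlgebra_of_mem_lieAlg_plusLoops h1) _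
    · rw [h4]
      exact M.complexAlg.smul_mem _ (h3 l).1
    · rw [h4, map_smul, (h3 l).2, ← h4]
  have hlin : ∀ v ∈ J, ∃ b₀ ∈ M.gr 0, ∃ b₁ ∈ M.gr 1, a v = linearLoop b₀ b₁ := fun v hv =>
    eq_linearLoop_of_conj_add (hVplus v hv) (hmem v hv).1 (hmem v hv).2 hD (hL v hv)
  -- the Maurer-Cartan form of `F`
  have hZbar : ∀ z ∈ strip J, mcZbar (fun z => (F z : Loop A)) z = a z.im := by
    intro z hz
    rw [mcZbar_eq, mcForm_one_exp_mul hJo hV hF hz, mcForm_I_exp_mul hJo hV hVa hF hz]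
    have := Complex.I_mul_I
    match_scalars
    · linear_combination this / 2
    · linear_combination -this
  have hZ : ∀ z ∈ strip J, mcZ (fun z => (F z : Loop A)) z =
      (((V z.im)⁻¹ : (Loop A)ˣ) : Loop A) * D * (V z.im : Loop A) - a z.im := by
    intro z hz
    rw [mcZ_eq, mcForm_one_exp_mul hJo hV hF hz, mcForm_I_exp_mul hJo hV hVa hF hz]
    have := Complex.I_mul_I
    match_scalars
    · linear_combination -this / 2
    · linear_combination this
  have hZbarl : ∀ z ∈ strip J, ∀ l, mcZbar (fun w => (F w : Loop A) l) z = a z.im l := by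
    intro z hz l
    rw [mcZbar_eval (hsm' z hz) (F z).isUnit, hZbar z hz]
  have hZl : ∀ z ∈ strip J, ∀ l, mcZ (fun w => (F w : Loop A) l) z = M.conj (a z.im l) := by
    intro z hz l
    rw [mcZ_eval (hsm' z hz) (F z).isUnit, hZ z hz]
    exact sub_eq_of_eq_add (hL _ hz l)
  have hreal : ∀ z ∈ strip J, F z ∈ M.realLoops := by
    refine mem_realLoops_of_translate hJ hJ0 hsm hF0 hDreal htr fun v hv l => ?_
    have hz := I_mul_mem_strip hv
    have hIl : ∀ l, (mcForm (fun z => (F z : Loop A)) Complex.I (Complex.I * v)) l =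
        Complex.I • (M.conj (a v l) - a v l) := by
      intro l
      rw [← mcForm_eval (hsm' _ hz) (F (Complex.I * v)).isUnit, mcForm_I_eq, hZl _ hz, hZbarl _ hz]
      simp
    rw [hIl, hIl]
    refine ⟨M.I_smul_conj_sub_mem ((hmem v hv).2 l).1, ?_⟩
    rw [map_smul, map_sub, M.dσ_conj ((hmem v hv).2 l).1, ((hmem v hv).2 l).2]
  refine ⟨fun z hz => ⟨M.mem_realLoops.1 (hreal z hz), M.plusLoops.inv_mem (hVplus _ hz), ?_⟩,
    fun l f hf => ⟨?_, ?_⟩, fun z hz l => ⟨hZbarl z hz l, hZl z hz l, ?_⟩⟩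
  · rw [hF z hz, mul_assoc, Units.mul_inv, mul_one]
  · have hfr : M.IsFrame (strip J) f (fun w => (F w : Loop A) l) :=
      ⟨fun z hz => (contDiffAt_eval (hsm z hz) l).contDiffWithinAt, hf⟩
    -- the `𝔪`- and `𝔨`-parts of the Maurer-Cartan form
    have hparts : ∀ z ∈ strip J, ∃ b₀ ∈ M.gr 0, ∃ b₁ ∈ M.gr 1, a z.im = linearLoop b₀ b₁ ∧
        M.mPart (mcZbar (fun w => (F w : Loop A) l) z) = (l : ℂ) • b₁ ∧
        M.kPart (mcZbar (fun w => (F w : Loop A) l) z) = b₀ ∧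
        M.mPart (mcZ (fun w => (F w : Loop A) l) z) = (l : ℂ)⁻¹ • M.conj b₁ ∧
        M.kPart (mcZ (fun w => (F w : Loop A) l) z) = M.conj b₀ := by
      intro z hz
      obtain ⟨b₀, h0, b₁, h1, e⟩ := hlin z.im hz
      have h1' := M.gr_smul (l : ℂ) h1
      have h0c : M.conj b₀ ∈ M.gr 0 := by simpa using M.gr_conj h0
      have h1c := M.gr_smul ((l : ℂ)⁻¹) (M.gr_conj h1)
      have hc : M.conj (linearLoop b₀ b₁ l) = M.conj b₀ + (l : ℂ)⁻¹ • M.conj b₁ := by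
        rw [linearLoop_apply, M.conj_add h0.1 h1'.1, M.conj_smul _ h1.1,
          ← Circle.coe_inv_eq_conj, Circle.coe_inv]
      refine ⟨b₀, h0, b₁, h1, e, ?_⟩
      rw [hZbarl z hz, hZl z hz, e, hc, linearLoop_apply]
      simp only [← mPartL_apply, ← kPartL_apply, map_add]
      simp only [mPartL_apply, kPartL_apply, M.mPart_of_mem_gr_zero h0, M.mPart_of_mem_gr_zero h0c,
        M.kPart_of_mem_gr_zero h0, M.kPart_of_mem_gr_zero h0c,
        M.mPart_of_mem_gr M.omega_zpow_one_ne h1', M.kPart_of_mem_gr M.omega_zpow_one_ne h1',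
        M.mPart_of_mem_gr M.omega_zpow_neg_one_ne h1c,
        M.kPart_of_mem_gr M.omega_zpow_neg_one_ne h1c]
      simp
    have hgr : ∀ z ∈ strip J, M.mPart (mcZ (fun w => (F w : Loop A) l) z) ∈ M.gr (-1) ∧
        M.mPart (mcZbar (fun w => (F w : Loop A) l) z) ∈ M.gr 1 := by
      intro z hz
      obtain ⟨b₀, h0, b₁, h1, -, e1, -, e2, -⟩ := hparts z hz
      rw [e1, e2]
      exact ⟨M.gr_smul _ (M.gr_conj h1), M.gr_smul _ h1⟩
    -- the associated family at `μ` is the Maurer-Cartan form of the frame at `μλ`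
    have hfamily : ∀ m : Circle, ∀ z ∈ strip J,
        M.alphaZ (fun w => (F w : Loop A) l) m z = mcZ (fun w => (F w : Loop A) (m * l)) z ∧
        M.alphaZbar (fun w => (F w : Loop A) l) m z =
          mcZbar (fun w => (F w : Loop A) (m * l)) z := by
      intro m z hz
      obtain ⟨b₀, h0, b₁, h1, e, e1, e2, e3, e4⟩ := hparts z hz
      rw [alphaZ, alphaZbar, e1, e2, e3, e4, hZl z hz, hZbarl z hz, e, linearLoop_apply,
        M.conj_add h0.1 (M.complexAlg.smul_mem _ h1.1), M.conj_smul _ h1.1,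
        ← Circle.coe_inv_eq_conj, Circle.coe_inv, Circle.coe_mul, mul_inv, smul_smul, smul_smul]
      exact ⟨add_comm _ _, add_comm _ _⟩
    have hint : ∀ m : Circle, IsIntegrableForm (strip J) (M.alphaZ (fun w => (F w : Loop A) l) m)
        (M.alphaZbar (fun w => (F w : Loop A) l) m) := by
      intro m z hz
      have h1 := isIntegrableForm_mc (S := strip J) (G := fun w => (F w : Loop A) (m * l))
        (fun z hz => contDiffAt_eval (hsm z hz) _) (fun z _ => (evalUnit (m * l) (F z)).isUnit) z hz
      have e1 : M.alphaZ (fun w => (F w : Loop A) l) m =ᶠ[𝓝 z]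
          mcZ (fun w => (F w : Loop A) (m * l)) := by
        filter_upwards [hS.mem_nhds hz] with w hw using (hfamily m w hw).1
      have e2 : M.alphaZbar (fun w => (F w : Loop A) l) m =ᶠ[𝓝 z]
          mcZbar (fun w => (F w : Loop A) (m * l)) := by
        filter_upwards [hS.mem_nhds hz] with w hw using (hfamily m w hw).2
      rwa [dZ_congr e2, dZbar_congr e1, e1.eq_of_nhds, e2.eq_of_nhds]
    exact ⟨isHarmonic_of_isHarmonicFrame hB hS hfr (isHarmonicFrame_of_isIntegrableForm
      (fun z hz => hfr.contDiffAt hS hz) (fun z hz => hfr.isUnit hz) hint), _, hfr, hgr, hint⟩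
  · have hR : ∀ t : ℝ, evalUnit l (expLoop (t • D)) ∈ M.G := by
      intro t
      obtain ⟨g, hg, e⟩ := (M.mem_realLoops.1 (expLoop_mem_realLoops hDreal t)).2 l
      have : evalUnit l (expLoop (t • D)) = g := Units.ext e.symm
      rwa [this]
    refine ⟨fun t => ⟨_, hR t⟩, ?_, fun s t => ?_, fun t z hz => ?_⟩
    · refine Continuous.subtype_mk ?_ _
      refine (Units.isOpenEmbedding_val (R := A)).isInducing.continuous_iff.2 ?_
      refine (continuous_evalLoop l).comp (f := fun t : ℝ => exp (t • D)) ?_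
      exact continuous_iff_continuousAt.2 fun t => (hasDerivAt_exp_smul_const D t).continuousAt
    · refine Subtype.ext ?_
      show evalUnit l (expLoop ((s + t) • D)) =
        evalUnit l (expLoop (s • D)) * evalUnit l (expLoop (t • D))
      rw [← map_mul]
      congr 1
      refine Units.ext ?_
      rw [Units.val_mul, expLoop_val, expLoop_val, expLoop_val, ← exp_ofReal_smul,
        ← exp_ofReal_smul, ← exp_ofReal_smul, ← exp_smul_add, Complex.ofReal_add]
    · obtain ⟨g, hg, e⟩ := hf z hz
      obtain ⟨g', hg', e'⟩ := hf (z + t) (add_real_mem_strip hz t)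
      rw [e, e']
      have : g' = ⟨_, hR t⟩ * g := by
        refine Subtype.ext (Units.ext ?_)
        rw [hg', htr t z hz, ContinuousMap.mul_apply, ← hg]
        rfl
      rw [this]
      rfl
  · have h1 := (hasDerivAt_eval (hVa z.im hz) l).deriv
    rw [h1, hL _ hz l, ContinuousMap.smul_apply, ContinuousMap.mul_apply, mul_smul_comm, smul_smul,
      ← mul_assoc, ← ContinuousMap.mul_apply, Units.inv_mul, ContinuousMap.one_apply, one_mul]
    have hc : (Complex.I / 2) * (-(2 * Complex.I)) = 1 := by
      have := Complex.I_mul_I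
      linear_combination -this
    rw [hc, one_smul, add_sub_cancel_right]

end KSymmetricSpace

end

theorem mainTheorem6 {A : Type*} [NormedRing A] [NormedAlgebra ℂ A] [FiniteDimensional ℂ A]
    (M : KSymmetricSpace A) (B : A →ₗ[ℝ] A →ₗ[ℝ] ℝ) (hB : M.IsInvariantMetric B) :
    -- Part (1)
    (∀ (J : Set ℝ), IsOpen J → J.OrdConnected → (0 : ℝ) ∈ J →
      ∀ (f : ℂ → M.Quot) (F : ℂ → (Loop A)ˣ) (D : Loop A),
        M.IsPrimitiveHarmonic B (strip J) f → M.IsTE (strip J) f →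
        M.IsExtendedFrame (strip J) f F →
        (∀ t : ℝ, ∀ z ∈ strip J,
          (F (z + t) : Loop A) = NormedSpace.exp (t • D) * (F z : Loop A)) →
        -- the Delaunay potential
        M.IsRealLoopAlg D ∧
        (∀ l : Circle,
          D l = M.alphaZ (fun w => (F w : Loop A) 1) l 0
            + M.alphaZbar (fun w => (F w : Loop A) 1) l 0 ∧
          D l = (l : ℂ)⁻¹ • M.mPart (mcZ (fun w => (F w : Loop A) 1) 0)
            + M.kPart (mcZ (fun w => (F w : Loop A) 1) 0)
            + M.kPart (mcZbar (fun w => (F w : Loop A) 1) 0)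
            + (l : ℂ) • M.mPart (mcZbar (fun w => (F w : Loop A) 1) 0)) ∧
        -- the factor `V(v, λ) = exp (-iv D(λ)) F(iv, λ)`
        ∃ V : ℝ → (Loop A)ˣ,
          (∀ v ∈ J, (V v : Loop A) =
            NormedSpace.exp (-(Complex.I * v) • D) * (F (Complex.I * v) : Loop A)) ∧
          ContDiffOn ℝ ∞ (fun v => (V v : Loop A)) J ∧
          (∀ v ∈ J, M.IsPlusLoop (V v)) ∧
          V 0 = 1 ∧
          (∀ z ∈ strip J, ∀ l : Circle,
            HasDerivAt (fun s : ℝ => (V s : Loop A) l)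
              ((-(2 * Complex.I)) • ((V z.im : Loop A) l *
                M.alphaZbar (fun w => (F w : Loop A) 1) l z)) z.im ∧
            M.alphaZ (fun w => (F w : Loop A) 1) l z
                + M.alphaZbar (fun w => (F w : Loop A) 1) l z =
              (((V z.im)⁻¹ : (Loop A)ˣ) : Loop A) l * D l * (V z.im : Loop A) l) ∧
          (∀ z ∈ strip J,
            (F z : Loop A) = NormedSpace.exp (z • D) * (V z.im : Loop A) ∧
            M.IsIwasawa (NormedSpace.exp (z • D)) (F z) (V z.im)⁻¹)) ∧
    -- Part (2)
    (∀ (D : Loop A) (Dm D₀ Dp : A) (ε : ℝ) (V : ℝ → (Loop A)ˣ) (a : ℝ → Loop A),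
        M.IsRealLoopAlg D →
        D₀ ∈ M.kAlg → Dm ∈ M.mAlgC → Dp ∈ M.mAlgC →
        (∀ l : Circle, D l = (l : ℂ)⁻¹ • Dm + D₀ + (l : ℂ) • Dp) →
        0 < ε →
        ContDiffOn ℝ ∞ (fun v => (V v : Loop A)) (Set.Ioo (-ε) ε) →
        (∀ v ∈ Set.Ioo (-ε) ε, M.IsPlusLoop (V v)) →
        V 0 = 1 →
        -- `a` is the loop-valued function denoted `α̃''`
        (∀ v ∈ Set.Ioo (-ε) ε,
          HasDerivAt (fun s : ℝ => (V s : Loop A))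
            ((-(2 * Complex.I)) • ((V v : Loop A) * a v)) v) →
        (∀ v ∈ Set.Ioo (-ε) ε, ∀ l : Circle,
          (((V v)⁻¹ : (Loop A)ˣ) : Loop A) l * D l * (V v : Loop A) l =
            M.conj (a v l) + a v l) →
        ∀ F : ℂ → (Loop A)ˣ,
          (∀ z ∈ strip (Set.Ioo (-ε) ε),
            (F z : Loop A) = NormedSpace.exp (z • D) * (V z.im : Loop A)) →
          (∀ z ∈ strip (Set.Ioo (-ε) ε),
            M.IsIwasawa (NormedSpace.exp (z • D)) (F z) (V z.im)⁻¹) ∧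
          (∀ (l : Circle) (f : ℂ → M.Quot),
            (∀ z ∈ strip (Set.Ioo (-ε) ε),
              ∃ g : M.G, ((g : Aˣ) : A) = (F z : Loop A) l ∧ f z = (g : M.Quot)) →
            M.IsPrimitiveHarmonic B (strip (Set.Ioo (-ε) ε)) f ∧
            M.IsTE (strip (Set.Ioo (-ε) ε)) f) ∧
          (∀ z ∈ strip (Set.Ioo (-ε) ε), ∀ l : Circle,
            mcZbar (fun w => (F w : Loop A) l) z = a z.im l ∧
            mcZ (fun w => (F w : Loop A) l) z = M.conj (a z.im l) ∧
            M.conj (a z.im l) =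
              (((V z.im)⁻¹ : (Loop A)ˣ) : Loop A) l * D l * (V z.im : Loop A) l
                - (Complex.I / 2) • ((((V z.im)⁻¹ : (Loop A)ˣ) : Loop A) l *
                    deriv (fun s : ℝ => (V s : Loop A) l) z.im))) := by
  refine ⟨fun J hJo hJ hJ0 f F D hf _ hF htr =>
    KSymmetricSpace.iwasawa_of_equivariant hJo hJ hJ0 hf hF htr, ?_⟩
  intro D Dm D₀ Dp ε V a hDreal _ _ _ hD hε hV hVplus hV0 hVa hL F hF
  exact KSymmetricSpace.equivariant_of_iwasawa hB isOpen_Ioo Set.ordConnected_Ioo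
    ⟨by linarith, hε⟩ hDreal hD hV hVplus hV0 hVa hL hF
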